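/- Let $n\ge 3$. For a holomorphic function $f$ defined near a matrix $X$ let $\nabla f(X)$ be its gradient with respect to the trace form $\langle A,B\rangle=\operatorname{Tr}(AB)$, i.e. $(\nabla f)_{ij}=\partial f/\partial x_{ji}$, and put $\nabla^L f=\nabla f\cdot X$, $\nabla^R f=X\cdot\nabla f$. For $N\ge1$ let $S=E_{21}+E_{32}+\dots+E_{N,N-1}$, $\gamma(A)=SAS^T$, $\gamma^*(A)=S^TAS$ on $\mathfrak{gl}_N$, and let $\pi_>,\pi_0,\pi_<$ be the projections onto strictly upper triangular, diagonal and strictly lower triangular matrices. Define the Cremmer–Gervais operators $$R_+=R_0\pi_0+\tfrac1{1-\gamma}\pi_>-\tfrac{\gamma^*}{1-\gamma^*}\pi_<,\qquad \bar R_+=\bar R_0\pi_0+\tfrac1{1-\gamma^*}\pi_>-\tfrac{\gamma}{1-\gamma}\pi_<,$$ $$R_0(\eta)=\tfrac{N-1}{2N}\operatorname{Tr}\eta\cdot\mathbf 1+\tfrac1N\bigl(\operatorname{Tr}\eta\cdot D-\operatorname{Tr}(D\eta)\cdot\mathbf 1\bigr)-\tfrac{\gamma^*}{1-\gamma^*}\eta,\qquad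 D=\operatorname{diag}(N,\dots,2,1),$$ $$\bar R_0(\eta)=\tfrac{N-1}{2N}\operatorname{Tr}\eta\cdot\mathbf 1+\tfrac1N\bigl(\operatorname{Tr}\eta\cdot \bar D-\operatorname{Tr}(\bar D\eta)\cdot\mathbf 1\bigr)-\tfrac{\gamma}{1-\gamma}\eta,\qquad \bar D=\operatorname{diag}(1,2,\dots,N).$$ Equip $GL_n$ with the bracket (with $N=n$) $$\{f_1,f_2\}=\langle\bar R_+(\nabla^Lf_1),\nabla^Lf_2\rangle-\langle R_+(\nabla^Rf_1),\nabla^Rf_2\rangle,$$ and $GL_{n-1}$ with the dual bracket (with $N=n-1$) $$\{f_1,f_2\}^\dagger=\langle R_+([\nabla f_1,U]),[\nabla f_2,U]\rangle-\langle[\nabla f_1,U],\nabla f_2\cdot U\rangle .$$ Let $\bar{\mathcal R}_{n-1}$ be the space of rational functions $\bar M(\lambda)=\bar q(\lambda)/p(\lambda)$ with $p$ monic of degree $n-1$ and $\bar q$ of degree at most $n-1$ coprime with $p$; it is an open subset of the space of coefficients $(p_0,\dots,p_{n-2},\bar q_0,\dots,\bar q_{n-1})$. Write $\bar M(\lambda)=\sum_{i\ge0}\bar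 h_i\lambda^{-i}$ at infinity. The functions $\bar h_0,\dots,\bar h_{2n-2}$ are local coordinates on $\bar{\mathcal R}_{n-1}$, and $\{\cdot,\cdot\}^T$ is the skew-symmetric biderivation determined by $\{\bar h_i,\bar h_j\}^T=\sum_{k=i}^{j-1}\bar h_{k+1}\bar h_{i+j-k-1}$ for $i<j$. Define rational maps as follows. For $X\in GL_n$ with $x_{1n}x_{n1}\neq0$ let $$X_L=X_{[2,n]}^{[1,n-1]}-X_{[2,n]}^{[n,n]}x_{1n}^{-1}X_{[1,1]}^{[1,n-1]},\qquad X_R=X_{[1,n-1]}^{[2,n]}-X_{[1,n-1]}^{[1,1]}x_{n1}^{-1}X_{[n,n]}^{[2,n]},\qquad \Psi'(X)=X_LX_R^{-1},$$ where lower indices denote rows and upper indices denote columns. For $X\in GL_n$ with $x_{1n}\ne0$ let $\Psi''(X)=\bar q/p$ with $\bar q_i=x_{n,i+1}/x_{1n}$, $p_i=x_{1,i+1}/x_{1n}$, $0\le i\le n-1$; its domain consists of those $X$ for which $\bar q$ and $p$ are coprime. A map is called Poisson if it is holomorphic on its domain, takes values in the indicated target, and $\{f_1\circ\Phi,f_2\circ\Phi\}(X)=\{f_1,f_2\}_{\rm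 target}(\Phi(X))$ for every point $X$ of the domain and all functions $f_1,f_2$ complex differentiable at $\Phi(X)$. Then: (i) $\Psi':(GL_n,\{\cdot,\cdot\})\to(GL_{n-1},-\{\cdot,\cdot\}^\dagger)$ is Poisson. (ii) $\Psi'':(GL_n,\{\cdot,\cdot\})\to(\bar{\mathcal R}_{n-1},\{\cdot,\cdot\}^T)$ is Poisson. (iii) On $GL_{n-1}\times\bar{\mathcal R}_{n-1}$ with the product of the brackets $-\{\cdot,\cdot\}^\dagger$ and $\{\cdot,\cdot\}^T$, the function $\det U-\bar q(0)$ has zero bracket, at every point of the fibre product $\{\det U=\bar q(0)\}$, with every function differentiable there, so the product bracket descends to the fibre product; and the combined map $\Psi=(\Psi',\Psi'')$, defined on the intersection of the two domains, takes values in this fibre product and is Poisson. -/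

import Mathlib

open Matrix

noncomputable section

namespace CremmerGervais

/-- Complex `n × n` matrices. -/
abbrev Mat (n : ℕ) : Type := Matrix (Fin n) (Fin n) ℂ

/-! ### Gradients, and the operators entering the Cremmer--Gervais R-matrices -/

/-- The gradient of `f` at `X` with respect to the trace form: the matrix with
`Tr (grad f X * H) = df_X(H)` for all `H`, i.e. `(grad f X) i j = ∂f/∂x_{ji}`. The left gradient
`∇ᴸ f`, given by `Tr (∇ᴸ f(X) ξ) = d/dt f(X exp(tξ))` at `t = 0`, is then `grad f X * X`, and the
right gradient `∇ᴿ f`, given by `Tr (∇ᴿ f(X) ξ) = d/dt f(exp(tξ) X)` at `t = 0`, is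
`X * grad f X`. -/
def grad {n : ℕ} (f : Mat n → ℂ) (X : Mat n) : Mat n :=
  Matrix.of fun i j => fderiv ℂ f X (Matrix.single j i 1)

/-- The invariant form `⟨A, B⟩ = Tr (A B)`. -/
def form {n : ℕ} (A B : Mat n) : ℂ := (A * B).trace

/-- The commutator `[A, B]`. -/
def comm {n : ℕ} (A B : Mat n) : Mat n := A * B - B * A

/-- The projection on strictly upper triangular matrices. -/
def upperPart {n : ℕ} (A : Mat n) : Mat n := Matrix.of fun i j => if i < j then A i j else 0

/-- The projection on strictly lower triangular matrices. -/
def lowerPart {n : ℕ} (A : Mat n) : Mat n := Matrix.of fun i j => if j < i then A i j else 0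

/-- The projection on diagonal matrices. -/
def diagPart {n : ℕ} (A : Mat n) : Mat n := Matrix.of fun i j => if i = j then A i j else 0

/-- The lower shift matrix `S = E_{21} + E_{32} + ⋯ + E_{n,n-1}`. -/
def shift (n : ℕ) : Mat n := Matrix.of fun i j => if (i : ℕ) = (j : ℕ) + 1 then 1 else 0

/-- The map `γ(A) = S A Sᵀ` induced by the Cremmer--Gervais triple `α_i ↦ α_{i+1}`. -/
def gamma (n : ℕ) : Module.End ℂ (Mat n) where
  toFun A := shift n * A * (shift n)ᵀ
  map_add' A B := by simp [Matrix.mul_add, Matrix.add_mul]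
  map_smul' c A := by simp

/-- The adjoint map `γ*(A) = Sᵀ A S`. -/
def gammaStar (n : ℕ) : Module.End ℂ (Mat n) where
  toFun A := (shift n)ᵀ * A * shift n
  map_add' A B := by simp [Matrix.mul_add, Matrix.add_mul]
  map_smul' c A := by simp

/-- For a nilpotent operator `T` on `n × n` matrices with `T ^ n = 0`, this is `1 / (1 - T)`. -/
def resolvent {n : ℕ} (T : Module.End ℂ (Mat n)) : Module.End ℂ (Mat n) :=
  ∑ k ∈ Finset.range n, T ^ k

lemma gamma_pow_eq_zero (n : ℕ) : gamma n ^ n = 0 := by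
  have key : ∀ (k : ℕ) (A : Mat n) (i j : Fin n), (i : ℕ) < k → (gamma n ^ k) A i j = 0 := by
    intro k
    induction k with
    | zero => intro A i j h; omega
    | succ k ih =>
      intro A i j h
      rw [pow_succ']
      change (shift n * (gamma n ^ k) A * (shift n)ᵀ) i j = 0
      rw [Matrix.mul_apply]
      refine Finset.sum_eq_zero fun l _ => ?_
      rw [Matrix.mul_apply, Finset.sum_eq_zero, zero_mul]
      intro r _
      by_cases hr : (i : ℕ) = (r : ℕ) + 1
      · rw [ih A r l (by omega), mul_zero]
      · simp [shift, hr]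
  ext A i j
  exact key n _ i j i.isLt

lemma gammaStar_pow_eq_zero (n : ℕ) : gammaStar n ^ n = 0 := by
  have key : ∀ (k : ℕ) (A : Mat n) (i j : Fin n), n ≤ (i : ℕ) + k →
      (gammaStar n ^ k) A i j = 0 := by
    intro k
    induction k with
    | zero => intro A i j h; omega
    | succ k ih =>
      intro A i j h
      rw [pow_succ']
      change ((shift n)ᵀ * (gammaStar n ^ k) A * shift n) i j = 0
      rw [Matrix.mul_apply]
      refine Finset.sum_eq_zero fun l _ => ?_
      rw [Matrix.mul_apply, Finset.sum_eq_zero, zero_mul]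
      intro r _
      by_cases hr : (r : ℕ) = (i : ℕ) + 1
      · rw [ih A r l (by omega), mul_zero]
      · simp [shift, hr]
  ext A i j
  exact key n _ i j (by omega)

lemma one_sub_mul_resolvent {n : ℕ} (T : Module.End ℂ (Mat n)) (h : T ^ n = 0) :
    (1 - T) * resolvent T = 1 ∧ resolvent T * (1 - T) = 1 := by
  constructor
  · rw [resolvent, mul_neg_geom_sum, h, sub_zero]
  · rw [resolvent, geom_sum_mul_neg, h, sub_zero]

/-- The Cartan part of an R-operator,
`R₀(η) = (n-1)/(2n) Tr η · 1 + 1/n (Tr η · D - Tr (D η) · 1) - T/(1 - T) η`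
for diagonal `η`, where `D` is the diagonal matrix with entries `d`. -/
def cartanPart {n : ℕ} (T : Module.End ℂ (Mat n)) (d : Fin n → ℂ) (η : Mat n) : Mat n :=
  (((n : ℂ) - 1) / (2 * n) * η.trace) • (1 : Mat n)
    + (1 / (n : ℂ)) • (η.trace • Matrix.diagonal d
        - (Matrix.diagonal d * η).trace • (1 : Mat n))
    - (T * resolvent T) η

/-- The operator `R₊ = R₀ π₀ + 1/(1-γ) π_> - γ*/(1-γ*) π_<` on `gl_n` of the Cremmer--Gervais
triple, with `D = diag(n, …, 2, 1)`. -/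
def rPlus {n : ℕ} (η : Mat n) : Mat n :=
  cartanPart (gammaStar n) (fun i => (n : ℂ) - (i : ℕ)) (diagPart η)
    + resolvent (gamma n) (upperPart η)
    - (gammaStar n * resolvent (gammaStar n)) (lowerPart η)

/-- The operator `R̄₊ = R̄₀ π₀ + 1/(1-γ*) π_> - γ/(1-γ) π_<` on `gl_n` of the `w₀`-conjugate
(equivalently, adjoint) triple, with `D = diag(1, 2, …, n)`. -/
def rPlusBar {n : ℕ} (η : Mat n) : Mat n :=
  cartanPart (gamma n) (fun i => ((i : ℕ) : ℂ) + 1) (diagPart η)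
    + resolvent (gammaStar n) (upperPart η)
    - (gamma n * resolvent (gamma n)) (lowerPart η)

/-! ### The brackets on `GL_n` -/

/-- The bracket `{f, g} = ⟨R̄₊(∇ᴸf), ∇ᴸg⟩ - ⟨R₊(∇ᴿf), ∇ᴿg⟩` at `X`. -/
def bracket {n : ℕ} (f g : Mat n → ℂ) (X : Mat n) : ℂ :=
  form (rPlusBar (grad f X * X)) (grad g X * X) - form (rPlus (X * grad f X)) (X * grad g X)

/-- The dual bracket `{f, g}† = ⟨R₊([∇f, U]), [∇g, U]⟩ - ⟨[∇f, U], ∇g · U⟩` at `U`. -/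
def dualBracket {n : ℕ} (f g : Mat n → ℂ) (U : Mat n) : ℂ :=
  form (rPlus (comm (grad f U) U)) (comm (grad g U) U) - form (comm (grad f U) U) (grad g U * U)

/-- The opposite dual bracket `-{·,·}†`. -/
def negDualBracket {n : ℕ} (f g : Mat n → ℂ) (U : Mat n) : ℂ := -dualBracket f g U

/-- `GL_n` as an open set of matrices. -/
def GLSet (n : ℕ) : Set (Mat n) := {X | X.det ≠ 0}

/-! ### The space of rational functions and its bracket -/

/-- Coefficients of a rational function `M(λ) = q(λ)/p(λ)` with `p` monic of degree `m` and `q` of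
degree at most `m`: the coordinate `Sum.inl i` is the coefficient of `λ^i` in `p` (`i < m`), the
coordinate `Sum.inr i` is the coefficient of `λ^i` in `q` (`i ≤ m`). -/
abbrev Coeffs (m : ℕ) : Type := (Fin m ⊕ Fin (m + 1)) → ℂ

/-- The monic denominator. -/
def denom {m : ℕ} (c : Coeffs m) : Polynomial ℂ :=
  Polynomial.X ^ m + ∑ i : Fin m, Polynomial.C (c (Sum.inl i)) * Polynomial.X ^ (i : ℕ)

/-- The numerator. -/
def numer {m : ℕ} (c : Coeffs m) : Polynomial ℂ :=
  ∑ i : Fin (m + 1), Polynomial.C (c (Sum.inr i)) * Polynomial.X ^ (i : ℕ)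

/-- The space of rational functions `q/p` with `p` monic of degree `m`, `deg q ≤ m`, and `p`, `q`
coprime. Such a representation of a rational function is unique, so the space is an open subset of
the space of coefficients. -/
def RatSet (m : ℕ) : Set (Coeffs m) := {c | IsCoprime (numer c) (denom c)}

/-- The coefficient `h_k` of the Laurent expansion `M(λ) = ∑_{k ≥ 0} h_k λ^{-k}` at infinity. In
the variable `t = λ⁻¹` one has `M = (t^m q(1/t)) / (t^m p(1/t))`, a quotient of two reflected
polynomials with the constant term of the denominator equal to one. -/
def moment {m : ℕ} (k : ℕ) (c : Coeffs m) : ℂ :=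
  PowerSeries.coeff k
    (((Polynomial.reflect m (numer c) : Polynomial ℂ) : PowerSeries ℂ)
      * ((Polynomial.reflect m (denom c) : Polynomial ℂ) : PowerSeries ℂ)⁻¹)

/-- The brackets of moments: `{h_i, h_j} = ∑_{k=i}^{j-1} h_{k+1} h_{i+j-k-1}` for `i < j`, extended
by skew-symmetry. -/
def momentBracket {m : ℕ} (c : Coeffs m) (i j : ℕ) : ℂ :=
  if i < j then ∑ k ∈ Finset.Ico i j, moment (k + 1) c * moment (i + j - k - 1) c
  else -∑ k ∈ Finset.Ico j i, moment (k + 1) c * moment (i + j - k - 1) c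

/-- The index set of the coefficients, enumerated as `0, 1, …, 2m`. -/
def momentIndex {m : ℕ} (a : Fin m ⊕ Fin (m + 1)) : ℕ := (finSumFinEquiv a : Fin (m + (m + 1)))

/-- The partial derivative of a function on the space of coefficients. -/
def partialDeriv {m : ℕ} (f : Coeffs m → ℂ) (c : Coeffs m) (a : Fin m ⊕ Fin (m + 1)) : ℂ :=
  fderiv ℂ f c (Pi.single a 1)

/-- The Jacobian matrix of the moments `h_0, …, h_{2m}` with respect to the coefficients. It is
invertible at every point of `RatSet m`: there the moments form a local coordinate system. -/
def momentJacobian {m : ℕ} (c : Coeffs m) :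
    Matrix (Fin m ⊕ Fin (m + 1)) (Fin m ⊕ Fin (m + 1)) ℂ :=
  Matrix.of fun a b => partialDeriv (moment (momentIndex a)) c b

/-- The matrix of the bracket in the coordinates `h_0, …, h_{2m}`. -/
def momentMatrix {m : ℕ} (c : Coeffs m) :
    Matrix (Fin m ⊕ Fin (m + 1)) (Fin m ⊕ Fin (m + 1)) ℂ :=
  Matrix.of fun a b => momentBracket c (momentIndex a) (momentIndex b)

/-- The matrix `J⁻¹ Ω J⁻ᵀ` of the same bracket in the coordinates given by the coefficients. -/
def coeffMatrix {m : ℕ} (c : Coeffs m) :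
    Matrix (Fin m ⊕ Fin (m + 1)) (Fin m ⊕ Fin (m + 1)) ℂ :=
  (momentJacobian c)⁻¹ * momentMatrix c * ((momentJacobian c)⁻¹)ᵀ

/-- The bracket `{f, g}ᵀ` at the rational function with coefficients `c`: the biderivation whose
values on the local coordinates `h_0, …, h_{2m}` are given by `momentBracket`. -/
def ratBracket {m : ℕ} (f g : Coeffs m → ℂ) (c : Coeffs m) : ℂ :=
  partialDeriv f c ⬝ᵥ (coeffMatrix c *ᵥ partialDeriv g c)

/-! ### Poisson maps and the fibre product -/

/-- `φ` is a holomorphic Poisson map from `(D, BE)` to `(T, BF)`. Brackets are evaluated pointwise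
and depend on the differentials of their arguments only. -/
structure IsPoissonMapOn {E F : Type*} [AddCommGroup E] [Module ℂ E] [TopologicalSpace E]
    [AddCommGroup F] [Module ℂ F] [TopologicalSpace F] (D : Set E) (T : Set F)
    (BE : (E → ℂ) → (E → ℂ) → E → ℂ) (BF : (F → ℂ) → (F → ℂ) → F → ℂ) (φ : E → F) : Prop where
  mapsTo : Set.MapsTo φ D T
  differentiableAt : ∀ x ∈ D, DifferentiableAt ℂ φ x
  bracket_comp : ∀ x ∈ D, ∀ f g : F → ℂ, DifferentiableAt ℂ f (φ x) →
    DifferentiableAt ℂ g (φ x) → BE (f ∘ φ) (g ∘ φ) x = BF f g (φ x)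

/-- The product of the brackets `-{·,·}†` and `{·,·}ᵀ`. -/
def prodBracket {m : ℕ} (f g : Mat m × Coeffs m → ℂ) (z : Mat m × Coeffs m) : ℂ :=
  negDualBracket (fun U => f (U, z.2)) (fun U => g (U, z.2)) z.1
    + ratBracket (fun c => f (z.1, c)) (fun c => g (z.1, c)) z.2

/-- The fibre product over `ℂ` defined by the functions `det U` and `q(0)`. -/
def fibreProduct (m : ℕ) : Set (Mat m × Coeffs m) :=
  {z | z.1 ∈ GLSet m ∧ z.2 ∈ RatSet m ∧ z.1.det = (numer z.2).eval 0}

/-! ### The maps, for `n = m + 1` -/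

/-- The Schur complement of `x_{1n}`,
`X_{[2,n]}^{[1,n-1]} - X_{[2,n]}^{[n,n]} x_{1n}⁻¹ X_{[1,1]}^{[1,n-1]}`. -/
def schurL {m : ℕ} (X : Mat (m + 1)) : Mat m :=
  Matrix.of fun i j => X i.succ j.castSucc
    - X i.succ (Fin.last m) * (X 0 (Fin.last m))⁻¹ * X 0 j.castSucc

/-- The Schur complement of `x_{n1}`,
`X_{[1,n-1]}^{[2,n]} - X_{[1,n-1]}^{[1,1]} x_{n1}⁻¹ X_{[n,n]}^{[2,n]}`. -/
def schurR {m : ℕ} (X : Mat (m + 1)) : Mat m :=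
  Matrix.of fun i j => X i.castSucc j.succ
    - X i.castSucc 0 * (X (Fin.last m) 0)⁻¹ * X (Fin.last m) j.succ

/-- The map `X ↦ U = X_L X_R⁻¹`. -/
def psiOne {m : ℕ} (X : Mat (m + 1)) : Mat m := schurL X * (schurR X)⁻¹

/-- The map `X ↦ q/p` with `q_i = x_{n,i+1} / x_{1n}` and `p_i = x_{1,i+1} / x_{1n}`. The
leading coefficient of `p` is `x_{1n} / x_{1n} = 1`. -/
def psiTwo {m : ℕ} (X : Mat (m + 1)) : Coeffs m :=
  Sum.elim (fun i : Fin m => X 0 i.castSucc / X 0 (Fin.last m))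
    (fun i : Fin (m + 1) => X (Fin.last m) i / X 0 (Fin.last m))

/-- The combined map. -/
def psi {m : ℕ} (X : Mat (m + 1)) : Mat m × Coeffs m := (psiOne X, psiTwo X)

/-- The domain of the rational map `psiOne` from `GL_n` to `GL_{n-1}`. -/
def domOne (m : ℕ) : Set (Mat (m + 1)) :=
  {X | X ∈ GLSet (m + 1) ∧ X 0 (Fin.last m) ≠ 0 ∧ X (Fin.last m) 0 ≠ 0}

/-- The domain of the rational map `psiTwo` from `GL_n` to the space of rational functions: the
points where the formulas make sense and give coprime polynomials. -/
def domTwo (m : ℕ) : Set (Mat (m + 1)) :=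
  {X | X ∈ GLSet (m + 1) ∧ X 0 (Fin.last m) ≠ 0 ∧ psiTwo X ∈ RatSet m}

end CremmerGervais

end

/-!
The maps are treated pointwise: a bracket at a point is a bilinear form on covectors, and both
sides of each identity are compared on the pullback of an arbitrary pair of covectors.

The operators `R₊` and `R̄₊` enter through the relations of `ShiftPair` only: on traceless
matrices, and modulo scalar matrices, each of them is an operator `R` with `R + R* = 1` that sends
`(1 - T) B` to `B` and `(1 - T') B` to `-T' B` whenever the boundary terms vanish, `{T, T'} = {γ,
γ*}`.

For `U = X_L X_R⁻¹` and a covector `ξ` at `U`, the left gradient is, up to a first and a last row,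
`(1 - γ)` of the block `c = X_R⁻¹ ξ X_L`, and the right gradient is, up to a first and a last
column, the difference of the lower right block `U ξ` and the upper left block `ξ U`. One of the
two border lines is killed by the R-operator and the other one is fixed, so the pairings can be
evaluated (`form_rPlusBar_left`, `form_rPlus_right`); comparing the operators `R₊` of `gl_n` and
of `gl_{n-1}` (`form_rPlus_core`) gives minus the dual bracket plus two traces. The traces agree
because the matrices occurring in them are intertwined by `X_L` and `X_R`
(`rowFirst_mul_inclLast_mul_schurL`, `rowLast_mul_inclFirst_mul_schurR`). The same formulas show
that functions of `U` Poisson commute with functions of the first and the last row of `X` that are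
homogeneous of degree zero (`bivector_pullOne_pullTwo`).

For functions of `q/p` the gradients have rank two and the bracket at `X` depends on `p` and `q`
only; call the resulting bivector `ratBivector`. The differential of the moment `h_k` has the
Laurent coefficients of `1/p` and `-M/p` as its components, so that the entries of its left
gradient depend on `k` and on the row through their sum only; applying `1/(1 - γ*)` amounts to
summation along diagonals, and the bracket of `h_k` and `h_l` satisfies a recursion along `k + l =
const` that identifies it with the given quadratic expression (`ratBivector_momentCovec`). The
Jacobian of `h_0, …, h_{2m}` is invertible: if the first `2m + 1` coefficients of `δM = (p δq - q
δp)/p²` vanish, then `p δq = q δp`, and coprimality forces `δp = δq = 0`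
(`det_momentJacobian_ne_zero`). Hence `ratBivector` is the bracket on the space of rational
functions (`coeffMatrix_eq`).

Finally `det U` has gradient `adj U`, which commutes with `U`, and the constant coefficient of `q`
is annihilated by `ratBivector` (`ratBivector_single_left`), so `det U - q(0)` is a Casimir
function; both `det U` and `q(0)` equal `x_{n1} / x_{1n}` at the image of `X` (`det_psiOne`).
-/

noncomputable section

namespace CremmerGervais

/-! ### Triangular parts and the trace form -/

lemma form_comm {n : ℕ} (A B : Mat n) : form A B = form B A := Matrix.trace_mul_comm A B

lemma form_add_left {n : ℕ} (A B C : Mat n) : form (A + B) C = form A C + form B C := by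
  simp [form, Matrix.add_mul]

lemma form_add_right {n : ℕ} (A B C : Mat n) : form A (B + C) = form A B + form A C := by
  simp [form, Matrix.mul_add]

lemma form_sub_left {n : ℕ} (A B C : Mat n) : form (A - B) C = form A C - form B C := by
  simp [form, Matrix.sub_mul]

lemma form_sub_right {n : ℕ} (A B C : Mat n) : form A (B - C) = form A B - form A C := by
  simp [form, Matrix.mul_sub]

lemma form_smul_left {n : ℕ} (s : ℂ) (A B : Mat n) : form (s • A) B = s * form A B := by
  simp [form]

lemma form_smul_right {n : ℕ} (s : ℂ) (A B : Mat n) : form A (s • B) = s * form A B := by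
  simp [form]

lemma form_neg_left {n : ℕ} (A B : Mat n) : form (-A) B = -form A B := by simp [form]

lemma form_neg_right {n : ℕ} (A B : Mat n) : form A (-B) = -form A B := by simp [form]

lemma form_one_left {n : ℕ} (B : Mat n) : form 1 B = B.trace := by simp [form]

lemma form_one_right {n : ℕ} (B : Mat n) : form B 1 = B.trace := by simp [form]

lemma form_sum_left {n : ℕ} {ι : Type*} (s : Finset ι) (A : ι → Mat n) (B : Mat n) :
    form (∑ i ∈ s, A i) B = ∑ i ∈ s, form (A i) B := by
  simp [form, Finset.sum_mul, Matrix.trace_sum]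

lemma form_sum_right {n : ℕ} {ι : Type*} (s : Finset ι) (A : Mat n) (B : ι → Mat n) :
    form A (∑ i ∈ s, B i) = ∑ i ∈ s, form A (B i) := by
  simp [form, Finset.mul_sum, Matrix.trace_sum]

/-- The projection on strictly upper triangular matrices, as a linear map. -/
def upperLin (n : ℕ) : Module.End ℂ (Mat n) where
  toFun := upperPart
  map_add' A B := by ext i j; simp only [upperPart, of_apply, Matrix.add_apply]; split_ifs <;> simp
  map_smul' c A := by ext i j; simp [upperPart]

/-- The projection on strictly lower triangular matrices, as a linear map. -/
def lowerLin (n : ℕ) : Module.End ℂ (Mat n) where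
  toFun := lowerPart
  map_add' A B := by ext i j; simp only [lowerPart, of_apply, Matrix.add_apply]; split_ifs <;> simp
  map_smul' c A := by ext i j; simp [lowerPart]

/-- The projection on diagonal matrices, as a linear map. -/
def diagLin (n : ℕ) : Module.End ℂ (Mat n) where
  toFun := diagPart
  map_add' A B := by ext i j; simp only [diagPart, of_apply, Matrix.add_apply]; split_ifs <;> simp
  map_smul' c A := by ext i j; simp [diagPart]

lemma upperPart_eq {n : ℕ} (A : Mat n) : upperPart A = upperLin n A := rfl

lemma lowerPart_eq {n : ℕ} (A : Mat n) : lowerPart A = lowerLin n A := rfl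

lemma diagPart_eq {n : ℕ} (A : Mat n) : diagPart A = diagLin n A := rfl

lemma upper_add_diag_add_lower {n : ℕ} (A : Mat n) :
    upperLin n A + diagLin n A + lowerLin n A = A := by
  ext i j
  rcases lt_trichotomy i j with h | h | h
  · simp [← upperPart_eq, ← lowerPart_eq, ← diagPart_eq, upperPart, lowerPart, diagPart, h,
      h.ne, h.not_gt]
  · simp [← upperPart_eq, ← lowerPart_eq, ← diagPart_eq, upperPart, lowerPart, diagPart, h]
  · simp [← upperPart_eq, ← lowerPart_eq, ← diagPart_eq, upperPart, lowerPart, diagPart, h,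
      h.ne', h.not_gt]

lemma form_eq_sum {n : ℕ} (A B : Mat n) : form A B = ∑ i, ∑ j, A i j * B j i := by
  simp [form, Matrix.trace, Matrix.mul_apply]

lemma form_upperLin {n : ℕ} (A B : Mat n) : form (upperLin n A) B = form A (lowerLin n B) := by
  rw [form_eq_sum, form_eq_sum]
  refine Finset.sum_congr rfl fun i _ => Finset.sum_congr rfl fun j _ => ?_
  simp only [← upperPart_eq, ← lowerPart_eq, upperPart, lowerPart, of_apply]
  split_ifs <;> simp

lemma form_lowerLin {n : ℕ} (A B : Mat n) : form (lowerLin n A) B = form A (upperLin n B) := by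
  rw [form_comm, ← form_upperLin, form_comm]

lemma form_diagLin {n : ℕ} (A B : Mat n) : form (diagLin n A) B = form A (diagLin n B) := by
  rw [form_eq_sum, form_eq_sum]
  refine Finset.sum_congr rfl fun i _ => Finset.sum_congr rfl fun j _ => ?_
  simp only [← diagPart_eq, diagPart, of_apply, eq_comm (a := j)]
  split_ifs <;> simp

lemma trace_diagLin {n : ℕ} (A : Mat n) : (diagLin n A).trace = A.trace := by
  simp [Matrix.trace, ← diagPart_eq, diagPart]

lemma diagLin_diagLin {n : ℕ} (A : Mat n) : diagLin n (diagLin n A) = diagLin n A := by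
  ext i j; simp only [← diagPart_eq, diagPart, of_apply]; split_ifs <;> rfl

/-! ### The shift operators -/

/-- The inclusion of `ℂᵐ` in `ℂᵐ⁺¹` onto the first `m` coordinates. -/
def inclFirst (m : ℕ) : Matrix (Fin (m + 1)) (Fin m) ℂ :=
  Matrix.of fun i j => if i = j.castSucc then 1 else 0

/-- The inclusion of `ℂᵐ` in `ℂᵐ⁺¹` onto the last `m` coordinates. -/
def inclLast (m : ℕ) : Matrix (Fin (m + 1)) (Fin m) ℂ :=
  Matrix.of fun i j => if i = j.succ then 1 else 0

lemma inclFirst_transpose_mul {m : ℕ} {ι : Type*} (M : Matrix (Fin (m + 1)) ι ℂ) :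
    (inclFirst m)ᵀ * M = Matrix.of fun i j => M i.castSucc j := by
  ext i j; simp [inclFirst, Matrix.mul_apply]

lemma inclLast_transpose_mul {m : ℕ} {ι : Type*} (M : Matrix (Fin (m + 1)) ι ℂ) :
    (inclLast m)ᵀ * M = Matrix.of fun i j => M i.succ j := by
  ext i j; simp [inclLast, Matrix.mul_apply]

lemma mul_inclFirst {m : ℕ} {ι : Type*} (M : Matrix ι (Fin (m + 1)) ℂ) :
    M * inclFirst m = Matrix.of fun i j => M i j.castSucc := by
  ext i j; simp [inclFirst, Matrix.mul_apply]

lemma mul_inclLast {m : ℕ} {ι : Type*} (M : Matrix ι (Fin (m + 1)) ℂ) :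
    M * inclLast m = Matrix.of fun i j => M i j.succ := by
  ext i j; simp [inclLast, Matrix.mul_apply]

lemma inclFirst_transpose_mul_self (m : ℕ) : (inclFirst m)ᵀ * inclFirst m = 1 := by
  rw [inclFirst_transpose_mul]; ext i j; simp [inclFirst, Matrix.one_apply]

lemma inclLast_transpose_mul_self (m : ℕ) : (inclLast m)ᵀ * inclLast m = 1 := by
  rw [inclLast_transpose_mul]; ext i j; simp [inclLast, Matrix.one_apply]

lemma inclFirst_transpose_mul_inclLast (m : ℕ) : (inclFirst m)ᵀ * inclLast m = shift m := by
  rw [inclFirst_transpose_mul]; ext i j; simp [inclLast, shift, Fin.ext_iff]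

lemma inclLast_transpose_mul_inclFirst (m : ℕ) : (inclLast m)ᵀ * inclFirst m = (shift m)ᵀ := by
  rw [← inclFirst_transpose_mul_inclLast, Matrix.transpose_mul, Matrix.transpose_transpose]

lemma inclLast_mul_inclFirst_transpose (m : ℕ) :
    inclLast m * (inclFirst m)ᵀ = shift (m + 1) := by
  ext i j
  simp only [Matrix.mul_apply, inclLast, inclFirst, shift, of_apply, transpose_apply]
  induction i using Fin.cases with
  | zero => simp [(Fin.succ_ne_zero _).symm]
  | succ i =>
    rw [Finset.sum_eq_single i (fun b _ hb => by simp [hb.symm]) (by simp)]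
    simp [Fin.ext_iff, eq_comm]

lemma gamma_apply {n : ℕ} (A : Mat n) : gamma n A = shift n * A * (shift n)ᵀ := rfl

lemma gammaStar_apply {n : ℕ} (A : Mat n) : gammaStar n A = (shift n)ᵀ * A * shift n := rfl

/-- The block inclusion `A ↦ J A Jᵀ` of the first `m` rows and columns. -/
def embFirst {m : ℕ} (A : Mat m) : Mat (m + 1) := inclFirst m * A * (inclFirst m)ᵀ

/-- The block inclusion `A ↦ J A Jᵀ` of the last `m` rows and columns. -/
def embLast {m : ℕ} (A : Mat m) : Mat (m + 1) := inclLast m * A * (inclLast m)ᵀ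

/-- The upper left `m × m` block. -/
def resFirst {m : ℕ} (A : Mat (m + 1)) : Mat m := (inclFirst m)ᵀ * A * inclFirst m

/-- The lower right `m × m` block. -/
def resLast {m : ℕ} (A : Mat (m + 1)) : Mat m := (inclLast m)ᵀ * A * inclLast m

lemma gamma_eq_emb {m : ℕ} (A : Mat (m + 1)) : gamma (m + 1) A = embLast (resFirst A) := by
  simp only [gamma_apply, ← inclLast_mul_inclFirst_transpose, embLast, resFirst,
    Matrix.transpose_mul, Matrix.transpose_transpose, Matrix.mul_assoc]

lemma gammaStar_eq_emb {m : ℕ} (A : Mat (m + 1)) :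
    gammaStar (m + 1) A = embFirst (resLast A) := by
  simp only [gammaStar_apply, ← inclLast_mul_inclFirst_transpose, embFirst, resLast,
    Matrix.transpose_mul, Matrix.transpose_transpose, Matrix.mul_assoc]

lemma embFirst_apply {m : ℕ} (A : Mat m) (i j : Fin m) :
    embFirst A i.castSucc j.castSucc = A i j := by
  simp [embFirst, inclFirst, Matrix.mul_apply]

lemma embFirst_last_left {m : ℕ} (A : Mat m) (j : Fin (m + 1)) :
    embFirst A (Fin.last m) j = 0 := by
  simp [embFirst, inclFirst, Matrix.mul_apply, Fin.ext_iff, (Fin.is_lt _).ne']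

lemma embFirst_last_right {m : ℕ} (A : Mat m) (i : Fin (m + 1)) :
    embFirst A i (Fin.last m) = 0 := by
  simp [embFirst, inclFirst, Matrix.mul_apply, Fin.ext_iff, (Fin.is_lt _).ne']

lemma embLast_apply {m : ℕ} (A : Mat m) (i j : Fin m) :
    embLast A i.succ j.succ = A i j := by
  simp [embLast, inclLast, Matrix.mul_apply]

lemma embLast_zero_left {m : ℕ} (A : Mat m) (j : Fin (m + 1)) : embLast A 0 j = 0 := by
  simp [embLast, inclLast, Matrix.mul_apply, Fin.ext_iff]

lemma embLast_zero_right {m : ℕ} (A : Mat m) (i : Fin (m + 1)) : embLast A i 0 = 0 := by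
  simp [embLast, inclLast, Matrix.mul_apply, Fin.ext_iff]

lemma resFirst_apply {m : ℕ} (A : Mat (m + 1)) (i j : Fin m) :
    resFirst A i j = A i.castSucc j.castSucc := by
  rw [resFirst, mul_inclFirst, inclFirst_transpose_mul]; rfl

lemma resLast_apply {m : ℕ} (A : Mat (m + 1)) (i j : Fin m) :
    resLast A i j = A i.succ j.succ := by
  rw [resLast, mul_inclLast, inclLast_transpose_mul]; rfl

lemma ext_succ {m : ℕ} {A B : Mat (m + 1)} (h0 : ∀ j, A 0 j = B 0 j) (h1 : ∀ i, A i 0 = B i 0)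
    (h : ∀ i j : Fin m, A i.succ j.succ = B i.succ j.succ) : A = B := by
  ext i j
  induction i using Fin.cases with
  | zero => exact h0 j
  | succ i =>
    induction j using Fin.cases with
    | zero => exact h1 _
    | succ j => exact h i j

lemma ext_castSucc {m : ℕ} {A B : Mat (m + 1)} (h0 : ∀ j, A (Fin.last m) j = B (Fin.last m) j)
    (h1 : ∀ i, A i (Fin.last m) = B i (Fin.last m))
    (h : ∀ i j : Fin m, A i.castSucc j.castSucc = B i.castSucc j.castSucc) : A = B := by
  ext i j
  induction i using Fin.lastCases with
  | last => exact h0 j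
  | cast i =>
    induction j using Fin.lastCases with
    | last => exact h1 _
    | cast j => exact h i j

lemma upperLin_embLast {m : ℕ} (A : Mat m) :
    upperLin (m + 1) (embLast A) = embLast (upperLin m A) := by
  apply ext_succ <;> intros <;>
    simp [← upperPart_eq, upperPart, embLast_apply, embLast_zero_left, embLast_zero_right]

lemma lowerLin_embLast {m : ℕ} (A : Mat m) :
    lowerLin (m + 1) (embLast A) = embLast (lowerLin m A) := by
  apply ext_succ <;> intros <;>
    simp [← lowerPart_eq, lowerPart, embLast_apply, embLast_zero_left, embLast_zero_right]

lemma diagLin_embLast {m : ℕ} (A : Mat m) :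
    diagLin (m + 1) (embLast A) = embLast (diagLin m A) := by
  apply ext_succ <;> intros <;>
    simp [← diagPart_eq, diagPart, embLast_apply, embLast_zero_left, embLast_zero_right]

lemma upperLin_embFirst {m : ℕ} (A : Mat m) :
    upperLin (m + 1) (embFirst A) = embFirst (upperLin m A) := by
  apply ext_castSucc <;> intros <;>
    simp [← upperPart_eq, upperPart, embFirst_apply, embFirst_last_left, embFirst_last_right]

lemma lowerLin_embFirst {m : ℕ} (A : Mat m) :
    lowerLin (m + 1) (embFirst A) = embFirst (lowerLin m A) := by
  apply ext_castSucc <;> intros <;>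
    simp [← lowerPart_eq, lowerPart, embFirst_apply, embFirst_last_left, embFirst_last_right]

lemma diagLin_embFirst {m : ℕ} (A : Mat m) :
    diagLin (m + 1) (embFirst A) = embFirst (diagLin m A) := by
  apply ext_castSucc <;> intros <;>
    simp [← diagPart_eq, diagPart, embFirst_apply, embFirst_last_left, embFirst_last_right]

lemma resFirst_upperLin {m : ℕ} (A : Mat (m + 1)) :
    resFirst (upperLin (m + 1) A) = upperLin m (resFirst A) := by
  ext i j; simp [resFirst_apply, ← upperPart_eq, upperPart]

lemma resFirst_lowerLin {m : ℕ} (A : Mat (m + 1)) :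
    resFirst (lowerLin (m + 1) A) = lowerLin m (resFirst A) := by
  ext i j; simp [resFirst_apply, ← lowerPart_eq, lowerPart]

lemma resFirst_diagLin {m : ℕ} (A : Mat (m + 1)) :
    resFirst (diagLin (m + 1) A) = diagLin m (resFirst A) := by
  ext i j; simp [resFirst_apply, ← diagPart_eq, diagPart]

lemma resLast_upperLin {m : ℕ} (A : Mat (m + 1)) :
    resLast (upperLin (m + 1) A) = upperLin m (resLast A) := by
  ext i j; simp [resLast_apply, ← upperPart_eq, upperPart]

lemma resLast_lowerLin {m : ℕ} (A : Mat (m + 1)) :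
    resLast (lowerLin (m + 1) A) = lowerLin m (resLast A) := by
  ext i j; simp [resLast_apply, ← lowerPart_eq, lowerPart]

lemma resLast_diagLin {m : ℕ} (A : Mat (m + 1)) :
    resLast (diagLin (m + 1) A) = diagLin m (resLast A) := by
  ext i j; simp [resLast_apply, ← diagPart_eq, diagPart]

lemma resFirst_embFirst {m : ℕ} (A : Mat m) : resFirst (embFirst A) = A := by
  ext i j; rw [resFirst_apply, embFirst_apply]

lemma resLast_embLast {m : ℕ} (A : Mat m) : resLast (embLast A) = A := by
  ext i j; rw [resLast_apply, embLast_apply]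

lemma resFirst_embLast {m : ℕ} (A : Mat m) : resFirst (embLast A) = gamma m A := by
  simp only [resFirst, embLast, gamma_apply, ← inclFirst_transpose_mul_inclLast,
    Matrix.transpose_mul, Matrix.transpose_transpose, Matrix.mul_assoc]

lemma resLast_embFirst {m : ℕ} (A : Mat m) : resLast (embFirst A) = gammaStar m A := by
  simp only [resLast, embFirst, gammaStar_apply, ← inclFirst_transpose_mul_inclLast,
    Matrix.transpose_mul, Matrix.transpose_transpose, Matrix.mul_assoc]

lemma gammaStar_gamma {m : ℕ} (A : Mat (m + 1)) :
    gammaStar (m + 1) (gamma (m + 1) A) = embFirst (resFirst A) := by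
  rw [gammaStar_eq_emb, gamma_eq_emb, resLast_embLast]

lemma gamma_gammaStar {m : ℕ} (A : Mat (m + 1)) :
    gamma (m + 1) (gammaStar (m + 1) A) = embLast (resLast A) := by
  rw [gammaStar_eq_emb, gamma_eq_emb, resFirst_embFirst]

lemma embFirst_resFirst {m : ℕ} {A : Mat (m + 1)} (h0 : ∀ j, A (Fin.last m) j = 0)
    (h1 : ∀ i, A i (Fin.last m) = 0) : embFirst (resFirst A) = A := by
  apply ext_castSucc <;> intros <;>
    simp [embFirst_apply, embFirst_last_left, embFirst_last_right, resFirst_apply, h0, h1]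

lemma embLast_resLast {m : ℕ} {A : Mat (m + 1)} (h0 : ∀ j, A 0 j = 0)
    (h1 : ∀ i, A i 0 = 0) : embLast (resLast A) = A := by
  apply ext_succ <;> intros <;>
    simp [embLast_apply, embLast_zero_left, embLast_zero_right, resLast_apply, h0, h1]

lemma trace_embFirst {m : ℕ} (A : Mat m) : (embFirst A).trace = A.trace := by
  rw [embFirst, Matrix.trace_mul_comm, ← Matrix.mul_assoc, inclFirst_transpose_mul_self,
    Matrix.one_mul]

lemma trace_embLast {m : ℕ} (A : Mat m) : (embLast A).trace = A.trace := by
  rw [embLast, Matrix.trace_mul_comm, ← Matrix.mul_assoc, inclLast_transpose_mul_self,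
    Matrix.one_mul]

lemma trace_gamma {m : ℕ} (A : Mat (m + 1)) :
    (gamma (m + 1) A).trace = A.trace - A (Fin.last m) (Fin.last m) := by
  rw [gamma_eq_emb, trace_embLast, Matrix.trace, Matrix.trace, Fin.sum_univ_castSucc]
  simp [resFirst_apply]

lemma trace_gammaStar {m : ℕ} (A : Mat (m + 1)) :
    (gammaStar (m + 1) A).trace = A.trace - A 0 0 := by
  rw [gammaStar_eq_emb, trace_embFirst, Matrix.trace, Matrix.trace, Fin.sum_univ_succ]
  simp [resLast_apply]

lemma form_gamma {n : ℕ} (A B : Mat n) : form (gamma n A) B = form A (gammaStar n B) := by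
  rw [form, form, gamma_apply, gammaStar_apply, Matrix.mul_assoc, Matrix.mul_assoc,
    Matrix.trace_mul_comm]
  simp only [Matrix.mul_assoc]

/-! ### R-operators of a pair of adjoint shifts -/

/-- The properties of the pair `(γ, γ*)` shared by the pair `(γ*, γ)` that are needed to compute
with the R-operators. -/
structure ShiftPair {n : ℕ} (T T' : Module.End ℂ (Mat n)) : Prop where
  pow_left : T ^ n = 0
  pow_right : T' ^ n = 0
  form_left : ∀ A B, form (T A) B = form A (T' B)
  upper_left : Commute (upperLin n) T
  upper_right : Commute (upperLin n) T'
  diag_left : Commute (diagLin n) T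
  diag_right : Commute (diagLin n) T'
  lower_left : Commute (lowerLin n) T
  lower_right : Commute (lowerLin n) T'
  diag_sum : ∀ A : Mat n, diagLin n A = A → A.trace = 0 →
    T (resolvent T A) + T' (resolvent T' A) = -A

lemma commute_gamma_upperLin (n : ℕ) : Commute (upperLin n) (gamma n) := by
  cases n with
  | zero => exact Subsingleton.elim _ _
  | succ m => ext1 A; simp [gamma_eq_emb, upperLin_embLast, resFirst_upperLin]

lemma commute_gamma_lowerLin (n : ℕ) : Commute (lowerLin n) (gamma n) := by
  cases n with
  | zero => exact Subsingleton.elim _ _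
  | succ m => ext1 A; simp [gamma_eq_emb, lowerLin_embLast, resFirst_lowerLin]

lemma commute_gamma_diagLin (n : ℕ) : Commute (diagLin n) (gamma n) := by
  cases n with
  | zero => exact Subsingleton.elim _ _
  | succ m => ext1 A; simp [gamma_eq_emb, diagLin_embLast, resFirst_diagLin]

lemma commute_gammaStar_upperLin (n : ℕ) : Commute (upperLin n) (gammaStar n) := by
  cases n with
  | zero => exact Subsingleton.elim _ _
  | succ m => ext1 A; simp [gammaStar_eq_emb, upperLin_embFirst, resLast_upperLin]

lemma commute_gammaStar_lowerLin (n : ℕ) : Commute (lowerLin n) (gammaStar n) := by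
  cases n with
  | zero => exact Subsingleton.elim _ _
  | succ m => ext1 A; simp [gammaStar_eq_emb, lowerLin_embFirst, resLast_lowerLin]

lemma commute_gammaStar_diagLin (n : ℕ) : Commute (diagLin n) (gammaStar n) := by
  cases n with
  | zero => exact Subsingleton.elim _ _
  | succ m => ext1 A; simp [gammaStar_eq_emb, diagLin_embFirst, resLast_diagLin]

lemma commute_resolvent {n : ℕ} {P T : Module.End ℂ (Mat n)} (h : Commute P T) :
    Commute P (resolvent T) :=
  Commute.sum_right _ _ _ fun _ _ => h.pow_right _

lemma resolvent_sub_map {n : ℕ} {T : Module.End ℂ (Mat n)} (h : T ^ n = 0) (A : Mat n) :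
    resolvent T (A - T A) = A :=
  LinearMap.congr_fun (one_sub_mul_resolvent T h).2 A

lemma map_resolvent {n : ℕ} {T : Module.End ℂ (Mat n)} (h : T ^ n = 0) (A : Mat n) :
    T (resolvent T A) = resolvent T A - A := by
  have := LinearMap.congr_fun (one_sub_mul_resolvent T h).1 A
  simp only [Module.End.mul_apply, LinearMap.sub_apply, Module.End.one_apply] at this
  rw [eq_sub_iff_add_eq, eq_comm, ← sub_eq_iff_eq_add', this]

lemma resolvent_of_map_eq_zero {n : ℕ} {T : Module.End ℂ (Mat n)} (h : T ^ n = 0) {A : Mat n}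
    (hA : T A = 0) : resolvent T A = A := by
  simpa [hA] using resolvent_sub_map h A

/-- If `C = 1/(1 - γ) A` with `A` diagonal and traceless, then the last entry of `C` is
`Tr (C - γ C) = 0`, hence `γ* γ C = C`. -/
lemma diag_sum_gamma {n : ℕ} (A : Mat n) (hA : diagLin n A = A) (h0 : A.trace = 0) :
    gamma n (resolvent (gamma n) A) + gammaStar n (resolvent (gammaStar n) A) = -A := by
  cases n with
  | zero => exact Subsingleton.elim _ _
  | succ m =>
    set C := resolvent (gamma (m + 1)) A with hC
    have hCA : C - gamma (m + 1) C = A := by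
      rw [hC, map_resolvent (gamma_pow_eq_zero _)]; abel
    have hd : diagLin (m + 1) C = C := by
      have := LinearMap.congr_fun (commute_resolvent (commute_gamma_diagLin (m + 1))).eq A
      simp only [Module.End.mul_apply, hA] at this
      exact this
    have hlast : C (Fin.last m) (Fin.last m) = 0 := by
      rw [← hCA, Matrix.trace_sub, trace_gamma] at h0
      linear_combination h0
    have hoff : ∀ i j, i ≠ j → C i j = 0 := by
      intro i j hij
      rw [← hd]; simp [← diagPart_eq, diagPart, hij]
    have hback : gammaStar (m + 1) (gamma (m + 1) C) = C := by
      rw [gammaStar_gamma, embFirst_resFirst]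
      · intro j
        by_cases h : Fin.last m = j
        · rw [← h, hlast]
        · exact hoff _ _ h
      · intro i
        by_cases h : i = Fin.last m
        · rw [h, hlast]
        · exact hoff _ _ h
    have h2 : resolvent (gammaStar (m + 1)) A = -gamma (m + 1) C := by
      have h3 : A = -(gamma (m + 1) C - gammaStar (m + 1) (gamma (m + 1) C)) := by
        rw [hback, ← hCA]; abel
      rw [h3, map_neg, resolvent_sub_map (gammaStar_pow_eq_zero _)]
    rw [h2, map_neg, hback]
    conv_rhs => rw [← hCA]
    abel

lemma shiftPair_gamma (n : ℕ) : ShiftPair (gamma n) (gammaStar n) where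
  pow_left := gamma_pow_eq_zero n
  pow_right := gammaStar_pow_eq_zero n
  form_left := form_gamma
  upper_left := commute_gamma_upperLin n
  upper_right := commute_gammaStar_upperLin n
  diag_left := commute_gamma_diagLin n
  diag_right := commute_gammaStar_diagLin n
  lower_left := commute_gamma_lowerLin n
  lower_right := commute_gammaStar_lowerLin n
  diag_sum := diag_sum_gamma

namespace ShiftPair

variable {n : ℕ} {T T' : Module.End ℂ (Mat n)}

lemma symm (h : ShiftPair T T') : ShiftPair T' T where
  pow_left := h.pow_right
  pow_right := h.pow_left
  form_left A B := by rw [form_comm, ← h.form_left, form_comm]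
  upper_left := h.upper_right
  upper_right := h.upper_left
  diag_left := h.diag_right
  diag_right := h.diag_left
  lower_left := h.lower_right
  lower_right := h.lower_left
  diag_sum A hA h0 := by rw [add_comm]; exact h.diag_sum A hA h0

end ShiftPair

lemma shiftPair_gammaStar (n : ℕ) : ShiftPair (gammaStar n) (gamma n) := (shiftPair_gamma n).symm

/-- The operator `R₀ π₀ + 1/(1-T) π_> - T'/(1-T') π_<`, where `R₀` is the Cartan part defined by
`T'` and the diagonal matrix with entries `d`. -/
def rOp {n : ℕ} (T T' : Module.End ℂ (Mat n)) (d : Fin n → ℂ) : Module.End ℂ (Mat n) where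
  toFun η := cartanPart T' d (diagPart η) + resolvent T (upperPart η)
    - (T' * resolvent T') (lowerPart η)
  map_add' A B := by
    simp only [upperPart_eq, lowerPart_eq, diagPart_eq, map_add, cartanPart, Matrix.trace_add,
      Matrix.mul_add]
    module
  map_smul' c A := by
    simp only [upperPart_eq, lowerPart_eq, diagPart_eq, map_smul, cartanPart, Matrix.trace_smul,
      Matrix.mul_smul, RingHom.id_apply, smul_eq_mul]
    module

lemma rPlus_eq {n : ℕ} (η : Mat n) :
    rPlus η = rOp (gamma n) (gammaStar n) (fun i => (n : ℂ) - (i : ℕ)) η := rfl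

lemma rPlusBar_eq {n : ℕ} (η : Mat n) :
    rPlusBar η = rOp (gammaStar n) (gamma n) (fun i => ((i : ℕ) : ℂ) + 1) η := rfl

namespace ShiftPair

variable {n : ℕ} {T T' : Module.End ℂ (Mat n)}

/-- On traceless matrices an R-operator is, up to a scalar matrix, given by the two geometric
series. -/
lemma exists_rOp_eq (T T' : Module.End ℂ (Mat n)) (d : Fin n → ℂ) {A : Mat n}
    (hA : A.trace = 0) : ∃ s : ℂ, rOp T T' d A = resolvent T (upperLin n A)
      - T' (resolvent T' (diagLin n A + lowerLin n A)) + s • (1 : Mat n) := by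
  refine ⟨-(1 / (n : ℂ)) * (Matrix.diagonal d * diagLin n A).trace, ?_⟩
  change cartanPart T' d (diagLin n A) + resolvent T (upperLin n A)
    - T' (resolvent T' (lowerLin n A)) = _
  have h1 : cartanPart T' d (diagLin n A)
      = (((n : ℂ) - 1) / (2 * n) * (diagLin n A).trace) • (1 : Mat n)
    + (1 / (n : ℂ)) • ((diagLin n A).trace • Matrix.diagonal d
        - (Matrix.diagonal d * diagLin n A).trace • (1 : Mat n))
    - T' (resolvent T' (diagLin n A)) := rfl
  rw [h1, trace_diagLin, hA, map_add, map_add]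
  module

lemma form_resolvent (h : ShiftPair T T') (A B : Mat n) :
    form (resolvent T A) B = form A (resolvent T' B) := by
  have key : ∀ k : ℕ, ∀ A B, form ((T ^ k) A) B = form A ((T' ^ k) B) := by
    intro k
    induction k with
    | zero => intro A B; rfl
    | succ k ih =>
      intro A B
      rw [pow_succ', pow_succ, Module.End.mul_apply, Module.End.mul_apply, h.form_left, ih]
  simp only [resolvent, LinearMap.sum_apply, form_sum_left, form_sum_right, key]

/-- The diagonal case of `R + R* = 1`, where the two sides are exchanged by `diag_sum`. -/
lemma form_diag_resolvent (h : ShiftPair T T') {A B : Mat n} (hB : B.trace = 0) :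
    form (T (resolvent T (diagLin n A))) B + form A (T (resolvent T (diagLin n B)))
      = -form A (diagLin n B) := by
  have hc : ∀ P : Module.End ℂ (Mat n), Commute (diagLin n) P → ∀ C,
      diagLin n (P C) = P (diagLin n C) := fun P hP C => LinearMap.congr_fun hP.eq C
  have hr := commute_resolvent h.diag_right
  have h1 : form (T (resolvent T (diagLin n A))) B
      = form A (T' (resolvent T' (diagLin n B))) := by
    rw [h.form_left, h.form_resolvent, form_diagLin, hc _ hr, hc _ h.diag_right]
    exact congrArg _ (LinearMap.congr_fun (commute_resolvent (Commute.refl T')).eq _).symm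
  rw [h1, ← form_add_right, add_comm, h.diag_sum _ (diagLin_diagLin B) (by rw [trace_diagLin, hB]),
    form_neg_right]

/-- On traceless matrices `R + R* = 1`. -/
lemma form_rOp (h : ShiftPair T T') (d : Fin n → ℂ) {A B : Mat n} (hA : A.trace = 0)
    (hB : B.trace = 0) : form (rOp T T' d A) B + form A (rOp T T' d B) = form A B := by
  obtain ⟨s, hs⟩ := exists_rOp_eq T T' d hA
  obtain ⟨t, ht⟩ := exists_rOp_eq T T' d hB
  have hc : ∀ P Q : Module.End ℂ (Mat n), Commute P Q → ∀ C,
      P (Q C) = Q (P C) := fun P Q hP C => LinearMap.congr_fun hP.eq C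
  have h1 : form (resolvent T (upperLin n A)) B = form A (resolvent T' (lowerLin n B)) := by
    rw [h.form_resolvent, form_upperLin, hc _ _ (commute_resolvent h.lower_right)]
  have h2 : form (resolvent T' (lowerLin n A)) B = form A (resolvent T (upperLin n B)) := by
    rw [h.symm.form_resolvent, form_lowerLin, hc _ _ (commute_resolvent h.upper_left)]
  have h3 := h.symm.form_diag_resolvent (A := A) hB
  have h4 : form A B = form A (upperLin n B) + form A (diagLin n B) + form A (lowerLin n B) := by
    rw [← form_add_right, ← form_add_right, upper_add_diag_add_lower]
  rw [map_add, map_add, map_resolvent h.pow_right (lowerLin n _)] at hs ht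
  rw [hs, ht, h4]
  simp only [form_add_left, form_add_right, form_sub_left, form_sub_right, form_smul_left,
    form_smul_right, form_one_left, form_one_right, hA, hB, h1, h2]
  linear_combination -h3 + form_lowerLin A B

/-- `R` inverts `1 - T` where the boundary terms vanish. -/
lemma exists_rOp_sub_left (h : ShiftPair T T') (d : Fin n → ℂ) {B : Mat n}
    (htr : (B - T B).trace = 0)
    (hB : T' (T (diagLin n B + lowerLin n B)) = diagLin n B + lowerLin n B) :
    ∃ s : ℂ, rOp T T' d (B - T B) = B + s • (1 : Mat n) := by
  obtain ⟨s, hs⟩ := exists_rOp_eq T T' d htr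
  refine ⟨s, ?_⟩
  have hc : ∀ P Q : Module.End ℂ (Mat n), Commute P Q → ∀ C,
      P (Q C) = Q (P C) := fun P Q hP C => LinearMap.congr_fun hP.eq C
  set C := diagLin n B + lowerLin n B with hC
  have h1 : diagLin n (B - T B) + lowerLin n (B - T B) = -(T C - T' (T C)) := by
    rw [hB, hC, map_sub, map_sub, hc _ _ h.diag_left, hc _ _ h.lower_left, map_add]; abel
  rw [hs, h1, map_sub, hc _ _ h.upper_left, resolvent_sub_map h.pow_left, map_neg,
    resolvent_sub_map h.pow_right, map_neg, hB, sub_neg_eq_add, hC, ← add_assoc,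
    upper_add_diag_add_lower]

/-- `R` sends `(1 - T') B` to `-T' B` where the boundary terms vanish. -/
lemma exists_rOp_sub_right (h : ShiftPair T T') (d : Fin n → ℂ) {B : Mat n}
    (htr : (B - T' B).trace = 0) (hB : T (T' (upperLin n B)) = upperLin n B) :
    ∃ s : ℂ, rOp T T' d (B - T' B) = -T' B + s • (1 : Mat n) := by
  obtain ⟨s, hs⟩ := exists_rOp_eq T T' d htr
  refine ⟨s, ?_⟩
  have hc : ∀ P Q : Module.End ℂ (Mat n), Commute P Q → ∀ C,
      P (Q C) = Q (P C) := fun P Q hP C => LinearMap.congr_fun hP.eq C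
  have h1 : upperLin n (B - T' B) = -(T' (upperLin n B) - T (T' (upperLin n B))) := by
    rw [hB, map_sub, hc _ _ h.upper_right]; abel
  have h2 : diagLin n (B - T' B) + lowerLin n (B - T' B)
      = (diagLin n B + lowerLin n B) - T' (diagLin n B + lowerLin n B) := by
    rw [map_sub, map_sub, hc _ _ h.diag_right, hc _ _ h.lower_right, map_add]; abel
  rw [hs, h1, h2, resolvent_sub_map h.pow_right, map_neg, resolvent_sub_map h.pow_left]
  conv_rhs => rw [← upper_add_diag_add_lower B, add_assoc, map_add]
  abel

lemma rOp_of_upper (h : ShiftPair T T') (d : Fin n → ℂ) {A : Mat n}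
    (hA : upperLin n A = A) (hT : T A = 0) : rOp T T' d A = A := by
  have h1 : diagPart A = 0 := by
    ext i j; rw [← hA]; simp only [diagPart, ← upperPart_eq, upperPart, of_apply]
    split_ifs with h1 h2 <;> simp_all
  have h2 : lowerPart A = 0 := by
    ext i j; rw [← hA]; simp only [lowerPart, ← upperPart_eq, upperPart, of_apply]
    split_ifs with h1 h2
    · exact absurd h1 h2.not_gt
    · rfl
    · rfl
  have h3 : cartanPart T' d 0 = 0 := by simp [cartanPart]
  change cartanPart T' d (diagPart A) + resolvent T (upperPart A)
    - (T' * resolvent T') (lowerPart A) = A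
  rw [h1, h2, h3, upperPart_eq, hA, resolvent_of_map_eq_zero h.pow_left hT]
  simp

lemma rOp_of_lower (h : ShiftPair T T') (d : Fin n → ℂ) {A : Mat n}
    (hA : lowerLin n A = A) (hT : T' A = 0) : rOp T T' d A = 0 := by
  have h1 : diagPart A = 0 := by
    ext i j; rw [← hA]; simp only [diagPart, ← lowerPart_eq, lowerPart, of_apply]
    split_ifs with h1 h2 <;> simp_all
  have h2 : upperPart A = 0 := by
    ext i j; rw [← hA]; simp only [upperPart, ← lowerPart_eq, lowerPart, of_apply]
    split_ifs with h1 h2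
    · exact absurd h1 h2.not_gt
    · rfl
    · rfl
  have h3 : cartanPart T' d 0 = 0 := by simp [cartanPart]
  change cartanPart T' d (diagPart A) + resolvent T (upperPart A)
    - (T' * resolvent T') (lowerPart A) = 0
  rw [h1, h2, h3, lowerPart_eq, hA, Module.End.mul_apply,
    resolvent_of_map_eq_zero h.pow_right hT, hT]
  simp

end ShiftPair

/-! ### The R-operators and block inclusions -/

lemma form_mul_mul {m n : ℕ} (J J' : Matrix (Fin n) (Fin m) ℂ) (K K' : Matrix (Fin m) (Fin n) ℂ)
    (a b : Mat m) : form (J * a * K) (J' * b * K') = form (a * (K * J')) (b * (K' * J)) := by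
  simp only [form, Matrix.mul_assoc]
  rw [Matrix.trace_mul_comm]
  simp only [Matrix.mul_assoc]

lemma form_embLast_embLast {m : ℕ} (a b : Mat m) : form (embLast a) (embLast b) = form a b := by
  rw [embLast, embLast, form_mul_mul, inclLast_transpose_mul_self, Matrix.mul_one, Matrix.mul_one]

lemma form_embFirst_embFirst {m : ℕ} (a b : Mat m) :
    form (embFirst a) (embFirst b) = form a b := by
  rw [embFirst, embFirst, form_mul_mul, inclFirst_transpose_mul_self, Matrix.mul_one,
    Matrix.mul_one]

lemma form_embLast_embFirst {m : ℕ} (a b : Mat m) :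
    form (embLast a) (embFirst b) = form (gamma m a) b := by
  rw [embLast, embFirst, form_mul_mul, inclLast_transpose_mul_inclFirst,
    inclFirst_transpose_mul_inclLast, gamma_apply, form, form, Matrix.trace_mul_comm]
  conv_rhs => rw [Matrix.trace_mul_comm]
  simp only [Matrix.mul_assoc]

lemma form_embFirst_embLast {m : ℕ} (a b : Mat m) :
    form (embFirst a) (embLast b) = form (gammaStar m a) b := by
  rw [form_comm, form_embLast_embFirst, form_gamma, form_comm]

lemma embLast_sub {m : ℕ} (a b : Mat m) : embLast (a - b) = embLast a - embLast b := by
  simp [embLast, Matrix.mul_sub, Matrix.sub_mul]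

lemma embLast_add {m : ℕ} (a b : Mat m) : embLast (a + b) = embLast a + embLast b := by
  simp [embLast, Matrix.mul_add, Matrix.add_mul]

lemma embFirst_sub {m : ℕ} (a b : Mat m) : embFirst (a - b) = embFirst a - embFirst b := by
  simp [embFirst, Matrix.mul_sub, Matrix.sub_mul]

lemma gamma_embFirst {m : ℕ} (a : Mat m) : gamma (m + 1) (embFirst a) = embLast a := by
  rw [gamma_eq_emb, resFirst_embFirst]

lemma gammaStar_embLast {m : ℕ} (a : Mat m) : gammaStar (m + 1) (embLast a) = embFirst a := by
  rw [gammaStar_eq_emb, resLast_embLast]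

lemma resolvent_gamma_embLast {m : ℕ} (y : Mat m) :
    resolvent (gamma (m + 1)) (embLast y) = embLast (resolvent (gamma m) y) := by
  have h : embLast y = embLast (resolvent (gamma m) y)
      - gamma (m + 1) (embLast (resolvent (gamma m) y)) := by
    rw [gamma_eq_emb, resFirst_embLast, map_resolvent (gamma_pow_eq_zero m), ← embLast_sub]
    congr 1; abel
  conv_lhs => rw [h]
  rw [resolvent_sub_map (gamma_pow_eq_zero _)]

lemma gammaStar_resolvent_embLast {m : ℕ} (y : Mat m) :
    gammaStar (m + 1) (resolvent (gammaStar (m + 1)) (embLast y))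
      = embFirst (resolvent (gammaStar m) y) := by
  have h : embLast y = (embLast y + embFirst (resolvent (gammaStar m) y))
      - gammaStar (m + 1) (embLast y + embFirst (resolvent (gammaStar m) y)) := by
    rw [map_add, gammaStar_embLast, gammaStar_eq_emb, resLast_embFirst,
      map_resolvent (gammaStar_pow_eq_zero m), embFirst_sub]
    abel
  rw [map_resolvent (gammaStar_pow_eq_zero _)]
  conv_lhs => rw [h]
  rw [resolvent_sub_map (gammaStar_pow_eq_zero _), ← h]
  abel

/-- The operator `R₊` of `gl_{m+1}` on a matrix supported in the last `m` rows and columns. -/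
lemma exists_rPlus_embLast {m : ℕ} {x : Mat m} (hx : x.trace = 0) :
    ∃ s : ℂ, rPlus (embLast x) = embLast (resolvent (gamma m) (upperLin m x))
      - embFirst (resolvent (gammaStar m) (diagLin m x + lowerLin m x))
      + s • (1 : Mat (m + 1)) := by
  obtain ⟨s, hs⟩ := ShiftPair.exists_rOp_eq (gamma (m + 1)) (gammaStar (m + 1))
    (fun i => ((m + 1 : ℕ) : ℂ) - (i : ℕ)) (A := embLast x) (by rw [trace_embLast, hx])
  refine ⟨s, ?_⟩
  rw [rPlus_eq, hs, upperLin_embLast, diagLin_embLast, lowerLin_embLast, ← embLast_add,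
    resolvent_gamma_embLast, gammaStar_resolvent_embLast]

lemma exists_rPlus_embLast_sub_embFirst {m : ℕ} (b : Mat m) :
    ∃ s : ℂ, rPlus (embLast b - embFirst b) = -embFirst b + s • (1 : Mat (m + 1)) := by
  have hg : gammaStar (m + 1) (gamma (m + 1)
      (diagLin (m + 1) (embFirst b) + lowerLin (m + 1) (embFirst b)))
      = diagLin (m + 1) (embFirst b) + lowerLin (m + 1) (embFirst b) := by
    rw [diagLin_embFirst, lowerLin_embFirst, map_add, map_add, gamma_embFirst, gamma_embFirst,
      gammaStar_embLast, gammaStar_embLast]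
  obtain ⟨s, hs⟩ := (shiftPair_gamma (m + 1)).exists_rOp_sub_left
    (fun i => ((m + 1 : ℕ) : ℂ) - (i : ℕ)) (B := embFirst b)
    (by rw [gamma_embFirst, Matrix.trace_sub, trace_embFirst, trace_embLast, sub_self]) hg
  refine ⟨-s, ?_⟩
  rw [rPlus_eq, ← neg_sub, map_neg, ← gamma_embFirst, hs]
  module

/-- The comparison of the operators `R₊` of `gl_{m+1}` and of `gl_m`. -/
lemma form_rPlus_core {m : ℕ} {a b a' b' : Mat m} (h : a.trace = b.trace)
    (h' : a'.trace = b'.trace) :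
    form (rPlus (embLast a - embFirst b)) (embLast a' - embFirst b')
      = form (rPlus (a - b)) (a' - b') + form a b' - form (gammaStar m b) a' := by
  have hx : (a - b).trace = 0 := by rw [Matrix.trace_sub, h, sub_self]
  obtain ⟨s, hs⟩ := exists_rPlus_embLast hx
  obtain ⟨t, ht⟩ := exists_rPlus_embLast_sub_embFirst b
  obtain ⟨r, hr⟩ := ShiftPair.exists_rOp_eq (gamma m) (gammaStar m)
    (fun i => (m : ℂ) - (i : ℕ)) hx
  have hsplit : embLast a - embFirst b = embLast (a - b) + (embLast b - embFirst b) := by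
    rw [embLast_sub]; abel
  have htr : (embLast a' - embFirst b').trace = 0 := by
    rw [Matrix.trace_sub, trace_embLast, trace_embFirst, h', sub_self]
  have htr' : (a' - b').trace = 0 := by rw [Matrix.trace_sub, h', sub_self]
  rw [rPlus_eq] at hs ht
  rw [hsplit, rPlus_eq, map_add, hs, ht, rPlus_eq, hr]
  rw [map_resolvent (gammaStar_pow_eq_zero m)]
  have hsum : form (a - b) b' = form (upperLin m (a - b)) b'
      + form (diagLin m (a - b) + lowerLin m (a - b)) b' := by
    rw [← form_add_left, ← add_assoc, upper_add_diag_add_lower]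
  rw [form_sub_left] at hsum
  simp only [form_add_left, form_sub_left, form_smul_left, form_one_left, htr, htr', form_neg_left,
    mul_zero, add_zero]
  simp only [form_sub_right, form_embLast_embLast, form_embLast_embFirst, form_embFirst_embFirst,
    form_embFirst_embLast, map_resolvent (gamma_pow_eq_zero m),
    map_resolvent (gammaStar_pow_eq_zero m), form_sub_left, form_add_left] at hsum ⊢
  linear_combination -hsum

/-! ### Rank one terms -/

lemma shift_mulVec_single_last (m : ℕ) :
    shift (m + 1) *ᵥ Pi.single (Fin.last m) 1 = 0 := by
  ext i
  simp only [Matrix.mulVec_single_one, Matrix.col_apply, shift, of_apply, Pi.zero_apply,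
    Fin.val_last]
  rw [if_neg (by omega)]

lemma shift_transpose_mulVec_single_zero (m : ℕ) :
    (shift (m + 1))ᵀ *ᵥ Pi.single 0 1 = 0 := by
  ext i
  simp [shift]

lemma gamma_vecMulVec {n : ℕ} (u v : Fin n → ℂ) :
    gamma n (vecMulVec u v) = vecMulVec (shift n *ᵥ u) (shift n *ᵥ v) := by
  rw [gamma_apply, Matrix.mul_vecMulVec, Matrix.vecMulVec_mul, Matrix.vecMul_transpose]

lemma gammaStar_vecMulVec {n : ℕ} (u v : Fin n → ℂ) :
    gammaStar n (vecMulVec u v) = vecMulVec ((shift n)ᵀ *ᵥ u) ((shift n)ᵀ *ᵥ v) := by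
  rw [gammaStar_apply, Matrix.mul_vecMulVec, Matrix.vecMulVec_mul, ← Matrix.mulVec_transpose]

lemma rPlusBar_vecMulVec_single_last {m : ℕ} {r : Fin (m + 1) → ℂ} (hr : r (Fin.last m) = 0) :
    rPlusBar (vecMulVec (Pi.single (Fin.last m) 1) r) = 0 := by
  refine (shiftPair_gammaStar (m + 1)).rOp_of_lower _ ?_ ?_
  · ext i j
    simp only [← lowerPart_eq, lowerPart, of_apply, vecMulVec_apply, Pi.single_apply]
    split_ifs with h1 h2 h2
    · rfl
    · rfl
    · rw [h2, not_lt] at h1; rw [le_antisymm (Fin.le_last j) h1, hr, mul_zero]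
    · simp
  · rw [gamma_vecMulVec, shift_mulVec_single_last, Matrix.zero_vecMulVec]

lemma rPlusBar_vecMulVec_single_zero {m : ℕ} {r : Fin (m + 1) → ℂ} (hr : r 0 = 0) :
    rPlusBar (vecMulVec (Pi.single 0 1) r) = vecMulVec (Pi.single 0 1) r := by
  refine (shiftPair_gammaStar (m + 1)).rOp_of_upper _ ?_ ?_
  · ext i j
    simp only [← upperPart_eq, upperPart, of_apply, vecMulVec_apply, Pi.single_apply]
    split_ifs with h1 h2 h2
    · rfl
    · rfl
    · rw [h2, not_lt] at h1; rw [le_antisymm h1 (Fin.zero_le j), hr, mul_zero]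
    · simp
  · rw [gammaStar_vecMulVec, shift_transpose_mulVec_single_zero, Matrix.zero_vecMulVec]

lemma rPlus_vecMulVec_single_zero {m : ℕ} {u : Fin (m + 1) → ℂ} (hu : u 0 = 0) :
    rPlus (vecMulVec u (Pi.single 0 1)) = 0 := by
  refine (shiftPair_gamma (m + 1)).rOp_of_lower _ ?_ ?_
  · ext i j
    simp only [← lowerPart_eq, lowerPart, of_apply, vecMulVec_apply, Pi.single_apply]
    split_ifs with h1 h2 h2
    · rfl
    · rfl
    · rw [h2, not_lt] at h1; rw [le_antisymm h1 (Fin.zero_le i), hu, zero_mul]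
    · simp
  · rw [gammaStar_vecMulVec, shift_transpose_mulVec_single_zero, Matrix.vecMulVec_zero]

lemma rPlus_vecMulVec_single_last {m : ℕ} {u : Fin (m + 1) → ℂ} (hu : u (Fin.last m) = 0) :
    rPlus (vecMulVec u (Pi.single (Fin.last m) 1)) = vecMulVec u (Pi.single (Fin.last m) 1) := by
  refine (shiftPair_gamma (m + 1)).rOp_of_upper _ ?_ ?_
  · ext i j
    simp only [← upperPart_eq, upperPart, of_apply, vecMulVec_apply, Pi.single_apply]
    split_ifs with h1 h2 h2
    · rfl
    · rfl
    · rw [h2, not_lt] at h1; rw [le_antisymm (Fin.le_last i) h1, hu, zero_mul]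
    · simp
  · rw [gamma_vecMulVec, shift_mulVec_single_last, Matrix.vecMulVec_zero]

/-! ### The R-operators on the left and right gradients of a function of `X_L X_R⁻¹` -/

/-- The matrix `(1; -w)` of size `(m + 1) × m`. -/
def colFirst {m : ℕ} (w : Fin m → ℂ) : Matrix (Fin (m + 1)) (Fin m) ℂ :=
  inclFirst m - vecMulVec (Pi.single (Fin.last m) 1) w

/-- The matrix `(-w; 1)` of size `(m + 1) × m`. -/
def colLast {m : ℕ} (w : Fin m → ℂ) : Matrix (Fin (m + 1)) (Fin m) ℂ :=
  inclLast m - vecMulVec (Pi.single 0 1) w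

/-- The matrix `(1, -v)` of size `m × (m + 1)`. -/
def rowFirst {m : ℕ} (v : Fin m → ℂ) : Matrix (Fin m) (Fin (m + 1)) ℂ :=
  (inclFirst m)ᵀ - vecMulVec v (Pi.single (Fin.last m) 1)

/-- The matrix `(-v, 1)` of size `m × (m + 1)`. -/
def rowLast {m : ℕ} (v : Fin m → ℂ) : Matrix (Fin m) (Fin (m + 1)) ℂ :=
  (inclLast m)ᵀ - vecMulVec v (Pi.single 0 1)

lemma inclFirst_transpose_mulVec_single (m : ℕ) :
    (inclFirst m)ᵀ *ᵥ Pi.single (Fin.last m) 1 = 0 := by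
  ext i; simp [inclFirst, Fin.ext_iff, i.isLt.ne']

lemma inclLast_transpose_mulVec_single (m : ℕ) :
    (inclLast m)ᵀ *ᵥ Pi.single 0 1 = 0 := by
  ext i; simp [inclLast, Fin.ext_iff]

lemma inclFirst_transpose_mul_colFirst {m : ℕ} (w : Fin m → ℂ) :
    (inclFirst m)ᵀ * colFirst w = 1 := by
  rw [colFirst, Matrix.mul_sub, inclFirst_transpose_mul_self, Matrix.mul_vecMulVec,
    inclFirst_transpose_mulVec_single, Matrix.zero_vecMulVec, sub_zero]

lemma inclLast_transpose_mul_colLast {m : ℕ} (w : Fin m → ℂ) :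
    (inclLast m)ᵀ * colLast w = 1 := by
  rw [colLast, Matrix.mul_sub, inclLast_transpose_mul_self, Matrix.mul_vecMulVec,
    inclLast_transpose_mulVec_single, Matrix.zero_vecMulVec, sub_zero]

lemma rowFirst_mul_inclFirst {m : ℕ} (v : Fin m → ℂ) : rowFirst v * inclFirst m = 1 := by
  rw [rowFirst, Matrix.sub_mul, inclFirst_transpose_mul_self, Matrix.vecMulVec_mul,
    ← Matrix.mulVec_transpose, inclFirst_transpose_mulVec_single, Matrix.vecMulVec_zero, sub_zero]

lemma rowLast_mul_inclLast {m : ℕ} (v : Fin m → ℂ) : rowLast v * inclLast m = 1 := by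
  rw [rowLast, Matrix.sub_mul, inclLast_transpose_mul_self, Matrix.vecMulVec_mul,
    ← Matrix.mulVec_transpose, inclLast_transpose_mulVec_single, Matrix.vecMulVec_zero, sub_zero]

lemma inclFirst_mulVec_last {m : ℕ} (u : Fin m → ℂ) :
    (inclFirst m *ᵥ u) (Fin.last m) = 0 := by
  simp [inclFirst, Matrix.mulVec, dotProduct, Fin.ext_iff, (Fin.is_lt _).ne']

lemma inclLast_mulVec_zero {m : ℕ} (u : Fin m → ℂ) : (inclLast m *ᵥ u) 0 = 0 := by
  simp [inclLast, Matrix.mulVec, dotProduct, Fin.ext_iff]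

/-- The left gradient consists of `(1 - γ)` of a block, on which `R̄₊` is known, a first row, which
is fixed by `R̄₊`, and a last row, which is killed. -/
lemma exists_rPlusBar_left {m : ℕ} (w w' : Fin m → ℂ) (c : Mat m) :
    ∃ s : ℂ, rPlusBar (colFirst w * c * (inclFirst m)ᵀ - colLast w' * c * (inclLast m)ᵀ)
      = -(colLast w' * c * (inclLast m)ᵀ) + s • (1 : Mat (m + 1)) := by
  have hg : gammaStar (m + 1) (gamma (m + 1) (upperLin (m + 1) (embFirst c)))
      = upperLin (m + 1) (embFirst c) := by
    rw [upperLin_embFirst, gamma_embFirst, gammaStar_embLast]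
  obtain ⟨s, hs⟩ := (shiftPair_gammaStar (m + 1)).exists_rOp_sub_right
    (fun i => ((i : ℕ) : ℂ) + 1) (B := embFirst c)
    (by rw [gamma_embFirst, Matrix.trace_sub, trace_embFirst, trace_embLast, sub_self]) hg
  refine ⟨s, ?_⟩
  have h1 : colFirst w * c * (inclFirst m)ᵀ
      = embFirst c - vecMulVec (Pi.single (Fin.last m) 1) (inclFirst m *ᵥ (w ᵥ* c)) := by
    rw [colFirst, Matrix.sub_mul, Matrix.sub_mul, Matrix.vecMulVec_mul, Matrix.vecMulVec_mul,
      Matrix.vecMul_transpose, embFirst]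
  have h2 : colLast w' * c * (inclLast m)ᵀ
      = embLast c - vecMulVec (Pi.single 0 1) (inclLast m *ᵥ (w' ᵥ* c)) := by
    rw [colLast, Matrix.sub_mul, Matrix.sub_mul, Matrix.vecMulVec_mul, Matrix.vecMulVec_mul,
      Matrix.vecMul_transpose, embLast]
  have h3 := rPlusBar_vecMulVec_single_last (r := inclFirst m *ᵥ (w ᵥ* c))
    (inclFirst_mulVec_last _)
  have h4 := rPlusBar_vecMulVec_single_zero (r := inclLast m *ᵥ (w' ᵥ* c))
    (inclLast_mulVec_zero _)
  rw [gamma_embFirst] at hs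
  rw [rPlusBar_eq] at h3 h4
  rw [h1, h2, sub_sub_sub_comm, rPlusBar_eq, map_sub, hs, map_sub, h3, h4]
  abel

lemma trace_left {m : ℕ} (w w' : Fin m → ℂ) (c : Mat m) :
    (colFirst w * c * (inclFirst m)ᵀ - colLast w' * c * (inclLast m)ᵀ).trace = 0 := by
  rw [Matrix.trace_sub, Matrix.trace_mul_comm, Matrix.trace_mul_comm (colLast w' * c),
    ← Matrix.mul_assoc, ← Matrix.mul_assoc, inclFirst_transpose_mul_colFirst,
    inclLast_transpose_mul_colLast, sub_self]

lemma trace_right {m : ℕ} (v v' : Fin m → ℂ) {a b : Mat m} (h : a.trace = b.trace) :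
    (inclLast m * a * rowLast v - inclFirst m * b * rowFirst v').trace = 0 := by
  rw [Matrix.trace_sub, Matrix.trace_mul_comm, Matrix.trace_mul_comm (inclFirst m * b),
    ← Matrix.mul_assoc, ← Matrix.mul_assoc, rowFirst_mul_inclFirst,
    rowLast_mul_inclLast, Matrix.one_mul, Matrix.one_mul, h, sub_self]

/-- The pairing of left gradients. -/
lemma form_rPlusBar_left {m : ℕ} (w w' : Fin m → ℂ) (c c' : Mat m) :
    form (rPlusBar (colFirst w * c * (inclFirst m)ᵀ - colLast w' * c * (inclLast m)ᵀ))
        (colFirst w * c' * (inclFirst m)ᵀ - colLast w' * c' * (inclLast m)ᵀ)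
      = form c c'
        - form (c * ((inclLast m)ᵀ * colFirst w)) (c' * ((inclFirst m)ᵀ * colLast w')) := by
  obtain ⟨s, hs⟩ := exists_rPlusBar_left w w' c
  rw [hs, form_add_left, form_smul_left, form_one_left, trace_left, form_neg_left,
    form_sub_right, form_mul_mul, form_mul_mul, inclLast_transpose_mul_colLast, Matrix.mul_one,
    Matrix.mul_one]
  ring

/-- The pairing of right gradients. They consist of a block part, a first column, which is killed
by `R₊`, and a last column, which is fixed by `R₊`. -/
lemma form_rPlus_right {m : ℕ} (v v' : Fin m → ℂ) {a b a' b' : Mat m} (h : a.trace = b.trace)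
    (h' : a'.trace = b'.trace) :
    form (rPlus (inclLast m * a * rowLast v - inclFirst m * b * rowFirst v'))
        (inclLast m * a' * rowLast v - inclFirst m * b' * rowFirst v')
      = form (rPlus (a - b)) (a' - b') + form a b'
        - form (b * (rowFirst v' * inclLast m)) (a' * (rowLast v * inclFirst m)) := by
  have hlast : ∀ a : Mat m, inclLast m * a * rowLast v
      = embLast a - vecMulVec (inclLast m *ᵥ (a *ᵥ v)) (Pi.single 0 1) := by
    intro a
    rw [rowLast, Matrix.mul_sub, Matrix.mul_vecMulVec, embLast, Matrix.mulVec_mulVec]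
  have hfirst : ∀ b : Mat m, inclFirst m * b * rowFirst v'
      = embFirst b - vecMulVec (inclFirst m *ᵥ (b *ᵥ v')) (Pi.single (Fin.last m) 1) := by
    intro b
    rw [rowFirst, Matrix.mul_sub, Matrix.mul_vecMulVec, embFirst, Matrix.mulVec_mulVec]
  have hR : ∀ a b : Mat m, rPlus (inclLast m * a * rowLast v - inclFirst m * b * rowFirst v')
      = rPlus (embLast a - embFirst b)
        + vecMulVec (inclFirst m *ᵥ (b *ᵥ v')) (Pi.single (Fin.last m) 1) := by
    intro a b
    have h3 := rPlus_vecMulVec_single_last (u := inclFirst m *ᵥ (b *ᵥ v'))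
      (inclFirst_mulVec_last _)
    have h4 := rPlus_vecMulVec_single_zero (u := inclLast m *ᵥ (a *ᵥ v))
      (inclLast_mulVec_zero _)
    rw [rPlus_eq] at h3 h4
    rw [hlast, hfirst, sub_sub_sub_comm, rPlus_eq, map_sub, map_sub _ (vecMulVec _ _), h3, h4,
      rPlus_eq]
    abel
  have hcore : (embLast a - embFirst b).trace = 0 := by
    rw [Matrix.trace_sub, trace_embLast, trace_embFirst, h, sub_self]
  -- `R + R* = 1` moves `R₊` from the block part to the first and last columns
  have hadj := (shiftPair_gamma (m + 1)).form_rOp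
    (fun i => ((m + 1 : ℕ) : ℂ) - (i : ℕ)) hcore (trace_right v v' h')
  rw [← rPlus_eq, ← rPlus_eq, hR a' b', form_add_right] at hadj
  have hadj' := (shiftPair_gamma (m + 1)).form_rOp
    (fun i => ((m + 1 : ℕ) : ℂ) - (i : ℕ)) hcore
    (show (embLast a' - embFirst b').trace = 0 by
      rw [Matrix.trace_sub, trace_embLast, trace_embFirst, h', sub_self])
  rw [← rPlus_eq, ← rPlus_eq, form_rPlus_core h h'] at hadj'
  have e1 : vecMulVec (inclFirst m *ᵥ (b *ᵥ v')) (Pi.single (Fin.last m) 1)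
      = embFirst b - inclFirst m * b * rowFirst v' := by rw [hfirst]; abel
  have e2 : vecMulVec (inclFirst m *ᵥ (b' *ᵥ v')) (Pi.single (Fin.last m) 1)
      = embFirst b' - inclFirst m * b' * rowFirst v' := by rw [hfirst]; abel
  rw [e2] at hadj
  rw [hR a b, form_add_left, e1]
  have k1 : form (gammaStar m b) a' = form (b * shift m) (a' * (shift m)ᵀ) := by
    rw [gammaStar_apply, form, form, Matrix.mul_assoc, Matrix.mul_assoc, Matrix.trace_mul_comm]
    simp only [Matrix.mul_assoc]
  simp only [form_sub_left, form_sub_right, embLast, embFirst, form_mul_mul,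
    inclFirst_transpose_mul_inclLast, inclLast_transpose_mul_inclFirst, rowFirst_mul_inclFirst,
    rowLast_mul_inclLast, inclFirst_transpose_mul_self, inclLast_transpose_mul_self,
    Matrix.mul_one] at hadj hadj' k1 ⊢
  linear_combination hadj - hadj' - k1

/-! ### Gradients and derivatives -/

section Calculus

attribute [local instance] Matrix.normedAddCommGroup Matrix.normedSpace

lemma form_single {n : ℕ} (G : Mat n) (i j : Fin n) : form G (Matrix.single j i 1) = G i j := by
  simp [form, Matrix.trace_mul_single]

lemma fderiv_eq_form {n : ℕ} (f : Mat n → ℂ) (X H : Mat n) :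
    fderiv ℂ f X H = form (grad f X) H := by
  conv_lhs => rw [Matrix.matrix_eq_sum_single H]
  simp only [map_sum]
  rw [form_eq_sum, Finset.sum_comm]
  refine Finset.sum_congr rfl fun i _ => Finset.sum_congr rfl fun j _ => ?_
  have : Matrix.single j i (H j i) = H j i • Matrix.single j i (1 : ℂ) := by
    rw [Matrix.smul_single, smul_eq_mul, mul_one]
  rw [this, map_smul, grad, of_apply, smul_eq_mul, mul_comm]

lemma grad_eq_of_forall {n : ℕ} {f : Mat n → ℂ} {X G : Mat n}
    (h : ∀ H, fderiv ℂ f X H = form G H) : grad f X = G := by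
  ext i j
  rw [grad, of_apply, h, form_single]

lemma differentiableAt_matrix {E : Type} [NormedAddCommGroup E] [NormedSpace ℂ E] {n k : ℕ}
    {φ : E → Matrix (Fin n) (Fin k) ℂ} {x : E} :
    DifferentiableAt ℂ φ x ↔ ∀ i j, DifferentiableAt ℂ (fun y => φ y i j) x :=
  differentiableAt_pi.trans (forall_congr' fun _ => differentiableAt_pi)

lemma fderiv_matrix_apply {E : Type} [NormedAddCommGroup E] [NormedSpace ℂ E] {n k : ℕ}
    {φ : E → Matrix (Fin n) (Fin k) ℂ} {x : E} (h : DifferentiableAt ℂ φ x) (v : E) (i : Fin n)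
    (j : Fin k) : fderiv ℂ φ x v i j = fderiv ℂ (fun y => φ y i j) x v := by
  have h1 := hasFDerivAt_pi'.1 h.hasFDerivAt i
  have h2 := hasFDerivAt_pi'.1 h1 j
  rw [h2.fderiv]
  rfl

lemma fderiv_matrix_mul {E : Type} [NormedAddCommGroup E] [NormedSpace ℂ E] {n k l : ℕ}
    {φ : E → Matrix (Fin n) (Fin k) ℂ} {ψ : E → Matrix (Fin k) (Fin l) ℂ} {x : E}
    (h : DifferentiableAt ℂ φ x) (h' : DifferentiableAt ℂ ψ x) :
    DifferentiableAt ℂ (fun y => φ y * ψ y) x ∧ ∀ v : E, fderiv ℂ (fun y => φ y * ψ y) x v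
      = fderiv ℂ φ x v * ψ x + φ x * fderiv ℂ ψ x v := by
  have hφ := differentiableAt_matrix.1 h
  have hψ := differentiableAt_matrix.1 h'
  have hd : DifferentiableAt ℂ (fun y => φ y * ψ y) x := by
    refine differentiableAt_matrix.2 fun i j => ?_
    simp only [Matrix.mul_apply]
    exact DifferentiableAt.fun_sum fun k _ => (hφ i k).mul (hψ k j)
  refine ⟨hd, fun v => ?_⟩
  ext i j
  rw [fderiv_matrix_apply hd]
  simp only [Matrix.mul_apply, Matrix.add_apply]
  rw [fderiv_fun_sum fun k _ => (hφ i k).fun_mul (hψ k j), _root_.sum_apply,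
    ← Finset.sum_add_distrib]
  refine Finset.sum_congr rfl fun k _ => ?_
  rw [fderiv_fun_mul (hφ i k) (hψ k j), fderiv_matrix_apply h, fderiv_matrix_apply h']
  simp only [_root_.add_apply, _root_.smul_apply, smul_eq_mul]
  ring

lemma differentiableAt_det {E : Type} [NormedAddCommGroup E] [NormedSpace ℂ E] {n : ℕ}
    {φ : E → Mat n} {x : E} (h : ∀ i j, DifferentiableAt ℂ (fun y => φ y i j) x) :
    DifferentiableAt ℂ (fun y => (φ y).det) x := by
  simp only [Matrix.det_apply]
  exact DifferentiableAt.fun_sum fun σ _ =>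
    DifferentiableAt.const_smul (HasFDerivAt.finsetProd fun i _ =>
      (h (σ i) i).hasFDerivAt).differentiableAt _

lemma differentiableAt_inv {E : Type} [NormedAddCommGroup E] [NormedSpace ℂ E] {n : ℕ}
    {φ : E → Mat n} {x : E} (h : DifferentiableAt ℂ φ x) (h0 : (φ x).det ≠ 0) :
    DifferentiableAt ℂ (fun y => (φ y)⁻¹) x := by
  have hφ := differentiableAt_matrix.1 h
  refine differentiableAt_matrix.2 fun i j => ?_
  simp only [Matrix.inv_def, Ring.inverse_eq_inv', Matrix.smul_apply, Matrix.adjugate_apply,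
    smul_eq_mul]
  refine ((differentiableAt_det hφ).inv h0).mul (differentiableAt_det fun k l => ?_)
  simp only [Matrix.updateRow_apply]
  split_ifs
  · exact differentiableAt_const _
  · exact hφ k l

lemma hasDerivAt_line {n : ℕ} (X H : Mat n) (i j : Fin n) :
    HasDerivAt (fun t : ℂ => (X + t • H) i j) (H i j) 0 := by
  simpa using ((hasDerivAt_id (0 : ℂ)).mul_const (H i j)).const_add (X i j)

lemma fderiv_eq_of_line {n : ℕ} {f : Mat n → ℂ} {X H : Mat n} {d : ℂ}
    (hf : DifferentiableAt ℂ f X) (h : HasDerivAt (fun t : ℂ => f (X + t • H)) d 0) :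
    fderiv ℂ f X H = d :=
  (hf.hasFDerivAt.hasLineDerivAt H).unique h

/-! ### Schur complements -/

lemma differentiableAt_schur {n : ℕ} {X : Mat n} (i j k l : Fin n) (h : X k l ≠ 0) :
    DifferentiableAt ℂ (fun Y : Mat n => Y i j - Y i l * (Y k l)⁻¹ * Y k j) X := by
  fun_prop (disch := assumption)

lemma fderiv_schur {n : ℕ} {X : Mat n} (i j k l : Fin n) (h : X k l ≠ 0) (H : Mat n) :
    fderiv ℂ (fun Y : Mat n => Y i j - Y i l * (Y k l)⁻¹ * Y k j) X H
      = H i j - X i l * (X k l)⁻¹ * H k j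
        - (H i l - X i l * (X k l)⁻¹ * H k l) * ((X k l)⁻¹ * X k j) := by
  refine fderiv_eq_of_line (differentiableAt_schur i j k l h) ?_
  have h0 : (X + (0 : ℂ) • H) k l ≠ 0 := by simpa using h
  have := (hasDerivAt_line X H i j).fun_sub
    (((hasDerivAt_line X H i l).fun_mul ((hasDerivAt_line X H k l).fun_inv h0)).fun_mul
      (hasDerivAt_line X H k j))
  refine this.congr_deriv ?_
  simp only [zero_smul, add_zero]
  field_simp
  ring

/-- The column `X_{[2,n]}^{n} x_{1n}⁻¹`. -/
def vecL {m : ℕ} (X : Mat (m + 1)) : Fin m → ℂ :=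
  fun i => X i.succ (Fin.last m) * (X 0 (Fin.last m))⁻¹

/-- The row `x_{1n}⁻¹ X_1^{[1,n-1]}`. -/
def covecL {m : ℕ} (X : Mat (m + 1)) : Fin m → ℂ :=
  fun j => (X 0 (Fin.last m))⁻¹ * X 0 j.castSucc

/-- The column `X_{[1,n-1]}^{1} x_{n1}⁻¹`. -/
def vecR {m : ℕ} (X : Mat (m + 1)) : Fin m → ℂ :=
  fun i => X i.castSucc 0 * (X (Fin.last m) 0)⁻¹

/-- The row `x_{n1}⁻¹ X_n^{[2,n]}`. -/
def covecR {m : ℕ} (X : Mat (m + 1)) : Fin m → ℂ :=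
  fun j => (X (Fin.last m) 0)⁻¹ * X (Fin.last m) j.succ

variable {m : ℕ}

lemma rowLast_mul_apply {ι : Type*} (v : Fin m → ℂ) (M : Matrix (Fin (m + 1)) ι ℂ) (i : Fin m)
    (j : ι) : (rowLast v * M) i j = M i.succ j - v i * M 0 j := by
  rw [rowLast, Matrix.sub_mul, inclLast_transpose_mul, Matrix.vecMulVec_mul, Matrix.sub_apply]
  simp [vecMulVec_apply]

lemma rowFirst_mul_apply {ι : Type*} (v : Fin m → ℂ) (M : Matrix (Fin (m + 1)) ι ℂ) (i : Fin m)
    (j : ι) : (rowFirst v * M) i j = M i.castSucc j - v i * M (Fin.last m) j := by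
  rw [rowFirst, Matrix.sub_mul, inclFirst_transpose_mul, Matrix.vecMulVec_mul, Matrix.sub_apply]
  simp [vecMulVec_apply]

lemma mul_colLast_apply {ι : Type*} (w : Fin m → ℂ) (M : Matrix ι (Fin (m + 1)) ℂ) (i : ι)
    (j : Fin m) : (M * colLast w) i j = M i j.succ - M i 0 * w j := by
  rw [colLast, Matrix.mul_sub, mul_inclLast, Matrix.mul_vecMulVec, Matrix.sub_apply]
  simp [vecMulVec_apply]

lemma mul_colFirst_apply {ι : Type*} (w : Fin m → ℂ) (M : Matrix ι (Fin (m + 1)) ℂ) (i : ι)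
    (j : Fin m) : (M * colFirst w) i j = M i j.castSucc - M i (Fin.last m) * w j := by
  rw [colFirst, Matrix.mul_sub, mul_inclFirst, Matrix.mul_vecMulVec, Matrix.sub_apply]
  simp [vecMulVec_apply]

lemma mul_inclFirst_transpose_castSucc {ι : Type*} (M : Matrix ι (Fin m) ℂ) (i : ι) (j : Fin m) :
    (M * (inclFirst m)ᵀ) i j.castSucc = M i j := by
  simp [Matrix.mul_apply, inclFirst]

lemma mul_inclFirst_transpose_last {ι : Type*} (M : Matrix ι (Fin m) ℂ) (i : ι) :
    (M * (inclFirst m)ᵀ) i (Fin.last m) = 0 := by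
  simp [Matrix.mul_apply, inclFirst, Fin.ext_iff, (Fin.is_lt _).ne']

lemma mul_inclLast_transpose_succ {ι : Type*} (M : Matrix ι (Fin m) ℂ) (i : ι) (j : Fin m) :
    (M * (inclLast m)ᵀ) i j.succ = M i j := by
  simp [Matrix.mul_apply, inclLast]

lemma mul_inclLast_transpose_zero {ι : Type*} (M : Matrix ι (Fin m) ℂ) (i : ι) :
    (M * (inclLast m)ᵀ) i 0 = 0 := by
  simp [Matrix.mul_apply, inclLast, Fin.ext_iff]

lemma inclFirst_mul_castSucc {ι : Type*} (M : Matrix (Fin m) ι ℂ) (i : Fin m) (j : ι) :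
    (inclFirst m * M) i.castSucc j = M i j := by
  simp [Matrix.mul_apply, inclFirst]

lemma inclFirst_mul_last {ι : Type*} (M : Matrix (Fin m) ι ℂ) (j : ι) :
    (inclFirst m * M) (Fin.last m) j = 0 := by
  simp [Matrix.mul_apply, inclFirst, Fin.ext_iff, (Fin.is_lt _).ne']

lemma inclLast_mul_succ {ι : Type*} (M : Matrix (Fin m) ι ℂ) (i : Fin m) (j : ι) :
    (inclLast m * M) i.succ j = M i j := by
  simp [Matrix.mul_apply, inclLast]

lemma inclLast_mul_zero {ι : Type*} (M : Matrix (Fin m) ι ℂ) (j : ι) :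
    (inclLast m * M) 0 j = 0 := by
  simp [Matrix.mul_apply, inclLast, Fin.ext_iff]

lemma rowLast_mul_self {X : Mat (m + 1)} (h : X 0 (Fin.last m) ≠ 0) :
    rowLast (vecL X) * X = schurL X * (inclFirst m)ᵀ := by
  ext i j
  rw [rowLast_mul_apply]
  induction j using Fin.lastCases with
  | last => rw [mul_inclFirst_transpose_last, vecL, inv_mul_cancel_right₀ h, sub_self]
  | cast j => rw [mul_inclFirst_transpose_castSucc]; rfl

lemma rowFirst_mul_self {X : Mat (m + 1)} (h : X (Fin.last m) 0 ≠ 0) :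
    rowFirst (vecR X) * X = schurR X * (inclLast m)ᵀ := by
  ext i j
  rw [rowFirst_mul_apply]
  induction j using Fin.cases with
  | zero => rw [mul_inclLast_transpose_zero, vecR, inv_mul_cancel_right₀ h, sub_self]
  | succ j => rw [mul_inclLast_transpose_succ]; rfl

lemma mul_colFirst_self {X : Mat (m + 1)} (h : X 0 (Fin.last m) ≠ 0) :
    X * colFirst (covecL X) = inclLast m * schurL X := by
  ext i j
  rw [mul_colFirst_apply]
  induction i using Fin.cases with
  | zero => rw [inclLast_mul_zero, covecL, mul_inv_cancel_left₀ h, sub_self]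
  | succ i => rw [inclLast_mul_succ, covecL, ← mul_assoc]; rfl

lemma mul_colLast_self {X : Mat (m + 1)} (h : X (Fin.last m) 0 ≠ 0) :
    X * colLast (covecR X) = inclFirst m * schurR X := by
  ext i j
  rw [mul_colLast_apply]
  induction i using Fin.lastCases with
  | last => rw [inclFirst_mul_last, covecR, mul_inv_cancel_left₀ h, sub_self]
  | cast i => rw [inclFirst_mul_castSucc, covecR, ← mul_assoc]; rfl

lemma differentiableAt_schurL {X : Mat (m + 1)} (h : X 0 (Fin.last m) ≠ 0) :
    DifferentiableAt ℂ schurL X :=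
  differentiableAt_matrix.2 fun _ _ => differentiableAt_schur _ _ _ _ h

lemma differentiableAt_schurR {X : Mat (m + 1)} (h : X (Fin.last m) 0 ≠ 0) :
    DifferentiableAt ℂ schurR X :=
  differentiableAt_matrix.2 fun _ _ => differentiableAt_schur _ _ _ _ h

lemma fderiv_schurL {X : Mat (m + 1)} (h : X 0 (Fin.last m) ≠ 0) (H : Mat (m + 1)) :
    fderiv ℂ schurL X H = rowLast (vecL X) * H * colFirst (covecL X) := by
  ext i j
  rw [mul_colFirst_apply, rowLast_mul_apply, rowLast_mul_apply]
  exact (fderiv_matrix_apply (differentiableAt_schurL h) H i j).trans (fderiv_schur _ _ _ _ h H)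

lemma fderiv_schurR {X : Mat (m + 1)} (h : X (Fin.last m) 0 ≠ 0) (H : Mat (m + 1)) :
    fderiv ℂ schurR X H = rowFirst (vecR X) * H * colLast (covecR X) := by
  ext i j
  rw [mul_colLast_apply, rowFirst_mul_apply, rowFirst_mul_apply]
  exact (fderiv_matrix_apply (differentiableAt_schurR h) H i j).trans (fderiv_schur _ _ _ _ h H)

/-- `det X = ± x_{1n} det X_L`. -/
lemma det_eq_schurL {X : Mat (m + 1)} (h : X 0 (Fin.last m) ≠ 0) :
    X.det = (-1) ^ m * X 0 (Fin.last m) * (schurL X).det := by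
  -- column operations clear the first row of `X` outside its last entry
  let Q : Mat (m + 1) := Matrix.of fun i j => Fin.lastCases (motive := fun _ => ℂ)
    ((Pi.single (Fin.last m) 1 : Fin (m + 1) → ℂ) i) (fun j => colFirst (covecL X) i j) j
  have hQc : ∀ i (j : Fin m), Q i j.castSucc = colFirst (covecL X) i j := by
    intro i j; simp [Q]
  have hQl : ∀ i, Q i (Fin.last m) = (Pi.single (Fin.last m) 1 : Fin (m + 1) → ℂ) i := by
    intro i; simp [Q]
  have hXc : ∀ i (j : Fin m), (X * Q) i j.castSucc = (inclLast m * schurL X) i j := by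
    intro i j
    rw [← mul_colFirst_self h, Matrix.mul_apply, Matrix.mul_apply]
    simp only [hQc]
  have hXl : ∀ i, (X * Q) i (Fin.last m) = X i (Fin.last m) := by
    intro i
    rw [Matrix.mul_apply]
    simp [hQl, Pi.single_apply]
  have hQ : Q.det = 1 := by
    rw [Matrix.det_of_isLowerTriangular Q ?_]
    · rw [Fin.prod_univ_castSucc, hQl, Pi.single_eq_same, mul_one]
      refine Finset.prod_eq_one fun j _ => ?_
      rw [hQc]
      simp [colFirst, inclFirst, vecMulVec_apply, Fin.ext_iff, j.isLt.ne]
    · intro i j hij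
      have hij : i < j := hij
      induction j using Fin.lastCases with
      | last => rw [hQl, Pi.single_eq_of_ne hij.ne]
      | cast j =>
        have : i ≠ Fin.last m := (hij.trans_le (Fin.le_last _)).ne
        rw [hQc]
        simp [colFirst, inclFirst, vecMulVec_apply, hij.ne, this]
  have h1 : X.det = (X * Q).det := by rw [Matrix.det_mul, hQ, mul_one]
  rw [h1, Matrix.det_succ_row_zero, Fin.sum_univ_castSucc, Finset.sum_eq_zero, zero_add, hXl]
  · simp only [Fin.val_last]
    congr 2
    ext i j
    simp only [Matrix.submatrix_apply, Fin.succAbove_last]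
    rw [hXc, inclLast_mul_succ]
  · intro j _
    rw [hXc, inclLast_mul_zero, mul_zero, zero_mul]

/-- `det X = ± x_{n1} det X_R`, with the same sign as for `x_{1n}`. -/
lemma det_eq_schurR {X : Mat (m + 1)} (h : X (Fin.last m) 0 ≠ 0) :
    X.det = (-1) ^ m * X (Fin.last m) 0 * (schurR X).det := by
  have hs : schurR X = (schurL Xᵀ)ᵀ := by
    ext i j
    simp [schurR, schurL]
    ring
  rw [hs, Matrix.det_transpose, ← Matrix.det_transpose X, det_eq_schurL (X := Xᵀ) h]
  rfl

lemma det_schurR_ne_zero {X : Mat (m + 1)} (hX : X.det ≠ 0) (h : X (Fin.last m) 0 ≠ 0) :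
    (schurR X).det ≠ 0 := fun h0 => hX (by rw [det_eq_schurR h, h0, mul_zero])

lemma det_psiOne {X : Mat (m + 1)} (hX : X.det ≠ 0) (h : X 0 (Fin.last m) ≠ 0)
    (h' : X (Fin.last m) 0 ≠ 0) :
    (psiOne X).det = X (Fin.last m) 0 / X 0 (Fin.last m) := by
  have e : (-1 : ℂ) ^ m * X 0 (Fin.last m) * (schurL X).det
      = (-1) ^ m * X (Fin.last m) 0 * (schurR X).det := by
    rw [← det_eq_schurL h, det_eq_schurR h']
  have e' : X 0 (Fin.last m) * (schurL X).det = X (Fin.last m) 0 * (schurR X).det := by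
    have : (-1 : ℂ) ^ m ≠ 0 := by simp
    apply mul_left_cancel₀ this
    rw [← mul_assoc, e, mul_assoc]
  have h1 := det_schurR_ne_zero hX h'
  rw [psiOne, Matrix.det_mul, Matrix.det_nonsing_inv, Ring.inverse_eq_inv']
  field_simp
  rw [mul_comm, e', mul_comm]

/-- The relations behind the cancellation of the first and last rows and columns. -/
lemma rowFirst_mul_inclLast_mul_schurL {X : Mat (m + 1)} (h : X 0 (Fin.last m) ≠ 0)
    (h' : X (Fin.last m) 0 ≠ 0) :
    rowFirst (vecR X) * inclLast m * schurL X
      = schurR X * ((inclLast m)ᵀ * colFirst (covecL X)) := by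
  rw [Matrix.mul_assoc, ← mul_colFirst_self h, ← Matrix.mul_assoc, rowFirst_mul_self h',
    Matrix.mul_assoc]

lemma rowLast_mul_inclFirst_mul_schurR {X : Mat (m + 1)} (h : X 0 (Fin.last m) ≠ 0)
    (h' : X (Fin.last m) 0 ≠ 0) :
    rowLast (vecL X) * inclFirst m * schurR X
      = schurL X * ((inclFirst m)ᵀ * colLast (covecR X)) := by
  rw [Matrix.mul_assoc, ← mul_colLast_self h', ← Matrix.mul_assoc, rowLast_mul_self h,
    Matrix.mul_assoc]

/-! ### The map to the dual group -/

lemma differentiableAt_psiOne {X : Mat (m + 1)} (hX : X ∈ domOne m) :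
    DifferentiableAt ℂ psiOne X := by
  obtain ⟨hd, h, h'⟩ := hX
  exact (fderiv_matrix_mul (differentiableAt_schurL h) (differentiableAt_inv
    (differentiableAt_schurR h') (det_schurR_ne_zero hd h'))).1

/-- Differentiate `U X_R = X_L`. -/
lemma fderiv_psiOne {X : Mat (m + 1)} (hX : X ∈ domOne m) (H : Mat (m + 1)) :
    fderiv ℂ psiOne X H = (rowLast (vecL X) * H * colFirst (covecL X)
      - psiOne X * (rowFirst (vecR X) * H * colLast (covecR X))) * (schurR X)⁻¹ := by
  have hψ := differentiableAt_psiOne hX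
  obtain ⟨hd, h, h'⟩ := hX
  have hR := det_schurR_ne_zero hd h'
  have hcont : ContinuousAt (fun Y : Mat (m + 1) => (schurR Y).det) X :=
    (differentiableAt_det (differentiableAt_matrix.1 (differentiableAt_schurR h'))).continuousAt
  have hev : (fun Y => psiOne Y * schurR Y) =ᶠ[nhds X] schurL := by
    filter_upwards [hcont.eventually_ne hR] with Y hY
    rw [psiOne, Matrix.nonsing_inv_mul_cancel_right _ _ (isUnit_iff_ne_zero.2 hY)]
  have hmul : fderiv ℂ schurL X H
      = fderiv ℂ psiOne X H * schurR X + psiOne X * fderiv ℂ schurR X H :=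
    (DFunLike.congr_fun hev.fderiv_eq H).symm.trans
      ((fderiv_matrix_mul hψ (differentiableAt_schurR h')).2 H)
  rw [fderiv_schurL h, fderiv_schurR h'] at hmul
  rw [hmul, add_sub_cancel_right, Matrix.mul_nonsing_inv_cancel_right _ _ (isUnit_iff_ne_zero.2 hR)]

end Calculus

/-! ### The bivector on `GL_n` -/

/-- The value on two covectors `G`, `G'` at `X` of the bivector defining the bracket on `GL_n`. -/
def bivector {n : ℕ} (X G G' : Mat n) : ℂ :=
  form (rPlusBar (G * X)) (G' * X) - form (rPlus (X * G)) (X * G')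

lemma bracket_eq_bivector {n : ℕ} (f g : Mat n → ℂ) (X : Mat n) :
    bracket f g X = bivector X (grad f X) (grad g X) := rfl

lemma bivector_add_left {n : ℕ} (X G₁ G₂ G' : Mat n) :
    bivector X (G₁ + G₂) G' = bivector X G₁ G' + bivector X G₂ G' := by
  simp only [bivector, rPlusBar_eq, rPlus_eq, Matrix.add_mul, Matrix.mul_add, map_add,
    form_add_left]
  ring

lemma bivector_add_right {n : ℕ} (X G G₁ G₂ : Mat n) :
    bivector X G (G₁ + G₂) = bivector X G G₁ + bivector X G G₂ := by
  simp only [bivector, Matrix.add_mul, Matrix.mul_add, form_add_right]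
  ring

/-- The bivector is skew-symmetric on the covectors that annihilate the Euler vector field. -/
lemma bivector_swap {n : ℕ} {X G G' : Mat n} (h : (G * X).trace = 0) (h' : (G' * X).trace = 0) :
    bivector X G' G = -bivector X G G' := by
  have h1 := (shiftPair_gammaStar n).form_rOp (fun i => ((i : ℕ) : ℂ) + 1) h h'
  have h2 := (shiftPair_gamma n).form_rOp (fun i => (n : ℂ) - (i : ℕ))
    (A := X * G) (B := X * G') (by rw [Matrix.trace_mul_comm, h])
    (by rw [Matrix.trace_mul_comm, h'])
  rw [← rPlusBar_eq, ← rPlusBar_eq] at h1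
  rw [← rPlus_eq, ← rPlus_eq] at h2
  have h3 : form (G * X) (G' * X) = form (X * G) (X * G') := by
    rw [form, form, Matrix.mul_assoc X G, Matrix.trace_mul_comm X]
    simp only [Matrix.mul_assoc]
  rw [bivector, bivector, form_comm _ (G * X), form_comm _ (X * G)]
  linear_combination h1 - h2 + h3

variable {m : ℕ}

/-! ### The pullback of the dual bracket -/

/-- The pullback to `X` of the covector `ξ` at `psiOne X`. -/
def pullOne (X : Mat (m + 1)) (ξ : Mat m) : Mat (m + 1) :=
  colFirst (covecL X) * ((schurR X)⁻¹ * ξ) * rowLast (vecL X)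
    - colLast (covecR X) * ((schurR X)⁻¹ * ξ * psiOne X) * rowFirst (vecR X)

lemma form_pullOne {X : Mat (m + 1)} (hX : X ∈ domOne m) (ξ : Mat m) (H : Mat (m + 1)) :
    form ξ (fderiv ℂ psiOne X H) = form (pullOne X ξ) H := by
  have key : ∀ (M : Matrix (Fin m) (Fin (m + 1)) ℂ) (N : Matrix (Fin (m + 1)) (Fin m) ℂ)
      (a b : Mat m), form a (b * (M * H * N) * (schurR X)⁻¹)
        = form (N * ((schurR X)⁻¹ * a * b) * M) H := by
    intro M N a b
    rw [form, form]
    have e1 : a * (b * (M * H * N) * (schurR X)⁻¹)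
        = (a * b * M * H) * (N * (schurR X)⁻¹) := by simp only [Matrix.mul_assoc]
    rw [e1, Matrix.trace_mul_comm]
    simp only [Matrix.mul_assoc]
  have h1 := key (rowLast (vecL X)) (colFirst (covecL X)) ξ 1
  have h2 := key (rowFirst (vecR X)) (colLast (covecR X)) ξ (psiOne X)
  rw [Matrix.one_mul, Matrix.mul_one] at h1
  rw [fderiv_psiOne hX, Matrix.sub_mul, form_sub_right, h1, h2, pullOne, form_sub_left]

lemma psiOne_mul_schurR {X : Mat (m + 1)} (hX : X ∈ domOne m) :
    psiOne X * schurR X = schurL X := by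
  rw [psiOne, Matrix.nonsing_inv_mul_cancel_right _ _
    (isUnit_iff_ne_zero.2 (det_schurR_ne_zero hX.1 hX.2.2))]

lemma schurR_mul_inv {X : Mat (m + 1)} (hX : X ∈ domOne m) :
    schurR X * (schurR X)⁻¹ = 1 :=
  Matrix.mul_nonsing_inv _ (isUnit_iff_ne_zero.2 (det_schurR_ne_zero hX.1 hX.2.2))

lemma pullOne_mul {X : Mat (m + 1)} (hX : X ∈ domOne m) (ξ : Mat m) :
    pullOne X ξ * X = colFirst (covecL X) * ((schurR X)⁻¹ * ξ * schurL X) * (inclFirst m)ᵀ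
      - colLast (covecR X) * ((schurR X)⁻¹ * ξ * schurL X) * (inclLast m)ᵀ := by
  rw [pullOne, Matrix.sub_mul, Matrix.mul_assoc _ _ X, Matrix.mul_assoc _ _ X,
    rowLast_mul_self hX.2.1, rowFirst_mul_self hX.2.2, ← psiOne_mul_schurR hX]
  simp only [Matrix.mul_assoc]

lemma mul_pullOne {X : Mat (m + 1)} (hX : X ∈ domOne m) (ξ : Mat m) :
    X * pullOne X ξ = inclLast m * (psiOne X * ξ) * rowLast (vecL X)
      - inclFirst m * (ξ * psiOne X) * rowFirst (vecR X) := by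
  have h1 : X * (colFirst (covecL X) * ((schurR X)⁻¹ * ξ) * rowLast (vecL X))
      = X * colFirst (covecL X) * (schurR X)⁻¹ * ξ * rowLast (vecL X) := by
    simp only [Matrix.mul_assoc]
  have h2 : X * (colLast (covecR X) * ((schurR X)⁻¹ * ξ * psiOne X) * rowFirst (vecR X))
      = X * colLast (covecR X) * (schurR X)⁻¹ * ξ * psiOne X * rowFirst (vecR X) := by
    simp only [Matrix.mul_assoc]
  rw [pullOne, Matrix.mul_sub, h1, h2, mul_colFirst_self hX.2.1, mul_colLast_self hX.2.2,
    Matrix.mul_assoc (inclFirst m), schurR_mul_inv hX, Matrix.mul_one, psiOne]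
  simp only [Matrix.mul_assoc]

lemma trace_pullOne {X : Mat (m + 1)} (hX : X ∈ domOne m) (ξ : Mat m) :
    (pullOne X ξ * X).trace = 0 := by
  rw [pullOne_mul hX, trace_left]

/-- The boundary terms of the left and of the right part cancel by
`rowFirst_mul_inclLast_mul_schurL` and `rowLast_mul_inclFirst_mul_schurR`. -/
lemma bivector_pullOne {X : Mat (m + 1)} (hX : X ∈ domOne m) (ξ η : Mat m) :
    bivector X (pullOne X ξ) (pullOne X η)
      = -(form (rPlus (comm ξ (psiOne X))) (comm η (psiOne X))
        - form (comm ξ (psiOne X)) (η * psiOne X)) := by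
  set U := psiOne X with hU
  have htr : ∀ ζ : Mat m, (U * ζ).trace = (ζ * U).trace := fun ζ => Matrix.trace_mul_comm _ _
  rw [bivector, pullOne_mul hX, pullOne_mul hX, mul_pullOne hX, mul_pullOne hX,
    form_rPlusBar_left, form_rPlus_right _ _ (htr ξ) (htr η)]
  have hLU := psiOne_mul_schurR hX
  have hRi := schurR_mul_inv hX
  -- conjugation by `X_R`
  have h1 : form ((schurR X)⁻¹ * ξ * schurL X) ((schurR X)⁻¹ * η * schurL X)
      = form (ξ * U) (η * U) := by
    rw [← hLU, form, form, ← hU]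
    have e : (schurR X)⁻¹ * ξ * (U * schurR X) * ((schurR X)⁻¹ * η * (U * schurR X))
        = (schurR X)⁻¹ * (ξ * U * (schurR X * (schurR X)⁻¹) * η * U * schurR X) := by
      simp only [Matrix.mul_assoc]
    rw [e, hRi, Matrix.trace_mul_comm, Matrix.mul_one, Matrix.mul_assoc _ (schurR X), hRi,
      Matrix.mul_one]
    simp only [Matrix.mul_assoc]
  have h2 : form ((schurR X)⁻¹ * ξ * schurL X * ((inclLast m)ᵀ * colFirst (covecL X)))
        ((schurR X)⁻¹ * η * schurL X * ((inclFirst m)ᵀ * colLast (covecR X)))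
      = form (ξ * U * (rowFirst (vecR X) * inclLast m))
        (U * η * (rowLast (vecL X) * inclFirst m)) := by
    have r1 := rowFirst_mul_inclLast_mul_schurL hX.2.1 hX.2.2
    have r2 := rowLast_mul_inclFirst_mul_schurR hX.2.1 hX.2.2
    rw [form, form]
    have e1 : (schurR X)⁻¹ * ξ * schurL X * ((inclLast m)ᵀ * colFirst (covecL X))
          * ((schurR X)⁻¹ * η * schurL X * ((inclFirst m)ᵀ * colLast (covecR X)))
        = (schurR X)⁻¹ * ξ * U * (schurR X * ((inclLast m)ᵀ * colFirst (covecL X)))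
          * ((schurR X)⁻¹ * η * (schurL X * ((inclFirst m)ᵀ * colLast (covecR X)))) := by
      rw [← hLU]; simp only [hU, Matrix.mul_assoc]
    have e2 : (schurR X)⁻¹ * ξ * U * (rowFirst (vecR X) * inclLast m * schurL X)
          * ((schurR X)⁻¹ * η * (rowLast (vecL X) * inclFirst m * schurR X))
        = (schurR X)⁻¹ * (ξ * U * (rowFirst (vecR X) * inclLast m) *
          (U * (schurR X * (schurR X)⁻¹) * η * (rowLast (vecL X) * inclFirst m)) * schurR X) := by
      rw [← hLU]; simp only [hU, Matrix.mul_assoc]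
    rw [e1, ← r1, ← r2, e2, Matrix.trace_mul_comm, Matrix.mul_assoc _ (schurR X), hRi,
      Matrix.mul_one, Matrix.mul_one]
  have h3 : ∀ ζ : Mat m, U * ζ - ζ * U = -comm ζ U := fun ζ => by rw [comm]; abel
  rw [h1, h2, h3, h3, rPlus_eq, rPlus_eq, map_neg, form_neg_left, form_neg_right, neg_neg]
  rw [comm, form_sub_left (ξ * U)]
  ring

/-! ### The pullback of the covectors on the space of rational functions -/

/-- The coefficients of the monic denominator, with the leading one. -/
def denomVec (c : Coeffs m) : Fin (m + 1) → ℂ := Fin.snoc (fun i => c (Sum.inl i)) 1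

/-- The coefficients of the numerator. -/
def numerVec (c : Coeffs m) : Fin (m + 1) → ℂ := fun i => c (Sum.inr i)

/-- The component along the coefficients of the denominator of the extension of the covector `u`
to pairs `(p, q)` with `p` not necessarily monic, which is homogeneous of degree `0`. -/
def denomCovec (c u : Coeffs m) : Fin (m + 1) → ℂ :=
  Fin.snoc (fun i => u (Sum.inl i))
    (-(∑ i : Fin m, c (Sum.inl i) * u (Sum.inl i) + numerVec c ⬝ᵥ numerVec u))

/-- The homogeneous extension annihilates the Euler vector field. -/
lemma denomVec_dotProduct_denomCovec (c u : Coeffs m) :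
    denomVec c ⬝ᵥ denomCovec c u = -(numerVec c ⬝ᵥ numerVec u) := by
  simp only [denomVec, denomCovec]
  rw [dotProduct, Fin.sum_univ_castSucc]
  simp only [Fin.snoc_castSucc, Fin.snoc_last]
  ring

lemma numerVec_add (u v : Coeffs m) : numerVec (u + v) = numerVec u + numerVec v := rfl

lemma numerVec_smul (s : ℂ) (u : Coeffs m) : numerVec (s • u) = s • numerVec u := rfl

lemma denomCovec_add (c u v : Coeffs m) :
    denomCovec c (u + v) = denomCovec c u + denomCovec c v := by
  ext i
  induction i using Fin.lastCases with
  | last =>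
    simp only [denomCovec, Fin.snoc_last, Pi.add_apply, numerVec_add, dotProduct_add, mul_add,
      Finset.sum_add_distrib]
    ring
  | cast i => simp [denomCovec, Fin.snoc_castSucc]

lemma denomCovec_smul (c : Coeffs m) (s : ℂ) (u : Coeffs m) :
    denomCovec c (s • u) = s • denomCovec c u := by
  ext i
  induction i using Fin.lastCases with
  | last =>
    simp only [denomCovec, Fin.snoc_last, Pi.smul_apply, numerVec_smul, dotProduct_smul,
      smul_eq_mul, mul_left_comm _ s, ← Finset.mul_sum]
    ring
  | cast i => simp [denomCovec, Fin.snoc_castSucc]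

/-- The left gradient of a function of the first and the last row, of homogeneity degree `0`. -/
def rowMat (c u : Coeffs m) : Mat (m + 1) :=
  vecMulVec (denomCovec c u) (denomVec c) + vecMulVec (numerVec u) (numerVec c)

lemma trace_vecMulVec_eq {n : ℕ} (u v : Fin n → ℂ) : (vecMulVec u v).trace = v ⬝ᵥ u := by
  rw [Matrix.trace_vecMulVec, dotProduct_comm]

lemma trace_rowMat (c u : Coeffs m) : (rowMat c u).trace = 0 := by
  rw [rowMat, Matrix.trace_add, trace_vecMulVec_eq, trace_vecMulVec_eq,
    denomVec_dotProduct_denomCovec, neg_add_cancel]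

lemma form_vecMulVec_right {n : ℕ} (M : Mat n) (u v : Fin n → ℂ) :
    form M (vecMulVec u v) = v ⬝ᵥ (M *ᵥ u) := by
  rw [form, Matrix.mul_vecMulVec, trace_vecMulVec_eq]

/-- The pullback to `X` of the covector `u` at `psiTwo X`. -/
def pullTwo (X : Mat (m + 1)) (u : Coeffs m) : Mat (m + 1) :=
  (X 0 (Fin.last m))⁻¹ • (vecMulVec (denomCovec (psiTwo X) u) (Pi.single 0 1)
    + vecMulVec (numerVec u) (Pi.single (Fin.last m) 1))

lemma row_zero_eq {X : Mat (m + 1)} (h : X 0 (Fin.last m) ≠ 0) :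
    X 0 = X 0 (Fin.last m) • denomVec (psiTwo X) := by
  ext i
  induction i using Fin.lastCases with
  | last => simp [denomVec, Fin.snoc_last]
  | cast i => simp [denomVec, Fin.snoc_castSucc, psiTwo, mul_div_cancel₀ _ h]

lemma row_last_eq {X : Mat (m + 1)} (h : X 0 (Fin.last m) ≠ 0) :
    X (Fin.last m) = X 0 (Fin.last m) • numerVec (psiTwo X) := by
  ext i; simp [numerVec, psiTwo, mul_div_cancel₀ _ h]

lemma single_vecMul_eq {n : ℕ} (X : Mat n) (i : Fin n) : Pi.single i 1 ᵥ* X = X i := by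
  rw [Matrix.single_one_vecMul]; rfl

lemma pullTwo_mul {X : Mat (m + 1)} (h : X 0 (Fin.last m) ≠ 0) (u : Coeffs m) :
    pullTwo X u * X = rowMat (psiTwo X) u := by
  rw [pullTwo, Matrix.smul_mul, Matrix.add_mul, Matrix.vecMulVec_mul, Matrix.vecMulVec_mul,
    single_vecMul_eq, single_vecMul_eq, congrArg (vecMulVec (numerVec u)) (row_last_eq h),
    congrArg (vecMulVec (denomCovec (psiTwo X) u)) (row_zero_eq h), Matrix.vecMulVec_smul,
    Matrix.vecMulVec_smul, ← smul_add, inv_smul_smul₀ h, rowMat]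

lemma mul_pullTwo (X : Mat (m + 1)) (u : Coeffs m) :
    X * pullTwo X u = (X 0 (Fin.last m))⁻¹ •
      (vecMulVec (X *ᵥ denomCovec (psiTwo X) u) (Pi.single 0 1)
        + vecMulVec (X *ᵥ numerVec u) (Pi.single (Fin.last m) 1)) := by
  rw [pullTwo, Matrix.mul_smul, Matrix.mul_add, Matrix.mul_vecMulVec, Matrix.mul_vecMulVec]

lemma vecMulVec_single_zero_self (m : ℕ) :
    vecMulVec (Pi.single 0 1) (Pi.single 0 1) = 1 - embLast (1 : Mat m) := by
  apply ext_succ <;> intros <;>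
    simp [vecMulVec_apply, Pi.single_apply, Matrix.one_apply, embLast_apply, embLast_zero_left,
      embLast_zero_right, eq_comm]

lemma vecMulVec_single_last_self (m : ℕ) :
    vecMulVec (Pi.single (Fin.last m) 1) (Pi.single (Fin.last m) 1)
      = 1 - embFirst (1 : Mat m) := by
  apply ext_castSucc <;> intros <;>
    simp [vecMulVec_apply, Pi.single_apply, Matrix.one_apply, embFirst_apply, embFirst_last_left,
      embFirst_last_right, eq_comm]

lemma upperLin_one (n : ℕ) : upperLin n 1 = 0 := by
  ext i j
  simp only [← upperPart_eq, upperPart, of_apply, Matrix.one_apply, Matrix.zero_apply]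
  split_ifs with h1 h2
  · exact absurd h2 h1.ne
  · rfl
  · rfl

/-- `R₊` on a matrix supported in the first and the last column. -/
lemma exists_rPlus_columns {u u' : Fin (m + 1) → ℂ} (h : u 0 + u' (Fin.last m) = 0) :
    ∃ s : ℂ, rPlus (vecMulVec u (Pi.single 0 1) + vecMulVec u' (Pi.single (Fin.last m) 1))
      = vecMulVec u' (Pi.single (Fin.last m) 1) + s • (1 : Mat (m + 1)) := by
  obtain ⟨s, hs⟩ := (shiftPair_gamma (m + 1)).exists_rOp_sub_right
    (fun i => ((m + 1 : ℕ) : ℂ) - (i : ℕ)) (B := embLast (1 : Mat m))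
    (by rw [gammaStar_embLast, Matrix.trace_sub, trace_embFirst, trace_embLast, sub_self])
    (by rw [upperLin_embLast, upperLin_one]; simp [embLast])
  rw [gammaStar_embLast] at hs
  have h1 := rPlus_vecMulVec_single_zero (u := u - u 0 • Pi.single 0 1) (by simp)
  have h2 := rPlus_vecMulVec_single_last
    (u := u' - u' (Fin.last m) • Pi.single (Fin.last m) 1) (by simp)
  rw [rPlus_eq] at h1 h2
  have hu' : u' (Fin.last m) = -u 0 := by linear_combination h
  have e : vecMulVec u (Pi.single 0 1) + vecMulVec u' (Pi.single (Fin.last m) 1)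
      = vecMulVec (u - u 0 • Pi.single 0 1) (Pi.single 0 1)
        + vecMulVec (u' - u' (Fin.last m) • Pi.single (Fin.last m) 1) (Pi.single (Fin.last m) 1)
        - u 0 • (embLast (1 : Mat m) - embFirst 1) := by
    rw [Matrix.sub_vecMulVec, Matrix.sub_vecMulVec, Matrix.smul_vecMulVec, Matrix.smul_vecMulVec,
      vecMulVec_single_zero_self, vecMulVec_single_last_self, hu']
    module
  refine ⟨-(u 0 * s) + u 0, ?_⟩
  rw [e, rPlus_eq, map_sub, map_add, h1, h2, map_smul, hs, Matrix.sub_vecMulVec,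
    Matrix.smul_vecMulVec, vecMulVec_single_last_self, hu']
  module

/-- `R̄₊` on a matrix supported in the first and the last row. -/
lemma exists_rPlusBar_rows {r r' : Fin (m + 1) → ℂ} (h : r 0 + r' (Fin.last m) = 0) :
    ∃ s : ℂ, rPlusBar (vecMulVec (Pi.single 0 1) r + vecMulVec (Pi.single (Fin.last m) 1) r')
      = vecMulVec (Pi.single 0 1) r + s • (1 : Mat (m + 1)) := by
  obtain ⟨s, hs⟩ := (shiftPair_gammaStar (m + 1)).exists_rOp_sub_right
    (fun i => ((i : ℕ) : ℂ) + 1) (B := embFirst (1 : Mat m))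
    (by rw [gamma_embFirst, Matrix.trace_sub, trace_embFirst, trace_embLast, sub_self])
    (by rw [upperLin_embFirst, upperLin_one]; simp [embFirst])
  rw [gamma_embFirst] at hs
  have h1 := rPlusBar_vecMulVec_single_zero (r := r - r 0 • Pi.single 0 1) (by simp)
  have h2 := rPlusBar_vecMulVec_single_last
    (r := r' - r' (Fin.last m) • Pi.single (Fin.last m) 1) (by simp)
  rw [rPlusBar_eq] at h1 h2
  have hr' : r' (Fin.last m) = -r 0 := by linear_combination h
  have e : vecMulVec (Pi.single 0 1) r + vecMulVec (Pi.single (Fin.last m) 1) r'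
      = vecMulVec (Pi.single 0 1) (r - r 0 • Pi.single 0 1)
        + vecMulVec (Pi.single (Fin.last m) 1) (r' - r' (Fin.last m) • Pi.single (Fin.last m) 1)
        + r 0 • (embFirst (1 : Mat m) - embLast 1) := by
    rw [Matrix.vecMulVec_sub, Matrix.vecMulVec_sub, Matrix.vecMulVec_smul, Matrix.vecMulVec_smul,
      vecMulVec_single_zero_self, vecMulVec_single_last_self, hr']
    module
  refine ⟨r 0 * s - r 0, ?_⟩
  rw [e, rPlusBar_eq, map_add, map_add, h1, h2, map_smul, hs, Matrix.vecMulVec_sub,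
    Matrix.vecMulVec_smul, vecMulVec_single_zero_self]
  module

/-- The bivector on the space of rational functions, in terms of the coefficients. -/
def ratBivector (c u v : Coeffs m) : ℂ :=
  form (rPlusBar (rowMat c u)) (rowMat c v)
    - ((numerVec c ⬝ᵥ denomCovec c v) * (denomVec c ⬝ᵥ numerVec u)
      + (numerVec c ⬝ᵥ numerVec u) * (numerVec c ⬝ᵥ numerVec v))

lemma trace_pullTwo {X : Mat (m + 1)} (h : X 0 (Fin.last m) ≠ 0) (u : Coeffs m) :
    (pullTwo X u * X).trace = 0 := by
  rw [pullTwo_mul h, trace_rowMat]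

lemma exists_rPlus_mul_pullTwo {X : Mat (m + 1)} (h : X 0 (Fin.last m) ≠ 0) (u : Coeffs m) :
    ∃ s : ℂ, rPlus (X * pullTwo X u)
      = (X 0 (Fin.last m))⁻¹ • vecMulVec (X *ᵥ numerVec u) (Pi.single (Fin.last m) 1)
        + s • (1 : Mat (m + 1)) := by
  obtain ⟨s, hs⟩ := exists_rPlus_columns (u := X *ᵥ denomCovec (psiTwo X) u)
    (u' := X *ᵥ numerVec u) (by
      rw [Matrix.mulVec, Matrix.mulVec, row_last_eq h]
      conv_lhs => enter [1]; rw [row_zero_eq h]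
      rw [smul_dotProduct, smul_dotProduct, denomVec_dotProduct_denomCovec, smul_neg,
        neg_add_cancel])
  refine ⟨(X 0 (Fin.last m))⁻¹ * s, ?_⟩
  rw [rPlus_eq] at hs
  rw [mul_pullTwo, rPlus_eq, map_smul, hs]
  module

lemma bivector_pullTwo {X : Mat (m + 1)} (h : X 0 (Fin.last m) ≠ 0) (u v : Coeffs m) :
    bivector X (pullTwo X u) (pullTwo X v) = ratBivector (psiTwo X) u v := by
  obtain ⟨s, hs⟩ := exists_rPlus_mul_pullTwo h u
  have htr : (X * pullTwo X v).trace = 0 := by rw [Matrix.trace_mul_comm, trace_pullTwo h]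
  have h0 : ∀ w : Fin (m + 1) → ℂ, (X *ᵥ w) 0 = X 0 (Fin.last m) * (denomVec (psiTwo X) ⬝ᵥ w) := by
    intro w
    rw [Matrix.mulVec]
    conv_lhs => rw [row_zero_eq h]
    rw [smul_dotProduct, smul_eq_mul]
  have hl : ∀ w : Fin (m + 1) → ℂ,
      (X *ᵥ w) (Fin.last m) = X 0 (Fin.last m) * (numerVec (psiTwo X) ⬝ᵥ w) := by
    intro w
    rw [Matrix.mulVec, row_last_eq h, smul_dotProduct, smul_eq_mul]
  rw [bivector, pullTwo_mul h, pullTwo_mul h, hs, form_add_left, form_smul_left (s := s),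
    form_one_left, htr, mul_zero, add_zero, mul_pullTwo, form_smul_left, form_smul_right,
    form_add_right, form_vecMulVec_right, form_vecMulVec_right, ratBivector,
    Matrix.vecMulVec_mulVec, Matrix.vecMulVec_mulVec]
  simp only [single_one_dotProduct, dotProduct_smul, h0, hl, op_smul_eq_mul]
  field_simp

/-- The two families of functions Poisson commute. -/
lemma bivector_pullOne_pullTwo {X : Mat (m + 1)} (hX : X ∈ domOne m) (ξ : Mat m)
    (u : Coeffs m) : bivector X (pullOne X ξ) (pullTwo X u) = 0 := by
  obtain ⟨s, hs⟩ := exists_rPlusBar_left (covecL X) (covecR X) ((schurR X)⁻¹ * ξ * schurL X)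
  obtain ⟨t, ht⟩ := exists_rPlus_mul_pullTwo hX.2.1 u
  have hG : (X * pullOne X ξ).trace = 0 := by rw [Matrix.trace_mul_comm, trace_pullOne hX]
  have hN : (X * pullTwo X u).trace = 0 := by rw [Matrix.trace_mul_comm, trace_pullTwo hX.2.1]
  have hadj := (shiftPair_gamma (m + 1)).form_rOp
    (fun i => ((m + 1 : ℕ) : ℂ) - (i : ℕ)) hG hN
  rw [← rPlus_eq, ← rPlus_eq, ht, form_add_right, form_smul_right (s := t), form_one_right, hG,
    mul_zero, add_zero, form_smul_right] at hadj
  have hcyc : ∀ K : Mat (m + 1), form K (pullTwo X u * X) = form (X * K) (pullTwo X u) := by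
    intro K
    rw [form, form, ← Matrix.mul_assoc, Matrix.trace_mul_comm, Matrix.mul_assoc]
  have hK : X * (colLast (covecR X) * ((schurR X)⁻¹ * ξ * schurL X) * (inclLast m)ᵀ)
      = inclFirst m * (ξ * schurL X * (inclLast m)ᵀ) := by
    have e : X * (colLast (covecR X) * ((schurR X)⁻¹ * ξ * schurL X) * (inclLast m)ᵀ)
        = X * colLast (covecR X) * (schurR X)⁻¹ * (ξ * schurL X * (inclLast m)ᵀ) := by
      simp only [Matrix.mul_assoc]
    rw [e, mul_colLast_self hX.2.2, Matrix.mul_assoc (inclFirst m), schurR_mul_inv hX,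
      Matrix.mul_one]
  have hGX : X * pullOne X ξ * X
      = inclLast m * (psiOne X * ξ * schurL X * (inclFirst m)ᵀ)
        - inclFirst m * (ξ * schurL X * (inclLast m)ᵀ) := by
    rw [mul_pullOne hX, Matrix.sub_mul, Matrix.mul_assoc _ _ X, Matrix.mul_assoc _ _ X,
      rowLast_mul_self hX.2.1, rowFirst_mul_self hX.2.2, ← psiOne_mul_schurR hX]
    simp only [Matrix.mul_assoc]
  have hrow : ∀ (M : Matrix (Fin m) (Fin (m + 1)) ℂ) (α : Fin (m + 1) → ℂ),
      ((inclLast m * M) *ᵥ α) 0 = 0 := by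
    intro M α
    rw [← Matrix.mulVec_mulVec, inclLast_mulVec_zero]
  have hrow' : ∀ (M : Matrix (Fin m) (Fin (m + 1)) ℂ) (α : Fin (m + 1) → ℂ),
      ((inclFirst m * M) *ᵥ α) (Fin.last m) = 0 := by
    intro M α
    rw [← Matrix.mulVec_mulVec, inclFirst_mulVec_last]
  have hR : form (X * pullOne X ξ) (X * pullTwo X u)
      = (X 0 (Fin.last m))⁻¹
        * (-((inclFirst m * (ξ * schurL X * (inclLast m)ᵀ)) *ᵥ denomCovec (psiTwo X) u) 0
          + form (X * pullOne X ξ)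
            (vecMulVec (X *ᵥ numerVec u) (Pi.single (Fin.last m) 1))) := by
    rw [mul_pullTwo, form_smul_right, form_add_right]
    congr 2
    rw [form_vecMulVec_right, Matrix.mulVec_mulVec, hGX, Matrix.sub_mulVec, single_one_dotProduct,
      Pi.sub_apply, hrow, zero_sub]
  have hL : form (rPlusBar (pullOne X ξ * X)) (pullTwo X u * X)
      = -((X 0 (Fin.last m))⁻¹
        * ((inclFirst m * (ξ * schurL X * (inclLast m)ᵀ)) *ᵥ denomCovec (psiTwo X) u) 0) := by
    rw [pullOne_mul hX, hs, form_add_left, form_smul_left, form_one_left, trace_pullTwo hX.2.1,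
      mul_zero, add_zero, form_neg_left, hcyc, hK, pullTwo, form_smul_right, form_add_right,
      form_vecMulVec_right, form_vecMulVec_right, single_one_dotProduct, single_one_dotProduct,
      hrow', add_zero]
  rw [bivector, hL]
  linear_combination -hadj - hR

lemma bivector_pullTwo_pullOne {X : Mat (m + 1)} (hX : X ∈ domOne m) (ξ : Mat m)
    (u : Coeffs m) : bivector X (pullTwo X u) (pullOne X ξ) = 0 := by
  rw [bivector_swap (trace_pullOne hX ξ) (trace_pullTwo hX.2.1 u),
    bivector_pullOne_pullTwo hX, neg_zero]

/-! ### Laurent expansions at infinity -/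

/-- The polynomial with coefficients `y`. -/
def vecPoly (y : Fin (m + 1) → ℂ) : Polynomial ℂ :=
  ∑ i, Polynomial.C (y i) * Polynomial.X ^ (i : ℕ)

lemma numer_eq_vecPoly (c : Coeffs m) : numer c = vecPoly (numerVec c) := rfl

lemma denom_eq_vecPoly (c : Coeffs m) : denom c = vecPoly (denomVec c) := by
  rw [denom, vecPoly, Fin.sum_univ_castSucc]
  simp [denomVec, Fin.snoc_castSucc, Fin.snoc_last, add_comm]

lemma coeff_vecPoly (y : Fin (m + 1) → ℂ) (i : Fin (m + 1)) : (vecPoly y).coeff i = y i := by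
  simp [vecPoly, Polynomial.coeff_X_pow, ← Fin.ext_iff]

lemma natDegree_vecPoly_le (y : Fin (m + 1) → ℂ) : (vecPoly y).natDegree ≤ m :=
  Polynomial.natDegree_sum_le_of_forall_le _ _ fun i _ =>
    (Polynomial.natDegree_C_mul_X_pow_le _ _).trans (Nat.lt_succ_iff.1 i.isLt)

/-- The polynomial with coefficients `y` in the variable `t = λ⁻¹`, multiplied by `t ^ m`. -/
def revSeries (y : Fin (m + 1) → ℂ) : PowerSeries ℂ :=
  ((Polynomial.reflect m (vecPoly y) : Polynomial ℂ) : PowerSeries ℂ)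

lemma coeff_revSeries (y : Fin (m + 1) → ℂ) (k : ℕ) :
    PowerSeries.coeff k (revSeries y) = (vecPoly y).coeff (Polynomial.revAt m k) := by
  rw [revSeries, Polynomial.coeff_coe, Polynomial.coeff_reflect]

lemma revSeries_eq_sum (y : Fin (m + 1) → ℂ) :
    revSeries y = ∑ i : Fin (m + 1), PowerSeries.C (y i) * PowerSeries.X ^ (m - (i : ℕ)) := by
  have h : Polynomial.reflect m (vecPoly y)
      = ∑ i : Fin (m + 1), Polynomial.C (y i) * Polynomial.X ^ (m - (i : ℕ)) := by
    ext k
    simp only [Polynomial.coeff_reflect, vecPoly, Polynomial.finsetSum_coeff,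
      Polynomial.coeff_C_mul, Polynomial.coeff_X_pow]
    refine Finset.sum_congr rfl fun i _ => ?_
    have hi : (i : ℕ) ≤ m := Nat.lt_succ_iff.1 i.isLt
    congr 1
    by_cases hk : k ≤ m
    · rw [Polynomial.revAt_le hk]
      congr 1
      exact propext ⟨fun h => by omega, fun h => by omega⟩
    · rw [Polynomial.revAt_eq_self_of_lt (by omega), if_neg (by omega), if_neg (by omega)]
  rw [revSeries, h, ← Polynomial.coeToPowerSeries.ringHom_apply, map_sum]
  simp

lemma revSeries_add (y z : Fin (m + 1) → ℂ) : revSeries (y + z) = revSeries y + revSeries z := by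
  simp [revSeries_eq_sum, add_mul, Finset.sum_add_distrib]

lemma revSeries_smul (s : ℂ) (y : Fin (m + 1) → ℂ) : revSeries (s • y) = s • revSeries y := by
  simp [revSeries_eq_sum, Finset.smul_sum, PowerSeries.smul_eq_C_mul, mul_assoc]

/-- Multiplication by a reversed polynomial is a sum over a window of length `m + 1`. -/
lemma coeff_revSeries_mul (y : Fin (m + 1) → ℂ) (A : PowerSeries ℂ) (k : ℕ) :
    PowerSeries.coeff k (revSeries y * A)
      = ∑ i : Fin (m + 1), y i * PowerSeries.coeff (k + i) (PowerSeries.X ^ m * A) := by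
  rw [revSeries_eq_sum, Finset.sum_mul, map_sum]
  refine Finset.sum_congr rfl fun i _ => ?_
  have hi : (i : ℕ) ≤ m := Nat.lt_succ_iff.1 i.isLt
  have e : (PowerSeries.X : PowerSeries ℂ) ^ m * A
      = PowerSeries.X ^ (i : ℕ) * (PowerSeries.X ^ (m - (i : ℕ)) * A) := by
    rw [← mul_assoc, ← pow_add, Nat.add_sub_cancel' hi]
  rw [e, PowerSeries.coeff_X_pow_mul, mul_assoc, PowerSeries.coeff_C_mul]

/-- The expansion at infinity of the rational function with coefficients `c`. -/
def ratSeries (c : Coeffs m) : PowerSeries ℂ :=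
  revSeries (numerVec c) * (revSeries (denomVec c))⁻¹

lemma moment_eq (k : ℕ) (c : Coeffs m) : moment k c = PowerSeries.coeff k (ratSeries c) := by
  rw [moment, ratSeries, numer_eq_vecPoly, denom_eq_vecPoly]; rfl

lemma constantCoeff_revSeries_denomVec (c : Coeffs m) :
    PowerSeries.constantCoeff (revSeries (denomVec c)) = 1 := by
  rw [← PowerSeries.coeff_zero_eq_constantCoeff_apply, coeff_revSeries,
    Polynomial.revAt_le (Nat.zero_le m)]
  have := coeff_vecPoly (denomVec c) (Fin.last m)
  simpa [denomVec, Fin.snoc_last] using this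

lemma revSeries_denomVec_mul_inv (c : Coeffs m) :
    revSeries (denomVec c) * (revSeries (denomVec c))⁻¹ = 1 :=
  PowerSeries.mul_inv_cancel _ (by rw [constantCoeff_revSeries_denomVec]; exact one_ne_zero)

lemma revSeries_denomVec_mul_ratSeries (c : Coeffs m) :
    revSeries (denomVec c) * ratSeries c = revSeries (numerVec c) := by
  rw [ratSeries, mul_left_comm, revSeries_denomVec_mul_inv, mul_one]

/-- The coefficients of `1 / p(λ)` at infinity. -/
def invCoeff (c : Coeffs m) (k : ℕ) : ℂ :=
  PowerSeries.coeff k (PowerSeries.X ^ m * (revSeries (denomVec c))⁻¹)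

/-- The coefficients of `M(λ) / p(λ)` at infinity. -/
def quotCoeff (c : Coeffs m) (k : ℕ) : ℂ :=
  PowerSeries.coeff k (PowerSeries.X ^ m * (ratSeries c * (revSeries (denomVec c))⁻¹))

/-- The coefficients of `M(λ)²` at infinity. -/
def sqCoeff (c : Coeffs m) (k : ℕ) : ℂ := PowerSeries.coeff k (ratSeries c * ratSeries c)

lemma sum_denomVec_invCoeff (c : Coeffs m) (k : ℕ) :
    ∑ i : Fin (m + 1), denomVec c i * invCoeff c (k + i) = if k = 0 then 1 else 0 := by
  rw [← PowerSeries.coeff_one, ← revSeries_denomVec_mul_inv c, coeff_revSeries_mul]; rfl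

lemma sum_numerVec_invCoeff (c : Coeffs m) (k : ℕ) :
    ∑ i : Fin (m + 1), numerVec c i * invCoeff c (k + i) = moment k c := by
  rw [moment_eq, ratSeries, coeff_revSeries_mul]; rfl

lemma sum_denomVec_quotCoeff (c : Coeffs m) (k : ℕ) :
    ∑ i : Fin (m + 1), denomVec c i * quotCoeff c (k + i) = moment k c := by
  have e : ratSeries c = revSeries (denomVec c)
      * (ratSeries c * (revSeries (denomVec c))⁻¹) := by
    rw [mul_left_comm, revSeries_denomVec_mul_inv, mul_one]
  rw [moment_eq, e, coeff_revSeries_mul]; rfl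

lemma sum_numerVec_quotCoeff (c : Coeffs m) (k : ℕ) :
    ∑ i : Fin (m + 1), numerVec c i * quotCoeff c (k + i) = sqCoeff c k := by
  have e : ratSeries c * ratSeries c = revSeries (numerVec c)
      * (ratSeries c * (revSeries (denomVec c))⁻¹) := by
    conv_lhs => rw [ratSeries]
    rw [ratSeries]; ring
  rw [sqCoeff, e, coeff_revSeries_mul]; rfl

lemma invCoeff_of_lt (c : Coeffs m) {k : ℕ} (h : k < m) : invCoeff c k = 0 := by
  rw [invCoeff, PowerSeries.coeff_X_pow_mul', if_neg (by omega)]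

lemma quotCoeff_of_lt (c : Coeffs m) {k : ℕ} (h : k < m) : quotCoeff c k = 0 := by
  rw [quotCoeff, PowerSeries.coeff_X_pow_mul', if_neg (by omega)]

lemma denomVec_last (c : Coeffs m) : denomVec c (Fin.last m) = 1 := by
  simp [denomVec, Fin.snoc_last]

lemma invCoeff_self (c : Coeffs m) : invCoeff c m = 1 := by
  have h := sum_denomVec_invCoeff c 0
  rw [Fin.sum_univ_castSucc, Finset.sum_eq_zero fun i _ => by
    rw [invCoeff_of_lt c (by simp), mul_zero], zero_add, denomVec_last] at h
  simpa using h

lemma quotCoeff_self (c : Coeffs m) : quotCoeff c m = moment 0 c := by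
  have h := sum_denomVec_quotCoeff c 0
  rw [Fin.sum_univ_castSucc, Finset.sum_eq_zero fun i _ => by
    rw [quotCoeff_of_lt c (by simp), mul_zero], zero_add, denomVec_last] at h
  simpa using h

lemma numerVec_last (c : Coeffs m) : numerVec c (Fin.last m) = moment 0 c := by
  have h := sum_numerVec_invCoeff c 0
  rw [Fin.sum_univ_castSucc, Finset.sum_eq_zero fun i _ => by
    rw [invCoeff_of_lt c (by simp), mul_zero], zero_add] at h
  simpa [invCoeff_self] using h

lemma sqCoeff_eq (c : Coeffs m) (k : ℕ) :
    sqCoeff c k = moment 0 c * moment k c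
      + ∑ l ∈ Finset.range k, moment (l + 1) c * moment (k - l - 1) c := by
  rw [sqCoeff, PowerSeries.coeff_mul, Finset.Nat.sum_antidiagonal_eq_sum_range_succ_mk,
    Finset.sum_range_succ']
  simp only [← moment_eq, Nat.sub_zero]
  rw [add_comm]
  simp only [Nat.sub_sub]

/-! ### The brackets of the moments -/

/-- The differential of the `k`-th moment. -/
def momentCovec (c : Coeffs m) (k : ℕ) : Coeffs m :=
  Sum.elim (fun i : Fin m => -quotCoeff c (k + i)) (fun i : Fin (m + 1) => invCoeff c (k + i))

lemma numerVec_momentCovec (c : Coeffs m) (k : ℕ) (i : Fin (m + 1)) :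
    numerVec (momentCovec c k) i = invCoeff c (k + i) := rfl

lemma denomCovec_momentCovec (c : Coeffs m) (k : ℕ) (i : Fin (m + 1)) :
    denomCovec c (momentCovec c k) i = -quotCoeff c (k + i) := by
  induction i using Fin.lastCases with
  | cast i => simp [denomCovec, Fin.snoc_castSucc, momentCovec]
  | last =>
    have h1 := sum_denomVec_quotCoeff c k
    have h2 := sum_numerVec_invCoeff c k
    rw [Fin.sum_univ_castSucc, denomVec_last] at h1
    simp only [denomCovec, Fin.snoc_last, dotProduct, numerVec_momentCovec]
    rw [h2]
    simp only [denomVec, Fin.snoc_castSucc, Fin.val_castSucc, Fin.val_last, one_mul] at h1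
    simp only [momentCovec, Sum.elim_inl, mul_neg, Finset.sum_neg_distrib, Fin.val_last]
    linear_combination h1

/-- The entry of `rowMat c (momentCovec c k)` in column `j` and row `i`, where `a = k + i`: the
left gradient of a moment depends on `k` and on the row through their sum only. -/
def hankel (c : Coeffs m) (j : Fin (m + 1)) (a : ℕ) : ℂ :=
  invCoeff c a * numerVec c j - quotCoeff c a * denomVec c j

lemma rowMat_momentCovec (c : Coeffs m) (k : ℕ) (i j : Fin (m + 1)) :
    rowMat c (momentCovec c k) i j = hankel c j (k + i) := by
  rw [rowMat, Matrix.add_apply, vecMulVec_apply, vecMulVec_apply, denomCovec_momentCovec,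
    numerVec_momentCovec, hankel]
  ring

/-- The sums of the entries of `hankel` down a diagonal. The row index is not bounded by the size
of the matrix. -/
def hankelTail (c : Coeffs m) (j a : ℕ) : ℂ :=
  ∑ t : Fin (m + 1), if j ≤ t then hankel c t (a + t - j) else 0

lemma hankelTail_of_lt (c : Coeffs m) {j : ℕ} (hj : m < j) (a : ℕ) : hankelTail c j a = 0 :=
  Finset.sum_eq_zero fun t _ => if_neg (by have := t.isLt; omega)

lemma hankelTail_zero (c : Coeffs m) (a : ℕ) : hankelTail c 0 a = 0 := by
  have h1 := sum_numerVec_invCoeff c a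
  have h2 := sum_denomVec_quotCoeff c a
  simp only [hankelTail, hankel, Nat.zero_le, if_true, Nat.sub_zero, Finset.sum_sub_distrib]
  simp only [mul_comm (invCoeff c _), mul_comm (quotCoeff c _), h1, h2, sub_self]

lemma hankelTail_sub_succ (c : Coeffs m) (j : Fin (m + 1)) (a : ℕ) :
    hankelTail c j a - hankelTail c (j + 1) (a + 1) = hankel c j a := by
  rw [hankelTail, hankelTail, ← Finset.sum_sub_distrib, Finset.sum_eq_single j]
  · rw [if_pos le_rfl, if_neg (by omega), sub_zero, Nat.add_sub_cancel]
  · intro t _ ht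
    have : (t : ℕ) ≠ j := fun h => ht (Fin.ext h)
    by_cases h : (j : ℕ) ≤ t
    · rw [if_pos h, if_pos (by omega), show a + 1 + (t : ℕ) - (j + 1) = a + t - j by omega,
        sub_self]
    · rw [if_neg h, if_neg (by omega), sub_self]
  · simp

/-- The matrix `1/(1-γ*)` of the left gradient of a moment, up to the last row. -/
def tailMat (c : Coeffs m) (k : ℕ) : Mat (m + 1) :=
  Matrix.of fun i j => hankelTail c j (k + i)

lemma rowMat_momentCovec_eq (c : Coeffs m) (k : ℕ) :
    rowMat c (momentCovec c k) = (tailMat c k - gammaStar (m + 1) (tailMat c k))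
      - vecMulVec (Pi.single (Fin.last m) 1)
        (fun j : Fin (m + 1) => hankelTail c (j + 1) (k + m + 1)) := by
  rw [gammaStar_eq_emb]
  ext i j
  rw [rowMat_momentCovec, ← hankelTail_sub_succ, Matrix.sub_apply, Matrix.sub_apply,
    vecMulVec_apply, tailMat, of_apply, sub_sub, add_assoc k m 1]
  congr 1
  induction i using Fin.lastCases with
  | last => rw [embFirst_last_left, Pi.single_eq_same, Fin.val_last]; ring_nf
  | cast i =>
    rw [Pi.single_eq_of_ne (Fin.castSucc_lt_last i).ne, zero_mul, add_zero]
    induction j using Fin.lastCases with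
    | last => rw [embFirst_last_right, Fin.val_last, hankelTail_of_lt c (Nat.lt_succ_self m)]
    | cast j => rw [embFirst_apply, resLast_apply, of_apply]; rfl

lemma exists_rPlusBar_rowMat_momentCovec (c : Coeffs m) (k : ℕ) :
    ∃ s : ℂ, rPlusBar (rowMat c (momentCovec c k)) = tailMat c k + s • (1 : Mat (m + 1)) := by
  have h0 : ∀ i, tailMat c k i 0 = 0 := fun i => hankelTail_zero c _
  obtain ⟨s, hs⟩ := (shiftPair_gammaStar (m + 1)).exists_rOp_sub_left
    (fun i => ((i : ℕ) : ℂ) + 1) (B := tailMat c k)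
    (by rw [Matrix.trace_sub, trace_gammaStar, h0]; ring)
    (by
      rw [gamma_gammaStar, embLast_resLast]
      · intro j
        simp only [← diagPart_eq, ← lowerPart_eq, diagPart, lowerPart, Matrix.add_apply, of_apply]
        rw [if_neg (Fin.not_lt_zero j), add_zero]
        split_ifs with h
        · rw [← h, h0]
        · rfl
      · intro i
        simp only [← diagPart_eq, ← lowerPart_eq, diagPart, lowerPart, Matrix.add_apply, of_apply,
          h0, ite_self, add_zero])
  have h1 := rPlusBar_vecMulVec_single_last
    (r := fun j : Fin (m + 1) => hankelTail c (j + 1) (k + m + 1))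
    (hankelTail_of_lt c (Nat.lt_succ_self m) _)
  refine ⟨s, ?_⟩
  rw [rPlusBar_eq] at h1
  rw [rowMat_momentCovec_eq, rPlusBar_eq, map_sub, hs, h1, sub_zero]

/-- The pairing of the left gradients of two moments. -/
def momentPairing (c : Coeffs m) (k l : ℕ) : ℂ :=
  ∑ j : Fin (m + 1), ∑ i : Fin (m + 1), hankelTail c j (k + i) * hankel c i (l + j)

lemma form_rPlusBar_momentCovec (c : Coeffs m) (k l : ℕ) :
    form (rPlusBar (rowMat c (momentCovec c k))) (rowMat c (momentCovec c l))
      = momentPairing c k l := by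
  obtain ⟨s, hs⟩ := exists_rPlusBar_rowMat_momentCovec c k
  rw [hs, form_add_left, form_smul_left, form_one_left, trace_rowMat, mul_zero, add_zero,
    form_eq_sum, Finset.sum_comm, momentPairing]
  simp only [rowMat_momentCovec]
  rfl

lemma sum_hankel_mul_hankel (c : Coeffs m) (j : Fin (m + 1)) (k b : ℕ) :
    ∑ i : Fin (m + 1), hankel c j (k + i) * hankel c i b
      = numerVec c j * invCoeff c b * moment k c
        - numerVec c j * quotCoeff c b * (if k = 0 then 1 else 0)
        - denomVec c j * invCoeff c b * sqCoeff c k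
        + denomVec c j * quotCoeff c b * moment k c := by
  conv_rhs => rw [← sum_denomVec_invCoeff c k, ← sum_numerVec_quotCoeff c k]
  conv_rhs => enter [1, 1, 1]; rw [← sum_numerVec_invCoeff c k]
  conv_rhs => enter [2]; rw [← sum_denomVec_quotCoeff c k]
  simp only [Finset.mul_sum, ← Finset.sum_sub_distrib, ← Finset.sum_add_distrib]
  refine Finset.sum_congr rfl fun i _ => ?_
  rw [hankel, hankel]
  ring

lemma momentPairing_succ (c : Coeffs m) (k l : ℕ) :
    momentPairing c k (l + 1) = momentPairing c (k + 1) l + 2 * moment k c * moment (l + 1) c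
      - (if k = 0 then 1 else 0) * sqCoeff c (l + 1) := by
  have h1 : momentPairing c (k + 1) l = ∑ j : Fin (m + 1), ∑ i : Fin (m + 1),
      hankelTail c (j + 1) (k + i + 1) * hankel c i (l + 1 + j) := by
    rw [momentPairing, Fin.sum_univ_succ]
    conv_rhs => rw [Fin.sum_univ_castSucc]
    simp only [Fin.val_zero, hankelTail_zero, zero_mul, Finset.sum_const_zero, zero_add,
      Fin.val_last, hankelTail_of_lt c (Nat.lt_succ_self m), add_zero, Fin.val_succ,
      Fin.val_castSucc]
    refine Finset.sum_congr rfl fun j _ => Finset.sum_congr rfl fun i _ => ?_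
    rw [add_right_comm k, add_right_comm l, add_assoc l]
  have h2 : momentPairing c k (l + 1) - momentPairing c (k + 1) l
      = ∑ j : Fin (m + 1), ∑ i : Fin (m + 1),
        hankel c j (k + i) * hankel c i (l + 1 + j) := by
    rw [h1, momentPairing, ← Finset.sum_sub_distrib]
    refine Finset.sum_congr rfl fun j _ => ?_
    rw [← Finset.sum_sub_distrib]
    refine Finset.sum_congr rfl fun i _ => ?_
    rw [← hankelTail_sub_succ c j]
    ring
  have a1 := sum_numerVec_invCoeff c (l + 1)
  have a2 := sum_numerVec_quotCoeff c (l + 1)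
  have a3 := sum_denomVec_invCoeff c (l + 1)
  have a4 := sum_denomVec_quotCoeff c (l + 1)
  simp only [sum_hankel_mul_hankel, Finset.sum_add_distrib, Finset.sum_sub_distrib,
    ← Finset.sum_mul, a1, a2, a3, a4] at h2
  rw [if_neg (Nat.succ_ne_zero l)] at h2
  linear_combination h2

lemma momentPairing_zero (c : Coeffs m) (k : ℕ) :
    momentPairing c k 0 = 2 * moment 0 c * moment k c
      - moment 0 c ^ 2 * (if k = 0 then 1 else 0) - sqCoeff c k := by
  rw [momentPairing, Fin.sum_univ_castSucc, Finset.sum_eq_zero, zero_add]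
  · have h : ∀ i : Fin (m + 1), hankelTail c (Fin.last m : Fin (m + 1)) (k + i)
        = hankel c (Fin.last m) (k + i) := by
      intro i
      rw [← hankelTail_sub_succ, Fin.val_last, hankelTail_of_lt c (Nat.lt_succ_self m), sub_zero]
    simp only [h]
    rw [sum_hankel_mul_hankel, numerVec_last, denomVec_last, zero_add, Fin.val_last, invCoeff_self,
      quotCoeff_self]
    ring
  · intro j _
    refine Finset.sum_eq_zero fun i _ => ?_
    rw [hankel, zero_add, invCoeff_of_lt c (by simp), quotCoeff_of_lt c (by simp)]
    ring

/-- Partial sums common to all brackets `{h_i, h_j}` with `i + j = s`. -/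
lemma momentBracket_eq (c : Coeffs m) (i j : ℕ) :
    momentBracket c i j
      = ∑ k ∈ Finset.range j, moment (k + 1) c * moment (i + j - k - 1) c
        - ∑ k ∈ Finset.range i, moment (k + 1) c * moment (i + j - k - 1) c := by
  rw [momentBracket]
  split_ifs with h
  · rw [Finset.sum_Ico_eq_sub _ h.le]
  · rw [Finset.sum_Ico_eq_sub _ (not_lt.1 h), neg_sub]

lemma momentBracket_succ (c : Coeffs m) (k l : ℕ) :
    momentBracket c k (l + 1) = momentBracket c (k + 1) l + moment k c * moment (l + 1) c
      + moment (k + 1) c * moment l c := by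
  rw [momentBracket_eq, momentBracket_eq, Finset.sum_range_succ, Finset.sum_range_succ,
    show k + 1 + l = k + (l + 1) by omega, show k + (l + 1) - l - 1 = k by omega,
    show k + (l + 1) - k - 1 = l by omega]
  ring

lemma ratBivector_momentCovec (c : Coeffs m) (k l : ℕ) :
    ratBivector c (momentCovec c k) (momentCovec c l) = momentBracket c k l := by
  have h1 : ratBivector c (momentCovec c k) (momentCovec c l)
      = momentPairing c k l + (if k = 0 then 1 else 0) * sqCoeff c l
        - moment k c * moment l c := by
    have a1 := sum_numerVec_invCoeff c k
    have a2 := sum_numerVec_invCoeff c l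
    have a3 := sum_numerVec_quotCoeff c l
    have a4 := sum_denomVec_invCoeff c k
    rw [ratBivector, form_rPlusBar_momentCovec]
    simp only [dotProduct, numerVec_momentCovec, denomCovec_momentCovec, mul_neg,
      Finset.sum_neg_distrib, a1, a2, a3, a4]
    ring
  rw [h1]
  clear h1
  induction l generalizing k with
  | zero =>
    rw [momentPairing_zero, momentBracket_eq, Finset.sum_range_zero, sqCoeff_eq, sqCoeff_eq,
      Finset.sum_range_zero]
    simp only [add_zero]
    ring
  | succ l ih =>
    rw [momentPairing_succ, momentBracket_succ, ← ih, if_neg (Nat.succ_ne_zero k)]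
    ring

/-! ### The moments as local coordinates -/

/-- The variation of the denominator, a polynomial of degree less than `m`. -/
def denomTangent (v : Coeffs m) : Fin (m + 1) → ℂ := Fin.snoc (fun i => v (Sum.inl i)) 0

lemma denomVec_add_smul (c v : Coeffs m) (t : ℂ) :
    denomVec (c + t • v) = denomVec c + t • denomTangent v := by
  ext i
  induction i using Fin.lastCases with
  | last => simp [denomVec, denomTangent, Fin.snoc_last]
  | cast i => simp [denomVec, denomTangent, Fin.snoc_castSucc]

lemma differentiableAt_coeff_denom (c : Coeffs m) (k : ℕ) :
    DifferentiableAt ℂ (fun c => PowerSeries.coeff k (revSeries (denomVec c))) c := by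
  simp only [revSeries_eq_sum, map_sum, PowerSeries.coeff_C_mul]
  refine DifferentiableAt.fun_sum fun i _ => DifferentiableAt.mul_const ?_ _
  induction i using Fin.lastCases with
  | last => simp only [denomVec, Fin.snoc_last]; exact differentiableAt_const _
  | cast i => simp only [denomVec, Fin.snoc_castSucc]; fun_prop

lemma differentiableAt_coeff_numer (c : Coeffs m) (k : ℕ) :
    DifferentiableAt ℂ (fun c => PowerSeries.coeff k (revSeries (numerVec c))) c := by
  simp only [revSeries_eq_sum, map_sum, PowerSeries.coeff_C_mul, numerVec]
  fun_prop

lemma fderiv_coeff_denom (c v : Coeffs m) (k : ℕ) :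
    fderiv ℂ (fun c => PowerSeries.coeff k (revSeries (denomVec c))) c v
      = PowerSeries.coeff k (revSeries (denomTangent v)) := by
  refine ((differentiableAt_coeff_denom c k).hasFDerivAt.hasLineDerivAt v).unique ?_
  simp only [HasLineDerivAt, denomVec_add_smul, revSeries_add, revSeries_smul, map_add,
    PowerSeries.coeff_smul]
  simpa using ((hasDerivAt_id (0 : ℂ)).smul_const
    (PowerSeries.coeff k (revSeries (denomTangent v)))).const_add
    (PowerSeries.coeff k (revSeries (denomVec c)))

lemma fderiv_coeff_numer (c v : Coeffs m) (k : ℕ) :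
    fderiv ℂ (fun c => PowerSeries.coeff k (revSeries (numerVec c))) c v
      = PowerSeries.coeff k (revSeries (numerVec v)) := by
  refine ((differentiableAt_coeff_numer c k).hasFDerivAt.hasLineDerivAt v).unique ?_
  simp only [HasLineDerivAt, numerVec_add, numerVec_smul, revSeries_add, revSeries_smul, map_add,
    PowerSeries.coeff_smul]
  simpa using ((hasDerivAt_id (0 : ℂ)).smul_const
    (PowerSeries.coeff k (revSeries (numerVec v)))).const_add
    (PowerSeries.coeff k (revSeries (numerVec c)))

/-- The defining relation `p M = q`, coefficient by coefficient. -/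
lemma sum_antidiagonal_moment (c : Coeffs m) (k : ℕ) :
    ∑ ij ∈ Finset.HasAntidiagonal.antidiagonal k,
      PowerSeries.coeff ij.1 (revSeries (denomVec c)) * moment ij.2 c
      = PowerSeries.coeff k (revSeries (numerVec c)) := by
  rw [← revSeries_denomVec_mul_ratSeries, PowerSeries.coeff_mul]
  simp only [moment_eq]

lemma coeff_zero_denom (c : Coeffs m) :
    PowerSeries.coeff 0 (revSeries (denomVec c)) = 1 := by
  rw [PowerSeries.coeff_zero_eq_constantCoeff_apply, constantCoeff_revSeries_denomVec]

lemma differentiableAt_moment (c : Coeffs m) (k : ℕ) : DifferentiableAt ℂ (moment k) c := by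
  induction k using Nat.strong_induction_on with
  | _ k ih =>
    cases k with
    | zero =>
      have h : moment (m := m) 0 = fun c => PowerSeries.coeff 0 (revSeries (numerVec c)) := by
        ext c
        rw [← sum_antidiagonal_moment]
        simp [coeff_zero_denom]
      rw [h]
      exact differentiableAt_coeff_numer c 0
    | succ k =>
      have h : moment (m := m) (k + 1) = fun c =>
          PowerSeries.coeff (k + 1) (revSeries (numerVec c))
            - ∑ ij ∈ Finset.HasAntidiagonal.antidiagonal k,
              PowerSeries.coeff (ij.1 + 1) (revSeries (denomVec c)) * moment ij.2 c := by
        ext c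
        rw [← sum_antidiagonal_moment, Finset.Nat.sum_antidiagonal_succ, coeff_zero_denom]
        ring
      rw [h]
      refine (differentiableAt_coeff_numer c _).sub (DifferentiableAt.fun_sum fun ij hij =>
        (differentiableAt_coeff_denom c _).mul (ih _ ?_))
      have := Finset.HasAntidiagonal.mem_antidiagonal.1 hij
      omega

/-- The variation `δM = (δq - M δp) / p`. -/
lemma coeff_variation (c v : Coeffs m) (k : ℕ) :
    fderiv ℂ (moment k) c v = PowerSeries.coeff k
      ((revSeries (numerVec v) - revSeries (denomTangent v) * ratSeries c)
        * (revSeries (denomVec c))⁻¹) := by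
  have key : revSeries (denomVec c) * PowerSeries.mk (fun k => fderiv ℂ (moment k) c v)
      + revSeries (denomTangent v) * ratSeries c = revSeries (numerVec v) := by
    ext k
    have hfun : (fun c : Coeffs m => ∑ ij ∈ Finset.HasAntidiagonal.antidiagonal k,
        PowerSeries.coeff ij.1 (revSeries (denomVec c)) * moment ij.2 c)
        = fun c => PowerSeries.coeff k (revSeries (numerVec c)) :=
      funext fun c => sum_antidiagonal_moment c k
    have h := fderiv_coeff_numer c v k
    rw [← hfun, fderiv_fun_sum fun ij _ =>
      (differentiableAt_coeff_denom c ij.1).fun_mul (differentiableAt_moment c ij.2),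
      _root_.sum_apply] at h
    rw [← h, map_add, PowerSeries.coeff_mul, PowerSeries.coeff_mul, ← Finset.sum_add_distrib]
    refine Finset.sum_congr rfl fun ij _ => ?_
    rw [fderiv_fun_mul (differentiableAt_coeff_denom c ij.1) (differentiableAt_moment c ij.2)]
    simp only [_root_.add_apply, _root_.smul_apply, smul_eq_mul, fderiv_coeff_denom,
      PowerSeries.coeff_mk, ← moment_eq]
    ring
  rw [← key, add_sub_cancel_right, mul_right_comm, revSeries_denomVec_mul_inv, one_mul,
    PowerSeries.coeff_mk]

lemma fderiv_moment (c v : Coeffs m) (k : ℕ) :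
    fderiv ℂ (moment k) c v = momentCovec c k ⬝ᵥ v := by
  rw [coeff_variation, sub_mul, mul_assoc, map_sub, coeff_revSeries_mul, coeff_revSeries_mul,
    dotProduct, Fintype.sum_sum_type]
  conv_lhs => enter [2]; rw [Fin.sum_univ_castSucc]
  simp only [momentCovec, Sum.elim_inl, Sum.elim_inr, denomTangent, Fin.snoc_castSucc,
    Fin.snoc_last, zero_mul, add_zero, numerVec, neg_mul, Finset.sum_neg_distrib, invCoeff,
    quotCoeff, Fin.val_castSucc]
  rw [sub_eq_neg_add]
  simp only [mul_comm (v _)]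

lemma momentJacobian_apply (c : Coeffs m) (a b : Fin m ⊕ Fin (m + 1)) :
    momentJacobian c a b = momentCovec c (momentIndex a) b := by
  rw [momentJacobian, of_apply, partialDeriv, fderiv_moment, dotProduct_single, mul_one]

/-- If the first `2m + 1` coefficients of `δM = (p δq - q δp) / p²` vanish, then
`p δq = q δp`, hence `p` divides `δp`. -/
lemma det_momentJacobian_ne_zero {c : Coeffs m} (hc : c ∈ RatSet m) :
    (momentJacobian c).det ≠ 0 := by
  intro hdet
  obtain ⟨v, hv, hJ⟩ := Matrix.exists_mulVec_eq_zero_iff.2 hdet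
  apply hv
  set Z := (revSeries (numerVec v) - revSeries (denomTangent v) * ratSeries c)
        * (revSeries (denomVec c))⁻¹ with hZ
  have hZk : ∀ k < 2 * m + 1, PowerSeries.coeff k Z = 0 := by
    intro k hk
    have h := congrFun hJ (finSumFinEquiv.symm ⟨k, by omega⟩)
    rw [Matrix.mulVec, dotProduct] at h
    simp only [momentJacobian_apply, momentIndex, Equiv.apply_symm_apply] at h
    rw [hZ, ← coeff_variation, fderiv_moment]
    exact h
  have hmul : revSeries (denomVec c) * revSeries (denomVec c) * Z
      = revSeries (denomVec c) * revSeries (numerVec v)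
        - revSeries (denomTangent v) * revSeries (numerVec c) := by
    rw [hZ, ← revSeries_denomVec_mul_ratSeries c]
    linear_combination (revSeries (denomVec c) * (revSeries (numerVec v)
      - revSeries (denomTangent v) * ratSeries c)) * revSeries_denomVec_mul_inv c
  set W := vecPoly (denomVec c) * vecPoly (numerVec v)
    - vecPoly (denomTangent v) * vecPoly (numerVec c) with hW
  have hWr : ((Polynomial.reflect (m + m) W : Polynomial ℂ) : PowerSeries ℂ)
      = revSeries (denomVec c) * revSeries (denomVec c) * Z := by
    rw [hmul, hW, Polynomial.reflect_sub, Polynomial.reflect_mul _ _ (natDegree_vecPoly_le _)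
      (natDegree_vecPoly_le _), Polynomial.reflect_mul _ _ (natDegree_vecPoly_le _)
      (natDegree_vecPoly_le _), Polynomial.coe_sub, Polynomial.coe_mul, Polynomial.coe_mul]
    rfl
  have hdvd : PowerSeries.X ^ (2 * m + 1)
      ∣ ((Polynomial.reflect (m + m) W : Polynomial ℂ) : PowerSeries ℂ) := by
    rw [hWr]
    exact (PowerSeries.X_pow_dvd_iff.2 hZk).mul_left _
  have hdeg : W.natDegree ≤ m + m :=
    (Polynomial.natDegree_sub_le_of_le
      (Polynomial.natDegree_mul_le_of_le (natDegree_vecPoly_le _) (natDegree_vecPoly_le _))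
      (Polynomial.natDegree_mul_le_of_le (natDegree_vecPoly_le _) (natDegree_vecPoly_le _))).trans
      (by simp)
  have hW0 : W = 0 := by
    ext k
    rw [Polynomial.coeff_zero]
    by_cases hk : k ≤ m + m
    · have h := PowerSeries.X_pow_dvd_iff.1 hdvd (m + m - k) (by omega)
      rwa [Polynomial.coeff_coe, Polynomial.coeff_reflect, Polynomial.revAt_le (by omega),
        Nat.sub_sub_self hk] at h
    · exact Polynomial.coeff_eq_zero_of_natDegree_lt (by omega)
  have heq : denom c * vecPoly (numerVec v) = vecPoly (denomTangent v) * numer c := by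
    rw [denom_eq_vecPoly, numer_eq_vecPoly]
    exact sub_eq_zero.1 hW0
  have hlast : (vecPoly (denomVec c)).coeff m = 1 := by
    have := coeff_vecPoly (denomVec c) (Fin.last m)
    rwa [denomVec_last, Fin.val_last] at this
  have hdeg_p : (denom c).degree = m := by
    rw [denom_eq_vecPoly]
    refine le_antisymm (Polynomial.natDegree_le_iff_degree_le.1 (natDegree_vecPoly_le _)) ?_
    exact Polynomial.le_degree_of_ne_zero (by rw [hlast]; exact one_ne_zero)
  have hdp : vecPoly (denomTangent v) = 0 := by
    refine Polynomial.eq_zero_of_dvd_of_degree_lt (p := denom c) ?_ ?_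
    · exact IsCoprime.dvd_of_dvd_mul_right (IsCoprime.symm hc) ⟨_, heq.symm⟩
    · rw [hdeg_p]
      refine (Polynomial.degree_lt_iff_coeff_zero _ _).2 fun k hk => ?_
      rcases hk.eq_or_lt with h | h
      · have := coeff_vecPoly (denomTangent v) (Fin.last m)
        rw [← h]
        simpa [denomTangent, Fin.snoc_last] using this
      · exact Polynomial.coeff_eq_zero_of_natDegree_lt ((natDegree_vecPoly_le _).trans_lt h)
  have hdq : vecPoly (numerVec v) = 0 := by
    rw [hdp, zero_mul] at heq
    refine (mul_eq_zero.1 heq).resolve_left fun h => ?_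
    rw [h, Polynomial.degree_zero] at hdeg_p
    exact absurd hdeg_p (by simp)
  ext b
  rcases b with i | i
  · have h := coeff_vecPoly (denomTangent v) i.castSucc
    rw [hdp, Polynomial.coeff_zero] at h
    simpa [denomTangent, Fin.snoc_castSucc] using h.symm
  · have h := coeff_vecPoly (numerVec v) i
    rw [hdq, Polynomial.coeff_zero] at h
    exact h.symm

/-! ### The bivector on the space of rational functions -/

lemma rowMat_add (c u v : Coeffs m) : rowMat c (u + v) = rowMat c u + rowMat c v := by
  rw [rowMat, rowMat, rowMat, denomCovec_add, numerVec_add, Matrix.add_vecMulVec,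
    Matrix.add_vecMulVec]
  abel

lemma rowMat_smul (c : Coeffs m) (s : ℂ) (u : Coeffs m) :
    rowMat c (s • u) = s • rowMat c u := by
  rw [rowMat, rowMat, denomCovec_smul, numerVec_smul, Matrix.smul_vecMulVec,
    Matrix.smul_vecMulVec, smul_add]

/-- `ratBivector` as a bilinear form. -/
def ratBilin (c : Coeffs m) : Coeffs m →ₗ[ℂ] Coeffs m →ₗ[ℂ] ℂ :=
  LinearMap.mk₂ ℂ (ratBivector c)
    (fun u u' v => by
      simp only [ratBivector, rowMat_add, rPlusBar_eq, map_add, form_add_left, numerVec_add,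
        dotProduct_add]
      ring)
    (fun s u v => by
      simp only [ratBivector, rowMat_smul, rPlusBar_eq, map_smul, form_smul_left, numerVec_smul,
        dotProduct_smul, smul_eq_mul]
      ring)
    (fun u v v' => by
      simp only [ratBivector, rowMat_add, form_add_right, numerVec_add, denomCovec_add,
        dotProduct_add]
      ring)
    (fun s u v => by
      simp only [ratBivector, rowMat_smul, form_smul_right, numerVec_smul, denomCovec_smul,
        dotProduct_smul, smul_eq_mul]
      ring)

lemma ratBilin_apply (c u v : Coeffs m) : ratBilin c u v = ratBivector c u v := rfl

lemma linearMap_eq_sum {ι : Type*} [Fintype ι] [DecidableEq ι] (L : (ι → ℂ) →ₗ[ℂ] ℂ) (u : ι → ℂ) :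
    L u = ∑ a, u a * L (Pi.single a 1) := by
  conv_lhs => rw [← Finset.univ_sum_single u, map_sum]
  refine Finset.sum_congr rfl fun a _ => ?_
  rw [← smul_eq_mul, ← map_smul, ← Pi.single_smul, smul_eq_mul, mul_one]

/-- The matrix of `ratBivector`. -/
def ratMatrix (c : Coeffs m) :
    Matrix (Fin m ⊕ Fin (m + 1)) (Fin m ⊕ Fin (m + 1)) ℂ :=
  Matrix.of fun a b => ratBivector c (Pi.single a 1) (Pi.single b 1)

lemma ratBivector_eq (c u v : Coeffs m) :
    ratBivector c u v = u ⬝ᵥ (ratMatrix c *ᵥ v) := by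
  have h1 := linearMap_eq_sum ((ratBilin c).flip v) u
  simp only [LinearMap.flip_apply, ratBilin_apply] at h1
  rw [h1, dotProduct]
  refine Finset.sum_congr rfl fun a _ => ?_
  have h2 := linearMap_eq_sum (ratBilin c (Pi.single a 1)) v
  simp only [ratBilin_apply] at h2
  rw [h2, Matrix.mulVec, dotProduct]
  simp only [ratMatrix, of_apply, mul_comm]

/-- On `RatSet m` the matrix of `ratBivector` is determined by its values on the differentials of
the moments. -/
lemma coeffMatrix_eq {c : Coeffs m} (hc : c ∈ RatSet m) : coeffMatrix c = ratMatrix c := by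
  have hJ : IsUnit (momentJacobian c).det := isUnit_iff_ne_zero.2 (det_momentJacobian_ne_zero hc)
  have h : momentMatrix c = momentJacobian c * ratMatrix c * (momentJacobian c)ᵀ := by
    ext a b
    have hrow : ∀ a, momentJacobian c a = momentCovec c (momentIndex a) :=
      fun a => funext fun b => momentJacobian_apply c a b
    rw [momentMatrix, of_apply, ← ratBivector_momentCovec, ratBivector_eq, Matrix.mul_assoc,
      Matrix.mul_apply, dotProduct]
    refine Finset.sum_congr rfl fun d _ => ?_
    rw [hrow, Matrix.mul_apply, Matrix.mulVec, dotProduct]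
    simp only [Matrix.transpose_apply, hrow]
  rw [coeffMatrix, h, Matrix.mul_assoc (momentJacobian c),
    Matrix.nonsing_inv_mul_cancel_left _ _ hJ, Matrix.mul_assoc, ← Matrix.transpose_mul,
    Matrix.nonsing_inv_mul _ hJ, Matrix.transpose_one, Matrix.mul_one]

lemma ratBracket_eq {c : Coeffs m} (hc : c ∈ RatSet m) (f g : Coeffs m → ℂ) :
    ratBracket f g c = ratBivector c (partialDeriv f c) (partialDeriv g c) := by
  rw [ratBracket, coeffMatrix_eq hc, ratBivector_eq]

lemma ratBivector_swap (c u v : Coeffs m) : ratBivector c v u = -ratBivector c u v := by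
  have h := (shiftPair_gammaStar (m + 1)).form_rOp (fun i => ((i : ℕ) : ℂ) + 1)
    (trace_rowMat c u) (trace_rowMat c v)
  rw [← rPlusBar_eq, ← rPlusBar_eq, form_comm (rowMat c u)] at h
  have h1 : form (rowMat c u) (rowMat c v)
      = (denomVec c ⬝ᵥ denomCovec c u) * (denomVec c ⬝ᵥ denomCovec c v)
        + (numerVec c ⬝ᵥ denomCovec c u) * (denomVec c ⬝ᵥ numerVec v)
        + (numerVec c ⬝ᵥ denomCovec c v) * (denomVec c ⬝ᵥ numerVec u)
        + (numerVec c ⬝ᵥ numerVec u) * (numerVec c ⬝ᵥ numerVec v) := by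
    conv_lhs => enter [2]; rw [rowMat]
    rw [form_add_right, form_vecMulVec_right, form_vecMulVec_right]
    simp only [rowMat, Matrix.add_mulVec, Matrix.vecMulVec_mulVec, dotProduct_add,
      dotProduct_smul, op_smul_eq_mul]
    ring
  rw [h1, denomVec_dotProduct_denomCovec,
    denomVec_dotProduct_denomCovec] at h
  rw [ratBivector, ratBivector]
  linear_combination h

/-- The constant coefficient of the numerator is a Casimir function. -/
lemma ratBivector_single_left (c v : Coeffs m) :
    ratBivector c (Pi.single (Sum.inr 0) 1) v = 0 := by
  have hn : numerVec (Pi.single (Sum.inr 0) 1 : Coeffs m) = Pi.single 0 1 := by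
    ext i
    simp [numerVec, Pi.single_apply]
  have hd : denomCovec c (Pi.single (Sum.inr 0) 1)
      = -(numerVec c 0) • Pi.single (Fin.last m) 1 := by
    ext i
    induction i using Fin.lastCases with
    | last => simp [denomCovec, Fin.snoc_last, hn]
    | cast i => simp [denomCovec, Fin.snoc_castSucc, (Fin.castSucc_lt_last i).ne]
  have hrow : rowMat c (Pi.single (Sum.inr 0) 1) = vecMulVec (Pi.single 0 1) (numerVec c)
      + vecMulVec (Pi.single (Fin.last m) 1) (-(numerVec c 0) • denomVec c) := by
    rw [rowMat, hn, hd, Matrix.smul_vecMulVec, Matrix.vecMulVec_smul]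
    exact add_comm _ _
  obtain ⟨s, hs⟩ := exists_rPlusBar_rows (r := numerVec c) (r' := -(numerVec c 0) • denomVec c)
    (by rw [Pi.smul_apply, denomVec_last]; simp)
  rw [ratBivector, hrow, hs, form_add_left, form_smul_left, form_one_left, trace_rowMat, hn,
    form_comm, form_vecMulVec_right, rowMat, Matrix.add_mulVec, Matrix.vecMulVec_mulVec,
    Matrix.vecMulVec_mulVec, dotProduct_add]
  simp only [dotProduct_smul, op_smul_eq_mul, dotProduct_single_one]
  ring

/-! ### Pullbacks of differentials -/

section Calculus

attribute [local instance] Matrix.normedAddCommGroup Matrix.normedSpace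

lemma fderiv_eq_dotProduct (f : Coeffs m → ℂ) (c v : Coeffs m) :
    fderiv ℂ f c v = partialDeriv f c ⬝ᵥ v := by
  rw [dotProduct]
  refine (linearMap_eq_sum (fderiv ℂ f c : Coeffs m →ₗ[ℂ] ℂ) v).trans ?_
  exact Finset.sum_congr rfl fun a _ => mul_comm _ _

lemma differentiableAt_psiTwo {X : Mat (m + 1)} (h : X 0 (Fin.last m) ≠ 0) :
    DifferentiableAt ℂ psiTwo X := by
  refine differentiableAt_pi.2 fun a => ?_
  rcases a with i | i
  · simp only [psiTwo, Sum.elim_inl]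
    fun_prop (disch := assumption)
  · simp only [psiTwo, Sum.elim_inr]
    fun_prop (disch := assumption)

lemma fderiv_entry_div {n : ℕ} {X : Mat n} (i j k l : Fin n) (h : X k l ≠ 0) (H : Mat n) :
    fderiv ℂ (fun Y : Mat n => Y i j / Y k l) X H
      = (X k l)⁻¹ * (H i j - X i j / X k l * H k l) := by
  refine fderiv_eq_of_line (by fun_prop (disch := assumption)) ?_
  have h0 : (X + (0 : ℂ) • H) k l ≠ 0 := by simpa using h
  refine ((hasDerivAt_line X H i j).fun_div (hasDerivAt_line X H k l) h0).congr_deriv ?_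
  simp only [zero_smul, add_zero]
  field_simp

lemma fderiv_psiTwo_apply {X : Mat (m + 1)} (h : X 0 (Fin.last m) ≠ 0) (H : Mat (m + 1))
    (a : Fin m ⊕ Fin (m + 1)) :
    fderiv ℂ psiTwo X H a = (X 0 (Fin.last m))⁻¹ *
      (Sum.elim (fun i : Fin m => H 0 i.castSucc) (fun i => H (Fin.last m) i) a
        - psiTwo X a * H 0 (Fin.last m)) := by
  have h1 := hasFDerivAt_pi'.1 (differentiableAt_psiTwo h).hasFDerivAt a
  have h2 : fderiv ℂ psiTwo X H a = fderiv ℂ (fun Y => psiTwo Y a) X H :=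
    (DFunLike.congr_fun h1.fderiv H).symm
  rw [h2]
  rcases a with i | i
  · exact fderiv_entry_div _ _ _ _ h H
  · exact fderiv_entry_div _ _ _ _ h H

lemma dotProduct_fderiv_psiTwo {X : Mat (m + 1)} (h : X 0 (Fin.last m) ≠ 0) (u : Coeffs m)
    (H : Mat (m + 1)) : u ⬝ᵥ fderiv ℂ psiTwo X H = form (pullTwo X u) H := by
  rw [form_comm, pullTwo, form_smul_right, form_add_right, form_vecMulVec_right,
    form_vecMulVec_right, single_one_dotProduct, single_one_dotProduct, Matrix.mulVec,
    Matrix.mulVec, dotProduct, dotProduct, dotProduct, Fintype.sum_sum_type]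
  conv_rhs => enter [2, 1]; rw [Fin.sum_univ_castSucc]
  simp only [fderiv_psiTwo_apply h, Sum.elim_inl, Sum.elim_inr, denomCovec, Fin.snoc_castSucc,
    Fin.snoc_last, dotProduct]
  have e1 : ∀ (k : ℕ) (s : Fin k → Fin m ⊕ Fin (m + 1)) (w : Fin k → ℂ),
      ∑ i, u (s i) * ((X 0 (Fin.last m))⁻¹ * (w i - psiTwo X (s i) * H 0 (Fin.last m)))
        = (X 0 (Fin.last m))⁻¹ * (∑ i, w i * u (s i)
          - H 0 (Fin.last m) * ∑ i, psiTwo X (s i) * u (s i)) := by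
    intro k s w
    rw [mul_sub, Finset.mul_sum, Finset.mul_sum, Finset.mul_sum, ← Finset.sum_sub_distrib]
    exact Finset.sum_congr rfl fun i _ => by ring
  rw [e1 m Sum.inl, e1 (m + 1) Sum.inr]
  simp only [numerVec]
  ring

lemma grad_comp_psiOne {X : Mat (m + 1)} (hX : X ∈ domOne m) {f : Mat m → ℂ}
    (hf : DifferentiableAt ℂ f (psiOne X)) :
    grad (f ∘ psiOne) X = pullOne X (grad f (psiOne X)) := by
  refine grad_eq_of_forall fun H => ?_
  have h := DFunLike.congr_fun (fderiv_comp X hf (differentiableAt_psiOne hX)) H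
  refine h.trans ?_
  rw [← form_pullOne hX, ← fderiv_eq_form]
  rfl

lemma grad_comp_psiTwo {X : Mat (m + 1)} (h : X 0 (Fin.last m) ≠ 0) {f : Coeffs m → ℂ}
    (hf : DifferentiableAt ℂ f (psiTwo X)) :
    grad (f ∘ psiTwo) X = pullTwo X (partialDeriv f (psiTwo X)) := by
  refine grad_eq_of_forall fun H => ?_
  have h' := DFunLike.congr_fun (fderiv_comp X hf (differentiableAt_psiTwo h)) H
  refine h'.trans ?_
  rw [← dotProduct_fderiv_psiTwo h, ← fderiv_eq_dotProduct]
  rfl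

lemma differentiableAt_psi {X : Mat (m + 1)} (hX : X ∈ domOne m) :
    DifferentiableAt ℂ psi X :=
  (differentiableAt_psiOne hX).prodMk (differentiableAt_psiTwo hX.2.1)

lemma fderiv_prod_apply {f : Mat m × Coeffs m → ℂ} {z : Mat m × Coeffs m}
    (hf : DifferentiableAt ℂ f z) (H : Mat m) (v : Coeffs m) :
    fderiv ℂ f z (H, v)
      = fderiv ℂ (fun U => f (U, z.2)) z.1 H + fderiv ℂ (fun c => f (z.1, c)) z.2 v := by
  have h1 : HasFDerivAt (fun U => f (U, z.2))
      ((fderiv ℂ f z).comp (ContinuousLinearMap.inl ℂ (Mat m) (Coeffs m))) z.1 :=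
    HasFDerivAt.comp z.1 (g := f) hf.hasFDerivAt (hasFDerivAt_prodMk_left z.1 z.2)
  have h2 : HasFDerivAt (fun c => f (z.1, c))
      ((fderiv ℂ f z).comp (ContinuousLinearMap.inr ℂ (Mat m) (Coeffs m))) z.2 :=
    HasFDerivAt.comp z.2 (g := f) hf.hasFDerivAt (hasFDerivAt_prodMk_right z.1 z.2)
  have e : ((H, v) : Mat m × Coeffs m) = (H, 0) + (0, v) := by simp
  refine (congrArg (fderiv ℂ f z) e).trans ((map_add (fderiv ℂ f z) _ _).trans ?_)
  congr 1
  · exact (DFunLike.congr_fun h1.fderiv H).symm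
  · exact (DFunLike.congr_fun h2.fderiv v).symm

lemma grad_comp_psi {X : Mat (m + 1)} (hX : X ∈ domOne m) {f : Mat m × Coeffs m → ℂ}
    (hf : DifferentiableAt ℂ f (psi X)) :
    grad (f ∘ psi) X = pullOne X (grad (fun U => f (U, psiTwo X)) (psiOne X))
      + pullTwo X (partialDeriv (fun c => f (psiOne X, c)) (psiTwo X)) := by
  refine grad_eq_of_forall fun H => ?_
  have h := DFunLike.congr_fun (fderiv_comp X hf (differentiableAt_psi hX)) H
  have h' : fderiv ℂ psi X H = (fderiv ℂ psiOne X H, fderiv ℂ psiTwo X H) :=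
    DFunLike.congr_fun ((differentiableAt_psiOne hX).fderiv_prodMk
      (differentiableAt_psiTwo hX.2.1)) H
  refine h.trans ((congrArg (fderiv ℂ f (psi X)) h').trans ((fderiv_prod_apply hf _ _).trans ?_))
  rw [form_add_left, ← form_pullOne hX, ← dotProduct_fderiv_psiTwo hX.2.1, ← fderiv_eq_form,
    ← fderiv_eq_dotProduct]
  rfl

/-- Jacobi's formula: the gradient of the determinant is the adjugate matrix. -/
lemma grad_det_sub_const (U : Mat m) (s : ℂ) : grad (fun V => V.det - s) U = U.adjugate := by
  ext i j
  have hd : DifferentiableAt ℂ (fun V : Mat m => V.det - s) U :=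
    (differentiableAt_det (φ := fun V : Mat m => V) fun _ _ => by fun_prop).sub_const s
  rw [grad, of_apply, Matrix.adjugate_apply]
  refine fderiv_eq_of_line hd ?_
  have h : ∀ t : ℂ, (U + t • Matrix.single j i (1 : ℂ)).det
      = U.det + t * (U.updateRow j (Pi.single i 1)).det := by
    intro t
    have e : U + t • Matrix.single j i (1 : ℂ) = U.updateRow j (U j + t • Pi.single i 1) := by
      ext k l
      by_cases hk : k = j
      · subst hk
        simp [Matrix.single_apply, Pi.single_apply, eq_comm]
      · simp [Matrix.updateRow_ne hk, Ne.symm hk]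
    rw [e, Matrix.det_updateRow_add, Matrix.det_updateRow_smul, Matrix.updateRow_eq_self]
  simp only [h]
  simpa using (((hasDerivAt_id (0 : ℂ)).mul_const
    (U.updateRow j (Pi.single i 1)).det).const_add U.det).sub_const s

end Calculus

/-! ### Casimir functions -/

lemma comm_adjugate (U : Mat m) : comm U.adjugate U = 0 := by
  rw [comm, Matrix.adjugate_mul, Matrix.mul_adjugate, sub_self]

lemma dualBracket_det_left (f : Mat m → ℂ) (U : Mat m) (s : ℂ) :
    dualBracket (fun V => V.det - s) f U = 0 := by
  rw [dualBracket, grad_det_sub_const, comm_adjugate, rPlus_eq, map_zero]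
  simp [form]

lemma dualBracket_det_right (f : Mat m → ℂ) (U : Mat m) (s : ℂ) :
    dualBracket f (fun V => V.det - s) U = 0 := by
  rw [dualBracket, grad_det_sub_const, comm_adjugate, Matrix.adjugate_mul, form_smul_right,
    form_one_right, comm, Matrix.trace_sub, Matrix.trace_mul_comm (grad f U), sub_self]
  simp [form]

lemma numer_eval_zero (c : Coeffs m) : (numer c).eval 0 = c (Sum.inr 0) := by
  rw [← Polynomial.coeff_zero_eq_eval_zero]
  exact coeff_vecPoly (numerVec c) 0

lemma partialDeriv_const_sub_numer (c : Coeffs m) (s : ℂ) :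
    partialDeriv (fun c : Coeffs m => s - (numer c).eval 0) c = -Pi.single (Sum.inr 0) 1 := by
  ext a
  have h : HasFDerivAt (fun c : Coeffs m => s - (numer c).eval 0)
      (-(ContinuousLinearMap.proj (R := ℂ) (φ := fun _ : Fin m ⊕ Fin (m + 1) => ℂ)
        (Sum.inr 0))) c := by
    simp only [numer_eval_zero]
    exact (hasFDerivAt_apply _ _).const_sub s
  rw [partialDeriv, h.fderiv]
  simp [Pi.single_apply, eq_comm]

lemma ratBracket_numer_left {c : Coeffs m} (hc : c ∈ RatSet m) (f : Coeffs m → ℂ) (s : ℂ) :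
    ratBracket (fun c => s - (numer c).eval 0) f c = 0 := by
  rw [ratBracket_eq hc, partialDeriv_const_sub_numer, ← ratBilin_apply, map_neg,
    LinearMap.neg_apply, ratBilin_apply, ratBivector_single_left, neg_zero]

lemma ratBracket_numer_right {c : Coeffs m} (hc : c ∈ RatSet m) (f : Coeffs m → ℂ) (s : ℂ) :
    ratBracket f (fun c => s - (numer c).eval 0) c = 0 := by
  rw [ratBracket_eq hc, ratBivector_swap, ← ratBracket_eq hc, ratBracket_numer_left hc, neg_zero]

/-! ### The Poisson maps -/

lemma isPoissonMapOn_psiOne (m : ℕ) :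
    IsPoissonMapOn (domOne m) (GLSet m) bracket negDualBracket psiOne where
  mapsTo X hX := by
    change (psiOne X).det ≠ 0
    rw [det_psiOne hX.1 hX.2.1 hX.2.2]
    exact div_ne_zero hX.2.2 hX.2.1
  differentiableAt X hX := differentiableAt_psiOne hX
  bracket_comp X hX f g hf hg := by
    rw [bracket_eq_bivector, grad_comp_psiOne hX hf, grad_comp_psiOne hX hg, bivector_pullOne hX]
    rfl

lemma isPoissonMapOn_psiTwo (m : ℕ) :
    IsPoissonMapOn (domTwo m) (RatSet m) bracket ratBracket psiTwo where
  mapsTo X hX := hX.2.2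
  differentiableAt X hX := differentiableAt_psiTwo hX.2.1
  bracket_comp X hX f g hf hg := by
    rw [bracket_eq_bivector, grad_comp_psiTwo hX.2.1 hf, grad_comp_psiTwo hX.2.1 hg,
      bivector_pullTwo hX.2.1, ratBracket_eq hX.2.2]

lemma isPoissonMapOn_psi (m : ℕ) :
    IsPoissonMapOn (domOne m ∩ domTwo m) (fibreProduct m) bracket prodBracket psi where
  mapsTo X hX := by
    refine ⟨(isPoissonMapOn_psiOne m).mapsTo hX.1, hX.2.2.2, ?_⟩
    rw [numer_eval_zero]
    exact det_psiOne hX.1.1 hX.1.2.1 hX.1.2.2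
  differentiableAt X hX := differentiableAt_psi hX.1
  bracket_comp X hX f g hf hg := by
    rw [bracket_eq_bivector, grad_comp_psi hX.1 hf, grad_comp_psi hX.1 hg, bivector_add_left,
      bivector_add_right, bivector_add_right, bivector_pullOne hX.1,
      bivector_pullTwo hX.1.2.1, bivector_pullOne_pullTwo hX.1, bivector_pullTwo_pullOne hX.1,
      add_zero, zero_add, ← ratBracket_eq hX.2.2.2]
    rfl

lemma prodBracket_casimir {z : Mat m × Coeffs m} (hz : z.2 ∈ RatSet m)
    (f : Mat m × Coeffs m → ℂ) :
    prodBracket (fun w => w.1.det - (numer w.2).eval 0) f z = 0 ∧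
      prodBracket f (fun w => w.1.det - (numer w.2).eval 0) z = 0 := by
  constructor
  · simp only [prodBracket, negDualBracket, dualBracket_det_left, ratBracket_numer_left hz,
      neg_zero, add_zero]
  · simp only [prodBracket, negDualBracket, dualBracket_det_right, ratBracket_numer_right hz,
      neg_zero, add_zero]

end CremmerGervais

end

theorem mainTheorem3 (m : ℕ) (hm : 2 ≤ m) :
    -- (i)
    CremmerGervais.IsPoissonMapOn (CremmerGervais.domOne m) (CremmerGervais.GLSet m)
      CremmerGervais.bracket CremmerGervais.negDualBracket CremmerGervais.psiOne ∧
    -- (ii)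
    CremmerGervais.IsPoissonMapOn (CremmerGervais.domTwo m) (CremmerGervais.RatSet m)
      CremmerGervais.bracket CremmerGervais.ratBracket CremmerGervais.psiTwo ∧
    -- (iii) the function `det U - q(0)` cutting out the fibre product is a Casimir, so the product
    -- bracket descends to the fibre product, and the combined map into it is Poisson
    (∀ z ∈ CremmerGervais.fibreProduct m, ∀ f : CremmerGervais.Mat m × CremmerGervais.Coeffs m → ℂ,
      DifferentiableAt ℂ f z →
        CremmerGervais.prodBracket
          (fun w => w.1.det - (CremmerGervais.numer w.2).eval 0) f z = 0 ∧
        CremmerGervais.prodBracket f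
          (fun w => w.1.det - (CremmerGervais.numer w.2).eval 0) z = 0) ∧
    CremmerGervais.IsPoissonMapOn (CremmerGervais.domOne m ∩ CremmerGervais.domTwo m)
      (CremmerGervais.fibreProduct m)
      CremmerGervais.bracket CremmerGervais.prodBracket CremmerGervais.psi := by
  exact ⟨CremmerGervais.isPoissonMapOn_psiOne m, CremmerGervais.isPoissonMapOn_psiTwo m,
    fun _ hz f _ => CremmerGervais.prodBracket_casimir hz.2.1 f,
    CremmerGervais.isPoissonMapOn_psi m⟩
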